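/- Inclusion logic $\mathrm{FO}(\subseteq)$ over a vocabulary $\tau$ (finitely many function and relation symbols) has the formulas $$\psi ::= t_1=t_2 \mid t_1\neq t_2 \mid R(\mathbf t)\mid \neg R(\mathbf t)\mid \mathbf t\subseteq\mathbf u\mid \psi\wedge\psi\mid\psi\vee\psi\mid\exists x\,\psi\mid\forall x\,\psi ,$$ where in $\mathbf t\subseteq\mathbf u$ the two tuples of terms have the same length. A team $T$ with domain $X$ in a $\tau$-structure $\mathcal A$ with universe $A$ is a set of assignments $s\colon X\to A$. Truth $\mathcal A,T\models\psi$ is defined as follows. A literal $t_1=t_2$, $t_1\neq t_2$, $R(\mathbf t)$ or $\neg R(\mathbf t)$ holds if it holds under every $s\in T$; $\mathbf t\subseteq\mathbf u$ holds if for every $s_1\in T$ there is $s_2\in T$ with $\mathbf t^{\mathcal A}\langle s_1\rangle=\mathbf u^{\mathcal A}\langle s_2\rangle$; $\psi_0\wedge\psi_1$ holds if both conjuncts hold; $\psi_0\vee\psi_1$ holds if $T=T_0\cup T_1$ with $\mathcal A,T_i\models\psi_i$ for $i=0,1$; $\exists x\,\psi$ holds if $\psi$ holds in $\{s^x_a\mid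 s\in T,\ a\in f(s)\}$ for some $f\colon T\to\mathcal P(A)\setminus\{\emptyset\}$; $\forall x\,\psi$ holds if $\psi$ holds in $\{s^x_a\mid s\in T,\ a\in A\}$. Here $s^x_a$ is $s$ with the value at $x$ set to $a$. For a fixed formula $\varphi\in\mathrm{FO}(\subseteq)$, the parameterized problem $\text{p-}\mathrm{WT}_\varphi$ asks, given a finite non-empty $\tau$-structure $\mathcal A$ (encoded as a binary word by its size in unary and the truth tables of its relations and of the graphs of its functions) and the parameter $k\in\mathbb N$, whether there is a team $T$ whose domain is the set of free variables of $\varphi$ such that $|T|=k$ and $\mathcal A,T\models\varphi$. A parameterized problem is a set $P\subseteq\Sigma^*\times\mathbb N$ with $\Sigma$ a finite alphabet. It is in $\mathrm W[\mathrm P]$ if it is decided by a nondeterministic Turing machine all of whose runs on an instance $(x,k)$ have at most $f(k)\cdot|x|^{O(1)}$ steps, at most $h(k)\cdot\log|x|$ of them nondeterministic, for some computable functions $f,h$ (for $|x|\le 1$ the factors $|x|$ and $\log|x|$ are read as positive constants). An fpt-reduction from $P$ to $Q$ is a map $(x,k)\mapsto(x',k')$, computable by a deterministic Turing machine in time $f(k)\cdot|x|^{O(1)}$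 with $f$ computable, such that $(x,k)\in P\Leftrightarrow(x',k')\in Q$ and $k'\le g(k)$ for a computable function $g$. For a class $\mathcal C$ of parameterized problems, $[\mathcal C]^{\mathrm{FPT}}$ is the class of all parameterized problems that are fpt-reducible to some problem in $\mathcal C$, and $\text{p-}\mathrm{WT}\text{-}\mathrm{FO}(\subseteq)$ is the class of all problems $\text{p-}\mathrm{WT}_\varphi$ with $\varphi\in\mathrm{FO}(\subseteq)$. **Theorem.** For every formula $\varphi\in\mathrm{FO}(\subseteq)$: 1. $\text{p-}\mathrm{WT}_\varphi\in\mathrm W[\mathrm P]$; 2. moreover, $\text{p-}\mathrm{WT}_\varphi$ is decided by a nondeterministic Turing machine with binary choices that runs in time polynomial in $|x|+k$ on every instance $(x,k)$ and makes at most $O(k\cdot\log|A|)$ nondeterministic steps on each run on an instance $(\mathcal A,k)$, all its other steps being deterministic; the constants depend only on $\varphi$. Consequently, $$[\text{p-}\mathrm{WT}\text{-}\mathrm{FO}(\subseteq)]^{\mathrm{FPT}}\subseteq\mathrm W[\mathrm P].$$ -/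

import Mathlib

/-! ## Parameterized problems -/

/-- A parameterized problem: a subset of `Σ* × ℕ` for a finite alphabet `Σ`. -/
structure ParamProblem where
  alphabet : Type
  [fin : Finite alphabet]
  lang : Set (List alphabet × ℕ)

/-- An instance `(x, k)` as one word: `x` followed by `k` copies of an extra symbol. As resource
bounds may depend on `k` in an arbitrary computable way, it does not matter that `k` is written
in unary. -/
def encodeInstance {α : Type} (p : List α × ℕ) : List (Option α) :=
  p.1.map some ++ List.replicate p.2 none

/-! ## Nondeterministic Turing machines -/

/-- A nondeterministic Turing machine with input alphabet `α`: one of Mathlib's multi-stack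
machines (every stack having a finite alphabet) with a second program `m'` beside the program `m`
of `FinTM2`. In every step the machine follows either of its two programs. It accepts by halting
in an accepting internal state; the output stack `k₁` plays no role. -/
structure NTM (α : Type) extends Turing.FinTM2 where
  m' : Λ → Turing.TM2.Stmt Γ Λ σ
  finite_stack_alphabet : ∀ k, Finite (Γ k)
  inputAlphabet : Γ k₀ ≃ α
  accept : σ → Bool

namespace NTM

variable {α : Type} (M : NTM α)

/-- One step with choice `b`; the value is `none` exactly at halted configurations. -/
def step (b : Bool) (c : M.toFinTM2.Cfg) : Option M.toFinTM2.Cfg :=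
  Turing.TM2.step (if b then M.m' else M.m) c

/-- The configuration after `t` steps on input `w`, where `ω t` is the choice in step `t`.
Halted configurations are repeated for ever. -/
def run (w : List α) (ω : ℕ → Bool) : ℕ → M.toFinTM2.Cfg
  | 0 => Turing.initList M.toFinTM2 (w.map M.inputAlphabet.symm)
  | t + 1 => (M.step (ω t) (run w ω t)).getD (run w ω t)

/-- The machine has halted: there is no next instruction. -/
def Halted (c : M.toFinTM2.Cfg) : Prop :=
  Turing.TM2.Cfg.l c = none

/-- A configuration with more than one successor, i.e. the next step is nondeterministic. -/
def Branching (c : M.toFinTM2.Cfg) : Prop :=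
  M.step false c ≠ M.step true c

/-- Some run on `w` halts in an accepting state. -/
def Accepts (w : List α) : Prop :=
  ∃ ω t, M.Halted (M.run w ω t) ∧ M.accept (Turing.TM2.Cfg.var (M.run w ω t)) = true

/-- Every run on `w` halts after at most `T` steps. -/
def HaltsWithin (w : List α) (T : ℕ) : Prop :=
  ∀ ω, M.Halted (M.run w ω T)

/-- Every run on `w` makes at most `B` nondeterministic steps. -/
def NondetStepsWithin (w : List α) (B : ℕ) : Prop :=
  ∀ ω, {t | M.Branching (M.run w ω t)}.encard ≤ B

end NTM

/-- The class `W[P]`: problems decided by a nondeterministic Turing machine all of whose runs take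
at most `f(k) · |x|^O(1)` steps, at most `h(k) · log |x|` of which are nondeterministic, with
`f, h` computable. (The shifts `|x| + 1` and `|x| + 2` only keep the bounds from vanishing for
`|x| ≤ 1`; they do not change the class.) -/
def WP : Set ParamProblem :=
  {P | ∃ (M : NTM (Option P.alphabet)) (f h : ℕ → ℕ) (c : ℕ), Computable f ∧ Computable h ∧
    ∀ (x : List P.alphabet) (k : ℕ),
      (M.Accepts (encodeInstance (x, k)) ↔ (x, k) ∈ P.lang) ∧
      M.HaltsWithin (encodeInstance (x, k)) (f k * (x.length + 1) ^ c) ∧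
      M.NondetStepsWithin (encodeInstance (x, k)) (h k * Nat.log 2 (x.length + 2))}

/-! ## fpt-reductions -/

/-- `F` is computed by a deterministic Turing machine (with finite stack alphabets) in time
`f(k) · |x|^O(1)` for a computable function `f`. -/
def FPTComputable {α β : Type} (F : List α × ℕ → List β × ℕ) : Prop :=
  ∃ (M : Turing.TM2ComputableAux (Option α) (Option β)) (f : ℕ → ℕ) (c : ℕ),
    (∀ i, Finite (M.tm.Γ i)) ∧ Computable f ∧
    ∀ (x : List α) (k : ℕ),
      Nonempty (Turing.TM2OutputsInTime M.tm
        ((encodeInstance (x, k)).map M.inputAlphabet.symm)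
        (some ((encodeInstance (F (x, k))).map M.outputAlphabet.symm))
        (f k * (x.length + 1) ^ c))

/-- `P` is fpt-reducible to `Q`. -/
def FPTReducible (P Q : ParamProblem) : Prop :=
  ∃ F : List P.alphabet × ℕ → List Q.alphabet × ℕ, FPTComputable F ∧
    (∀ p, p ∈ P.lang ↔ F p ∈ Q.lang) ∧
    ∃ g : ℕ → ℕ, Computable g ∧ ∀ p, (F p).2 ≤ g p.2

/-- `[𝒞]^FPT`, the closure of a class of parameterized problems under fpt-reductions. -/
def fptClosure (𝒞 : Set ParamProblem) : Set ParamProblem :=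
  {P | ∃ Q ∈ 𝒞, FPTReducible P Q}

/-! ## Inclusion logic -/

/-- Formulas of inclusion logic `FO(⊆)` over the vocabulary `L` (in negation normal form), with
first-order variables `ℕ`. -/
inductive InclusionFormula (L : FirstOrder.Language.{0, 0}) : Type
  | eq (t u : L.Term ℕ)
  | neq (t u : L.Term ℕ)
  | rel {r : ℕ} (R : L.Relations r) (t : Fin r → L.Term ℕ)
  | nrel {r : ℕ} (R : L.Relations r) (t : Fin r → L.Term ℕ)
  | incl {m : ℕ} (t u : Fin m → L.Term ℕ)
  | and (φ ψ : InclusionFormula L)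
  | or (φ ψ : InclusionFormula L)
  | ex (x : ℕ) (φ : InclusionFormula L)
  | all (x : ℕ) (φ : InclusionFormula L)

/-- A team with domain `X` over `A` is a set of assignments `X → A`. -/
abbrev Team (X : Finset ℕ) (A : Type) : Type := Set (X → A)

namespace Team

variable {X : Finset ℕ} {A : Type}

/-- The assignment `s` with the value at `x` set to `a`. -/
def update (s : X → A) (x : ℕ) (a : A) : ↥(insert x X) → A :=
  fun v => if h : v.1 = x then a else s ⟨v.1, Finset.mem_of_mem_insert_of_ne v.2 h⟩

/-- The supplemented team: `s` with `x` set to `a`, for all `s ∈ T` and `a ∈ f s`. -/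
def supplement (T : Team X A) (x : ℕ) (f : T → Set A) : Team (insert x X) A :=
  {s' | ∃ s : T, ∃ a ∈ f s, s' = update s.1 x a}

/-- The value of a term under `s : X → A`. Variables outside `X`, which do not occur in terms
evaluated by a formula with free variables in `X`, get an arbitrary value. -/
noncomputable def value {L : FirstOrder.Language.{0, 0}} [Nonempty A] [L.Structure A] (s : X → A)
    (t : L.Term ℕ) : A :=
  t.realize fun v => if h : v ∈ X then s ⟨v, h⟩ else Classical.arbitrary A

end Team

namespace InclusionFormula

variable {L : FirstOrder.Language.{0, 0}}

/-- The free variables of a formula. -/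
def freeVars : InclusionFormula L → Finset ℕ
  | eq t u => t.varFinset ∪ u.varFinset
  | neq t u => t.varFinset ∪ u.varFinset
  | rel _ t => Finset.univ.biUnion fun i => (t i).varFinset
  | nrel _ t => Finset.univ.biUnion fun i => (t i).varFinset
  | incl t u => Finset.univ.biUnion fun i => (t i).varFinset ∪ (u i).varFinset
  | and φ ψ => φ.freeVars ∪ ψ.freeVars
  | or φ ψ => φ.freeVars ∪ ψ.freeVars
  | ex x φ => φ.freeVars.erase x
  | all x φ => φ.freeVars.erase x

/-- Team semantics: `Sat A φ X T` says that the team `T` with domain `X` satisfies `φ` in `A`. -/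
def Sat (A : Type) [Nonempty A] [L.Structure A] :
    InclusionFormula L → (X : Finset ℕ) → Team X A → Prop
  | eq t u, _, T => ∀ s ∈ T, Team.value s t = Team.value s u
  | neq t u, _, T => ∀ s ∈ T, Team.value s t ≠ Team.value s u
  | rel R t, _, T => ∀ s ∈ T, FirstOrder.Language.Structure.RelMap R fun i => Team.value s (t i)
  | nrel R t, _, T => ∀ s ∈ T, ¬ FirstOrder.Language.Structure.RelMap R fun i => Team.value s (t i)
  | incl t u, _, T =>
      ∀ s₁ ∈ T, ∃ s₂ ∈ T, ∀ i, Team.value s₁ (t i) = Team.value s₂ (u i)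
  | and φ ψ, X, T => Sat A φ X T ∧ Sat A ψ X T
  | or φ ψ, X, T => ∃ T₀ T₁ : Team X A, T₀ ∪ T₁ = T ∧ Sat A φ X T₀ ∧ Sat A ψ X T₁
  | ex x φ, X, T =>
      ∃ f : T → Set A, (∀ s, (f s).Nonempty) ∧ Sat A φ (insert x X) (T.supplement x f)
  | all x φ, X, T => Sat A φ (insert x X) (T.supplement x fun _ => Set.univ)

end InclusionFormula

/-! ## Weighted team definability -/

/-- The truth table of an `r`-ary relation on `{0, …, n - 1}`: a list of `n ^ r` bits, the bit for
the tuple `a` standing at position `∑ i, a i * n ^ i`. -/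
noncomputable def relationTable {n r : ℕ} (R : (Fin r → Fin n) → Prop) : List Bool :=
  open Classical in List.ofFn fun i : Fin (n ^ r) => decide (R (finFunctionFinEquiv.symm i))

/-- The usual encoding of a structure with domain `{0, …, n - 1}` over a finite vocabulary whose
symbols are enumerated: the word `1ⁿ0`, the tables of all relations, and the tables of the graphs
`{(a₁, …, a_r, b) | f(a₁, …, a_r) = b}` of all functions. -/
noncomputable def encodeStructure (L : FirstOrder.Language.{0, 0})
    [FinEnum (Σ r, L.Functions r)] [FinEnum (Σ r, L.Relations r)]
    (n : ℕ) [L.Structure (Fin n)] : List Bool :=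
  List.replicate n true ++ [false] ++
  (FinEnum.toList (Σ r, L.Relations r)).flatMap (fun R =>
    relationTable fun a : Fin R.1 → Fin n => FirstOrder.Language.Structure.RelMap R.2 a) ++
  (FinEnum.toList (Σ r, L.Functions r)).flatMap (fun f =>
    relationTable fun a : Fin (f.1 + 1) → Fin n =>
      FirstOrder.Language.Structure.funMap f.2 (fun i => a i.castSucc) = a (Fin.last f.1))

/-- The problem `p-WT_φ`: given a finite (non-empty) structure `A` and the parameter `k`, is there
a team over the free variables of `φ` that has exactly `k` elements and satisfies `φ` in `A`? -/
noncomputable def pWT {L : FirstOrder.Language.{0, 0}}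
    [FinEnum (Σ r, L.Functions r)] [FinEnum (Σ r, L.Relations r)]
    (φ : InclusionFormula L) : ParamProblem where
  alphabet := Bool
  lang := {p | ∃ (n : ℕ) (_ : NeZero n) (_ : L.Structure (Fin n)),
    p.1 = encodeStructure L n ∧
    ∃ T : Team φ.freeVars (Fin n), T.ncard = p.2 ∧ φ.Sat (Fin n) φ.freeVars T}

/-- The class `p-WT-FO(⊆)` of all problems `p-WT_φ`, for inclusion logic formulas `φ` over finite
vocabularies. -/
def pWTInclusion : Set ParamProblem :=
  {P | ∃ (L : FirstOrder.Language.{0, 0}) (_ : FinEnum (Σ r, L.Functions r))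
    (_ : FinEnum (Σ r, L.Relations r)) (φ : InclusionFormula L), P = pWT φ}

/-! Inclusion logic is closed under unions of teams: if all members of a family of teams satisfy
`φ`, so does their union (`Sat.sUnion`). Hence every team `T` has a largest subteam satisfying `φ`,
namely `maxTeam φ X T`, and `T` satisfies `φ` exactly if this subteam is all of `T` (`sat_iff`). For
a fixed formula it is computed in polynomial time by recursion on `φ`. Literals filter the team; a
disjunction yields the union of two largest subteams; an existential quantifier needs one evaluation
on the fully supplemented team; conjunctions, inclusion atoms and universal quantifiers iterate a
decreasing monotone operator, which is stationary after at most `|A| ^ |X|` rounds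
(`iterate_eq_sUnion`, `computesTeam_maxTeam`).

A team of size `k` over the variables `X` amounts to `k` distinct rows of `|X|` elements, that is,
to at most `|X| * k * clog |A|` binary digits. It suffices to guess these digits and then to check
deterministically that the rows describe `k` distinct assignments and that their team is contained
in its largest satisfying subteam. The word for `(𝒜, k)` has length `|x| + k`, so polynomial time in
this length is what is claimed.

Much of the work is to carry this out on an actual machine. Structured programs over stacks are
compiled to machines step by step (`Exec.trace`). They are used to maintain bit tapes, addressed by
tuples over a domain slightly larger than the input. Predicates obtained from tape contents and
arithmetic on addresses by first-order operations are decidable in polynomial time (`Definable`),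
and so are assignments of such predicates to tapes and their polynomial iterations computable
(`Computes`). The symbols that write `k` in unary serve as names of the rows. A guess is a subset of
a prepared tape of candidate positions, and a bit is guessed only at the candidates, so that the
number of nondeterministic steps is the number of candidates (`exec_guessTape`,
`Prepared.encard_le`). These pieces meet in `exists_guess_machine` and `exists_pWT_machine`.

For the closure under fpt-reductions the machine is run on the output of the reduction
(`NTM.exists_comp`). The new parameter is at most `g k`, and the new universe has size at most `G k
* (|x| + 1) ^ (a + 1)`. Its logarithm is bounded by a computable function of `k` times `log |x|`,
which keeps the number of guesses within the limits of `WP`. -/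

/-! ## Structured programs over stacks -/

namespace StackProgram

open Turing Function

/-- Stack symbols. -/
abbrev Sym := Option Bool

/-- The internal state: the last symbol read and a flag. -/
abbrev Reg := Option Sym × Bool

/-- A state of a structured program. -/
structure St (K : Type) where
  reg : Reg
  stk : K → List Sym

/-- Elementary operations. -/
inductive Op (K : Type)
  | push (k : K) (f : Reg → Sym)
  | pushOpt (k : K) (f : Reg → Option Sym)
  | pop (k : K)
  | peek (k : K)
  | load (f : Reg → Reg)

/-- Structured programs: a list of operations (or one of two, chosen nondeterministically) is
performed in one step of a machine. -/
inductive Prog (K : Type)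
  | act (l : List (Op K))
  | guess (l : Bool → List (Op K))
  | seq (p q : Prog K)
  | cond (c : Reg → Bool) (p q : Prog K)
  | loop (c : Reg → Bool) (p : Prog K)

variable {K : Type} [DecidableEq K]

/-- `pushOpt` serves the left end of a tape: popping an empty left half yields `none`, and then
nothing must be pushed on the right half. -/
def Op.run : Op K → St K → St K
  | push k f, s => ⟨s.reg, update s.stk k (f s.reg :: s.stk k)⟩
  | pushOpt k f, s => ⟨s.reg, update s.stk k ((f s.reg).toList ++ s.stk k)⟩
  | pop k, s => ⟨((s.stk k).head?, s.reg.2), update s.stk k (s.stk k).tail⟩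
  | peek k, s => ⟨((s.stk k).head?, s.reg.2), s.stk⟩
  | load f, s => ⟨f s.reg, s.stk⟩

def runOps : List (Op K) → St K → St K
  | [], s => s
  | o :: l, s => runOps l (o.run s)

/-- `Exec π p t s t' s' g`: started at time `t` in state `s`, the program `p` stops at time `t'` in
state `s'` after `g` guesses, if guesses are made according to the policy `π`. -/
inductive Exec (π : ℕ → St K → Bool) : Prog K → ℕ → St K → ℕ → St K → ℕ → Prop
  | act (l t s) : Exec π (.act l) t s (t + 1) (runOps l s) 0
  | guess (l t s) : Exec π (.guess l) t s (t + 1) (runOps (l (π t s)) s) 1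
  | seq {p q t s t' s' g t'' s'' g'} : Exec π p t s t' s' g → Exec π q t' s' t'' s'' g' →
      Exec π (.seq p q) t s t'' s'' (g + g')
  | cond_true {c p q t s t' s' g} : c s.reg = true → Exec π p (t + 1) s t' s' g →
      Exec π (.cond c p q) t s t' s' g
  | cond_false {c p q t s t' s' g} : c s.reg = false → Exec π q (t + 1) s t' s' g →
      Exec π (.cond c p q) t s t' s' g
  | loop_true {c p t s t' s' g t'' s'' g'} : c s.reg = true → Exec π p (t + 1) s t' s' g →
      Exec π (.loop c p) t' s' t'' s'' g' → Exec π (.loop c p) t s t'' s'' (g + g')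
  | loop_false {c p t s} : c s.reg = false → Exec π (.loop c p) t s (t + 1) s 0

def Op.stack : Op K → Finset K
  | push k _ => {k}
  | pushOpt k _ => {k}
  | pop k => {k}
  | peek k => {k}
  | load _ => ∅

/-- The stacks that occur in a list of operations. -/
def opsStacks : List (Op K) → Finset K
  | [] => ∅
  | o :: l => o.stack ∪ opsStacks l

/-- The stacks that occur in a program. -/
def Prog.stacks : Prog K → Finset K
  | act l => opsStacks l
  | guess l => opsStacks (l false) ∪ opsStacks (l true)
  | seq p q => p.stacks ∪ q.stacks
  | cond _ p q => p.stacks ∪ q.stacks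
  | loop _ p => p.stacks

/-! ### The length of stacks -/

/-- A bound on the number of symbols pushed in one step. -/
def Prog.width : Prog K → ℕ
  | act l => l.length
  | guess l => (l false).length + (l true).length
  | seq p q => p.width + q.width
  | cond _ p q => p.width + q.width
  | loop _ p => p.width

theorem Op.length_run_le (o : Op K) (s : St K) (k : K) :
    ((o.run s).stk k).length ≤ (s.stk k).length + 1 := by
  cases o with
  | push j f => by_cases h : k = j <;> simp [Op.run, h]
  | pushOpt j f =>
    by_cases h : k = j
    · cases hf : f s.reg <;> simp [Op.run, h, hf]
    · simp [Op.run, h]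
  | pop j =>
    by_cases h : k = j
    · subst h; simp only [Op.run, update_self, List.length_tail]; omega
    · simp [Op.run, h]
  | peek j => simp [Op.run]
  | load f => simp [Op.run]

theorem length_runOps_le (l : List (Op K)) (s : St K) (k : K) :
    ((runOps l s).stk k).length ≤ (s.stk k).length + l.length := by
  induction l generalizing s with
  | nil => simp [runOps]
  | cons o l ih =>
    have h1 := ih (o.run s)
    have h2 := o.length_run_le s k
    simp only [runOps, List.length_cons]
    omega

/-- In one step of the clock a stack grows by at most the width of the program. Absolute times stand
on both sides so that consecutive executions combine without subtraction. A time bound for the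
preparation thereby bounds the length of the tape that is scanned while guessing. -/
theorem Exec.length_le {π : ℕ → St K → Bool} {p : Prog K} {t s t' s' g}
    (h : Exec π p t s t' s' g) (k : K) (C : ℕ) (hC : p.width ≤ C) :
    (s'.stk k).length + C * t ≤ (s.stk k).length + C * t' := by
  induction h with
  | act l t s =>
    have := length_runOps_le l s k
    simp only [Prog.width] at hC
    rw [mul_add]; omega
  | guess l t s =>
    have := length_runOps_le (l (π t s)) s k
    have h2 : (l (π t s)).length ≤ C := by
      simp only [Prog.width] at hC
      cases π t s <;> omega
    rw [mul_add]; omega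
  | seq _ _ ih1 ih2 =>
    simp only [Prog.width] at hC
    have := ih1 (by omega)
    have := ih2 (by omega)
    omega
  | cond_true _ _ ih =>
    simp only [Prog.width] at hC
    have := ih (by omega)
    rw [mul_add] at this; omega
  | cond_false _ _ ih =>
    simp only [Prog.width] at hC
    have := ih (by omega)
    rw [mul_add] at this; omega
  | loop_true _ _ _ ih1 ih2 =>
    have := ih1 hC
    have := ih2 hC
    rw [mul_add] at *; omega
  | loop_false _ => rw [mul_add]; omega

/-! ### Compilation -/

section Compile

variable (S : Finset K) {Λ : Type}

/-- Programs draw their stacks from a possibly infinite supply `K`; a machine only gets the finite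
set `S` of stacks that are mentioned. -/
abbrev MStmt (S : Finset K) (Λ : Type) := TM2.Stmt (fun _ : S => Sym) Λ Reg

abbrev MCfg (S : Finset K) (Λ : Type) := TM2.Cfg (fun _ : S => Sym) Λ Reg

def Op.stmt : Op K → MStmt S Λ → MStmt S Λ
  | push k f, q => if h : k ∈ S then .push ⟨k, h⟩ f q else q
  | pushOpt k f, q =>
    if h : k ∈ S then
      .branch (fun r => (f r).isSome) (.push ⟨k, h⟩ (fun r => (f r).getD none) q) q
    else q
  | pop k, q => if h : k ∈ S then .pop ⟨k, h⟩ (fun r a => (a, r.2)) q else q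
  | peek k, q => if h : k ∈ S then .peek ⟨k, h⟩ (fun r a => (a, r.2)) q else q
  | load f, q => .load f q

def opsStmt : List (Op K) → MStmt S Λ → MStmt S Λ
  | [], q => q
  | o :: l, q => o.stmt S (opsStmt l q)

/-- Jump to a label, or halt. -/
def exitStmt : Option Λ → MStmt S Λ
  | some l => .goto fun _ => l
  | none => .halt

/-- The labels of the machine code of a program. -/
def Prog.Label : Prog K → Type
  | act _ => Unit
  | guess _ => Unit
  | seq p q => p.Label ⊕ q.Label
  | cond _ p q => Option (p.Label ⊕ q.Label)
  | loop _ p => Option p.Label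

def Prog.entry : (p : Prog K) → p.Label
  | act _ => ()
  | guess _ => ()
  | seq p _ => .inl p.entry
  | cond _ _ _ => none
  | loop _ _ => none

omit [DecidableEq K] in
theorem Prog.finite_label : (p : Prog K) → Finite p.Label
  | act _ => inferInstanceAs (Finite Unit)
  | guess _ => inferInstanceAs (Finite Unit)
  | seq p q =>
    have := p.finite_label
    have := q.finite_label
    inferInstanceAs (Finite (p.Label ⊕ q.Label))
  | cond _ p q =>
    have := p.finite_label
    have := q.finite_label
    inferInstanceAs (Finite (Option (p.Label ⊕ q.Label)))
  | loop _ p =>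
    have := p.finite_label
    inferInstanceAs (Finite (Option p.Label))

/-- The machine code of a program, for the choice `b` in guesses. The labels are embedded by `emb`,
and `ex` is the exit. -/
def Prog.code (b : Bool) : (p : Prog K) → (p.Label → Λ) → Option Λ → p.Label → MStmt S Λ
  | act l, _, ex, _ => opsStmt S l (exitStmt S ex)
  | guess l, _, ex, _ => opsStmt S (l b) (exitStmt S ex)
  | seq p q, emb, ex, x =>
    match x with
    | .inl x => p.code b (fun y => emb (.inl y)) (some (emb (.inr q.entry))) x
    | .inr x => q.code b (fun y => emb (.inr y)) ex x
  | cond c p q, emb, ex, x =>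
    match x with
    | none => .branch c (exitStmt S (some (emb (some (.inl p.entry)))))
        (exitStmt S (some (emb (some (.inr q.entry)))))
    | some (.inl x) => p.code b (fun y => emb (some (.inl y))) ex x
    | some (.inr x) => q.code b (fun y => emb (some (.inr y))) ex x
  | loop c p, emb, ex, x =>
    match x with
    | none => .branch c (exitStmt S (some (emb (some p.entry)))) (exitStmt S ex)
    | some x => p.code b (fun y => emb (some y)) (some (emb none)) x

/-- The configuration of a machine that belongs to a state of a program. -/
def St.cfg (l : Option Λ) (s : St K) : MCfg S Λ := ⟨l, s.reg, fun k => s.stk k⟩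

variable {S}

theorem restrict_update (f : K → List Sym) {k : K} (h : k ∈ S) (v : List Sym) :
    (fun x : S => update f k v x) = update (fun x : S => f x) ⟨k, h⟩ v := by
  funext x
  by_cases hx : x.1 = k
  · have : x = ⟨k, h⟩ := Subtype.ext hx
    subst this; simp
  · have : x ≠ ⟨k, h⟩ := fun e => hx (congrArg Subtype.val e)
    simp [hx, this]

theorem stepAux_stmt (o : Op K) (ho : o.stack ⊆ S) (q : MStmt S Λ) (s : St K) :
    TM2.stepAux (o.stmt S q) s.reg (fun k => s.stk k) =
      TM2.stepAux q (o.run s).reg (fun k => (o.run s).stk k) := by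
  cases o with
  | push k f =>
    have h : k ∈ S := by simpa [Op.stack] using ho
    simp [Op.stmt, Op.run, h, restrict_update]
  | pushOpt k f =>
    have h : k ∈ S := by simpa [Op.stack] using ho
    cases hf : f s.reg <;> simp [Op.stmt, Op.run, h, hf, restrict_update]
  | pop k =>
    have h : k ∈ S := by simpa [Op.stack] using ho
    simp [Op.stmt, Op.run, h, restrict_update]
  | peek k =>
    have h : k ∈ S := by simpa [Op.stack] using ho
    simp [Op.stmt, Op.run, h]
  | load f => simp [Op.stmt, Op.run]

/-- A list of operations is compiled into a single statement that ends with a jump or with halting,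
hence it costs one machine step whatever its length. -/
theorem stepAux_opsStmt (l : List (Op K)) (hl : opsStacks l ⊆ S) (ex : Option Λ) (s : St K) :
    TM2.stepAux (opsStmt S l (exitStmt S ex)) s.reg (fun k => s.stk k) =
      (runOps l s).cfg S ex := by
  induction l generalizing s with
  | nil => cases ex <;> simp [opsStmt, exitStmt, runOps, St.cfg]
  | cons o l ih =>
    rw [opsStacks, Finset.union_subset_iff] at hl
    rw [opsStmt, stepAux_stmt o hl.1, ih hl.2, runOps]

/-- Branching configurations. -/
def Branches (m : Bool → Λ → MStmt S Λ) (c : MCfg S Λ) : Prop :=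
  TM2.step (m false) c ≠ TM2.step (m true) c

/-- The times in `[t, t')` at which `c` branches. -/
def branchTimes (m : Bool → Λ → MStmt S Λ) (c : ℕ → MCfg S Λ) (t t' : ℕ) : Set ℕ :=
  {u | t ≤ u ∧ u < t' ∧ Branches m (c u)}

theorem encard_branchTimes_le (m : Bool → Λ → MStmt S Λ) (c : ℕ → MCfg S Λ) {t t' t'' g g' : ℕ}
    (h1 : (branchTimes m c t t').encard ≤ g) (h2 : (branchTimes m c t' t'').encard ≤ g') :
    (branchTimes m c t t'').encard ≤ (g + g' : ℕ) := by
  have : branchTimes m c t t'' ⊆ branchTimes m c t t' ∪ branchTimes m c t' t'' := by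
    rintro u ⟨h, h', hb⟩
    rcases lt_or_ge u t' with hu | hu
    · exact .inl ⟨h, hu, hb⟩
    · exact .inr ⟨hu, h', hb⟩
  refine (Set.encard_le_encard this).trans ((Set.encard_union_le _ _).trans ?_)
  push_cast
  exact add_le_add h1 h2

theorem branchTimes_succ_of_not (m : Bool → Λ → MStmt S Λ) (c : ℕ → MCfg S Λ) {t : ℕ}
    (h : ¬ Branches m (c t)) : (branchTimes m c t (t + 1)).encard ≤ (0 : ℕ) := by
  have : branchTimes m c t (t + 1) = ∅ := by
    ext u
    simp only [branchTimes, Set.mem_ofPred_eq, Set.mem_empty_iff_false, iff_false]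
    rintro ⟨h1, h2, h3⟩
    obtain rfl : u = t := by omega
    exact h h3
  simp [this]

theorem branchTimes_succ (m : Bool → Λ → MStmt S Λ) (c : ℕ → MCfg S Λ) {t : ℕ} :
    (branchTimes m c t (t + 1)).encard ≤ (1 : ℕ) := by
  have : branchTimes m c t (t + 1) ⊆ {t} := by
    rintro u ⟨h1, h2, -⟩
    simp only [Set.mem_singleton_iff]; omega
  exact (Set.encard_le_encard this).trans (by simp)

/-- The machine code follows the executions of the program. -/
theorem Exec.trace {π : ℕ → Reg → (S → List Sym) → Bool} {p : Prog K} {t s t' s' g}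
    (h : Exec (fun t (s : St K) => π t s.reg fun k => s.stk k) p t s t' s' g)
    {m : Bool → Λ → MStmt S Λ} {c : ℕ → MCfg S Λ}
    (hc : ∀ t, c (t + 1) = (TM2.step (m (π t (c t).var (c t).stk)) (c t)).getD (c t))
    {emb : p.Label → Λ} {ex : Option Λ} (hm : ∀ b l, m b (emb l) = p.code S b emb ex l)
    (hS : p.stacks ⊆ S) (h0 : c t = s.cfg S (some (emb p.entry))) :
    c t' = s'.cfg S ex ∧ (branchTimes m c t t').encard ≤ g := by
  have next : ∀ {t : ℕ} {s : St K} {l : Λ} {q : MStmt S Λ} {d : MCfg S Λ},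
      c t = s.cfg S (some l) → m (π t s.reg fun k => s.stk k) l = q →
      TM2.stepAux q s.reg (fun k => s.stk k) = d → c (t + 1) = d := by
    intro t s l q d h hq hd
    rw [hc, h]
    simp only [St.cfg, TM2.step, Option.getD_some]
    rw [hq, hd]
  -- Except at guesses, the two codes have the same statement at a label, so both choices lead to
  -- the same configuration.
  have det : ∀ {t : ℕ} {s : St K} {l : Λ} {q : MStmt S Λ},
      c t = s.cfg S (some l) → (∀ b, m b l = q) → ¬ Branches m (c t) := by
    intro t s l q h hq
    simp [Branches, h, St.cfg, hq]
  induction h generalizing ex with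
  | act l t s =>
    exact ⟨next h0 (hm _ _) (stepAux_opsStmt l hS ex s),
      branchTimes_succ_of_not _ _ (det h0 fun b => hm b _)⟩
  | guess l t s =>
    refine ⟨next h0 (hm _ _) (stepAux_opsStmt _ (subset_trans ?_ hS) ex s), branchTimes_succ _ _⟩
    rw [Prog.stacks]
    cases π t s.reg (fun k => s.stk k)
    · exact Finset.subset_union_left
    · exact Finset.subset_union_right
  | @seq p q t s t' s' g t'' s'' g' _ _ ih1 ih2 =>
    rw [Prog.stacks, Finset.union_subset_iff] at hS
    obtain ⟨h1, e1⟩ := ih1 (emb := fun y => emb (.inl y)) (ex := some (emb (.inr q.entry)))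
      (fun b l => hm b (.inl l)) hS.1 h0
    obtain ⟨h2, e2⟩ := ih2 (emb := fun y => emb (.inr y)) (ex := ex)
      (fun b l => hm b (.inr l)) hS.2 h1
    exact ⟨h2, encard_branchTimes_le _ _ e1 e2⟩
  | @cond_true r p q t s t' s' g hr _ ih =>
    rw [Prog.stacks, Finset.union_subset_iff] at hS
    have h1 : c (t + 1) = s.cfg S (some (emb (some (.inl p.entry)))) :=
      next h0 (q := .branch r (exitStmt S (some (emb (some (.inl p.entry)))))
        (exitStmt S (some (emb (some (.inr q.entry)))))) (hm _ none)
        (by simp only [TM2.stepAux, hr]; rfl)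
    obtain ⟨h2, e2⟩ := ih (emb := fun y => emb (some (.inl y))) (ex := ex)
      (fun b l => hm b (some (.inl l))) hS.1 h1
    refine ⟨h2, ?_⟩
    rw [← zero_add g]
    exact encard_branchTimes_le _ _ (branchTimes_succ_of_not _ _ (det h0 fun b => hm b none)) e2
  | @cond_false r p q t s t' s' g hr _ ih =>
    rw [Prog.stacks, Finset.union_subset_iff] at hS
    have h1 : c (t + 1) = s.cfg S (some (emb (some (.inr q.entry)))) :=
      next h0 (q := .branch r (exitStmt S (some (emb (some (.inl p.entry)))))
        (exitStmt S (some (emb (some (.inr q.entry)))))) (hm _ none)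
        (by simp only [TM2.stepAux, hr]; rfl)
    obtain ⟨h2, e2⟩ := ih (emb := fun y => emb (some (.inr y))) (ex := ex)
      (fun b l => hm b (some (.inr l))) hS.2 h1
    refine ⟨h2, ?_⟩
    rw [← zero_add g]
    exact encard_branchTimes_le _ _ (branchTimes_succ_of_not _ _ (det h0 fun b => hm b none)) e2
  | @loop_true r p t s t' s' g t'' s'' g' hr _ _ ih1 ih2 =>
    have h1 : c (t + 1) = s.cfg S (some (emb (some p.entry))) :=
      next h0 (q := .branch r (exitStmt S (some (emb (some p.entry)))) (exitStmt S ex))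
        (hm _ none) (by simp only [TM2.stepAux, hr]; rfl)
    -- The body of a loop exits to the label of the loop test.
    obtain ⟨h2, e2⟩ := ih1 (emb := fun y => emb (some y)) (ex := some (emb none))
      (fun b l => hm b (some l)) hS h1
    obtain ⟨h3, e3⟩ := ih2 hm hS h2
    refine ⟨h3, encard_branchTimes_le _ _ ?_ e3⟩
    rw [← zero_add g]
    exact encard_branchTimes_le _ _ (branchTimes_succ_of_not _ _ (det h0 fun b => hm b none)) e2
  | @loop_false r p t s hr =>
    refine ⟨next h0 (q := .branch r (exitStmt S (some (emb (some p.entry)))) (exitStmt S ex))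
        (hm _ none) ?_, branchTimes_succ_of_not _ _ (det h0 fun b => hm b none)⟩
    simp only [TM2.stepAux, hr]
    cases ex <;> rfl

end Compile

/-- The machine of a program with input stack `inp`; it accepts by its flag. -/
noncomputable def Prog.toNTM (p : Prog K) (inp : K) : NTM Sym where
  K := (insert inp p.stacks : Finset K)
  k₀ := ⟨inp, Finset.mem_insert_self _ _⟩
  k₁ := ⟨inp, Finset.mem_insert_self _ _⟩
  Γ := fun _ => Sym
  Λ := p.Label
  main := p.entry
  ΛFin := @Fintype.ofFinite _ p.finite_label
  σ := Reg
  initialState := (none, false)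
  m := p.code _ false id none
  m' := p.code _ true id none
  finite_stack_alphabet := fun _ => inferInstanceAs (Finite Sym)
  inputAlphabet := Equiv.refl _
  accept := fun r => r.2

/-- The initial state on input `w`. -/
def St.init (inp : K) (w : List Sym) : St K := ⟨(none, false), update (fun _ => []) inp w⟩

theorem Prog.run_zero (p : Prog K) (inp : K) (w : List Sym) (ω : ℕ → Bool) :
    (p.toNTM inp).run w ω 0 =
      (St.init inp w).cfg (insert inp p.stacks : Finset K) (some p.entry) := by
  have : List.map (⇑(p.toNTM inp).inputAlphabet.symm) w = w := List.map_id w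
  rw [NTM.run, this]
  unfold initList St.cfg St.init
  congr 1
  funext k
  by_cases hk : k.1 = inp
  · have : k = (p.toNTM inp).k₀ := Subtype.ext hk
    rw [dif_pos this]
    subst this
    simp [hk]
    rfl
  · have : k ≠ (p.toNTM inp).k₀ := fun h => hk (congrArg Subtype.val h)
    rw [dif_neg this]
    simp [hk]
    rfl

/-- A sequence of choices is a policy that ignores the state, so `Exec.trace` applies directly.
After halting both programs give no successor, so no branching is added later. -/
theorem Prog.run_of_exec (p : Prog K) (inp : K) (w : List Sym) (ω : ℕ → Bool) {t' s' g}
    (h : Exec (fun t _ => ω t) p 0 (.init inp w) t' s' g) :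
    (∀ u, t' ≤ u → (p.toNTM inp).run w ω u =
      s'.cfg (insert inp p.stacks : Finset K) none) ∧
    {t | (p.toNTM inp).Branching ((p.toNTM inp).run w ω t)}.encard ≤ g := by
  have key := Exec.trace (S := (insert inp p.stacks : Finset K)) (π := fun t _ _ => ω t) h
    (m := fun b => if b then (p.toNTM inp).m' else (p.toNTM inp).m)
    (c := (p.toNTM inp).run w ω) (fun t => rfl) (emb := id) (ex := none)
    (by rintro (_ | _) l <;> rfl) (Finset.subset_insert _ _) (p.run_zero inp w ω)
  have stay : ∀ u, t' ≤ u → (p.toNTM inp).run w ω u =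
      s'.cfg (insert inp p.stacks : Finset K) none := by
    intro u hu
    induction u, hu using Nat.le_induction with
    | base => exact key.1
    | succ u hu ih => rw [NTM.run, ih]; rfl
  refine ⟨stay, le_trans (Set.encard_le_encard ?_) key.2⟩
  intro u hu
  refine ⟨Nat.zero_le _, ?_, hu⟩
  by_contra hlt
  refine hu ?_
  rw [stay u (not_lt.mp hlt)]
  rfl

/-- A policy may consult the stacks, a choice sequence may not. The trajectory under the policy is
followed and its choices are recorded in `ω`. This lets an accepting run be described by which bit
to guess at which position, without knowing the times of the guesses. -/
theorem Prog.exists_run_of_exec (p : Prog K) (inp : K) (w : List Sym)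
    (π : ℕ → Reg → (↥(insert inp p.stacks : Finset K) → List Sym) → Bool) {t' s' g}
    (h : Exec (fun t (s : St K) => π t s.reg fun k => s.stk k) p 0 (.init inp w) t' s' g) :
    ∃ ω, (p.toNTM inp).run w ω t' = s'.cfg (insert inp p.stacks : Finset K) none := by
  let M := p.toNTM inp
  let c : ℕ → MCfg (insert inp p.stacks : Finset K) p.Label := fun t =>
    Nat.rec ((St.init inp w).cfg (insert inp p.stacks : Finset K) (some p.entry))
      (fun t c => (TM2.step (if π t c.var c.stk then M.m' else M.m) c).getD c) t
  let ω : ℕ → Bool := fun t => π t (c t).var (c t).stk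
  have hrun : ∀ t, M.run w ω t = c t := by
    intro t
    induction t with
    | zero => exact p.run_zero inp w ω
    | succ t ih => rw [NTM.run, ih]; rfl
  refine ⟨ω, (hrun t').trans ?_⟩
  exact (Exec.trace (S := (insert inp p.stacks : Finset K)) (π := π) h
    (m := fun b => if b then M.m' else M.m) (c := c) (fun t => rfl) (emb := id) (ex := none)
    (by rintro (_ | _) l <;> rfl) (Finset.subset_insert _ _) rfl).1

end StackProgram


/-! ## Programs with tapes and iterators -/

namespace StackProgram

open Function

/-- Stacks: the input, a temporary stack, a stack with one symbol for each element of the domain,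
the two halves of every tape, and three stacks for every iterator. -/
inductive Stk
  | inp
  | tmp
  | dom
  | left (τ : ℕ)
  | right (τ : ℕ)
  | up (v : ℕ)
  | dn (v : ℕ)
  | aux (v : ℕ)
  deriving DecidableEq

/-- The contents of the tapes, the positions of the heads, and the flag. -/
structure Core where
  mem : ℕ → Set ℕ
  pos : ℕ → ℕ
  flag : Bool

open Classical in
/-- Two stacks hold the set `A` as a tape of bits, with the head at position `p`. -/
def TapeRep (A : Set ℕ) (p : ℕ) (l r : List Sym) : Prop :=
  l.length = p ∧ ∀ a, ((l.reverse ++ r)[a]?).getD (some false) = some (decide (a ∈ A))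

/-- A state holds a core over the domain `{0, …, N - 1}`, where the iterator `v` has the value
`it v`, with `rem v` further values to come. -/
structure Rep (N : ℕ) (it rem : ℕ → ℕ) (c : Core) (s : St Stk) : Prop where
  dom : s.stk .dom = List.replicate N none
  up : ∀ v, s.stk (.up v) = List.replicate (it v) none
  dn : ∀ v, s.stk (.dn v) = List.replicate (rem v) none
  aux : ∀ v, s.stk (.aux v) = []
  tape : ∀ τ, TapeRep (c.mem τ) (c.pos τ) (s.stk (.left τ)) (s.stk (.right τ))
  flag : s.reg.2 = c.flag

/-- Started with the core `c`, the program `p` stops within `T` steps, without guesses, with a core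
that satisfies `Q`. -/
def Runs (N : ℕ) (it rem : ℕ → ℕ) (p : Prog Stk) (T : ℕ) (c : Core) (Q : Core → Prop) : Prop :=
  ∀ π t s, Rep N it rem c s →
    ∃ t' s' c', Exec π p t s t' s' 0 ∧ t' ≤ t + T ∧ Rep N it rem c' s' ∧ Q c'

section Rules

variable {N : ℕ} {it rem : ℕ → ℕ} {p q : Prog Stk} {T T' : ℕ} {c : Core} {Q R : Core → Prop}

theorem Runs.mono (h : Runs N it rem p T c Q) (hT : T ≤ T') (hQ : ∀ c, Q c → R c) :
    Runs N it rem p T' c R := by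
  intro π t s hs
  obtain ⟨t', s', c', h1, h2, h3, h4⟩ := h π t s hs
  exact ⟨t', s', c', h1, by omega, h3, hQ _ h4⟩

theorem Runs.seq (h : Runs N it rem p T c Q) (h' : ∀ c, Q c → Runs N it rem q T' c R) :
    Runs N it rem (.seq p q) (T + T') c R := by
  intro π t s hs
  obtain ⟨t1, s1, c1, h1, h2, h3, h4⟩ := h π t s hs
  obtain ⟨t2, s2, c2, g1, g2, g3, g4⟩ := h' c1 h4 π t1 s1 h3
  exact ⟨t2, s2, c2, h1.seq g1, by omega, g3, g4⟩

theorem Runs.cond (h1 : c.flag = true → Runs N it rem p T c Q)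
    (h2 : c.flag = false → Runs N it rem q T c Q) :
    Runs N it rem (.cond (fun r => r.2) p q) (T + 1) c Q := by
  intro π t s hs
  cases hf : c.flag with
  | true =>
    obtain ⟨t', s', c', e1, e2, e3, e4⟩ := h1 hf π (t + 1) s hs
    exact ⟨t', s', c', .cond_true (by rw [hs.flag, hf]) e1, by omega, e3, e4⟩
  | false =>
    obtain ⟨t', s', c', e1, e2, e3, e4⟩ := h2 hf π (t + 1) s hs
    exact ⟨t', s', c', .cond_false (by rw [hs.flag, hf]) e1, by omega, e3, e4⟩

theorem Runs.act {l : List (Op Stk)} {c' : Core} (h : ∀ s, Rep N it rem c s →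
    Rep N it rem c' (runOps l s)) : Runs N it rem (.act l) 1 c (fun d => d = c') :=
  fun _ t s hs => ⟨t + 1, _, c', .act l t s, le_rfl, h s hs, rfl⟩

theorem Runs.skip : Runs N it rem (.act []) 1 c (fun d => d = c) :=
  Runs.act fun _ hs => hs

/-- Applies a function to the flag. -/
def mapFlag (f : Bool → Bool) : Prog Stk := .act [.load fun r => (r.1, f r.2)]

theorem Runs.mapFlag (f : Bool → Bool) :
    Runs N it rem (mapFlag f) 1 c (fun d => d = { c with flag := f c.flag }) :=
  Runs.act fun _ hs => ⟨hs.dom, hs.up, hs.dn, hs.aux, hs.tape, by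
    simp [runOps, Op.run, hs.flag]⟩

/-- Moves the head of a tape to the right. -/
def moveRight (τ : ℕ) : Prog Stk :=
  .act [.pop (.right τ), .push (.left τ) fun r => r.1.getD (some false)]

/-- Beyond its right end a tape is blank, and blanks read as `false`. A move to the right in this
region makes one blank explicit, which leaves the represented set unchanged. -/
theorem TapeRep.right {A : Set ℕ} {p : ℕ} {l r : List Sym} (h : TapeRep A p l r) :
    TapeRep A (p + 1) (r.head?.getD (some false) :: l) r.tail := by
  refine ⟨by simp [h.1], fun a => ?_⟩
  rw [← h.2 a]
  cases r with
  | nil =>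
    have : (l.reverse ++ [some false])[a]?.getD (some false)
        = (l.reverse)[a]?.getD (some false) := by
      rw [List.getElem?_append]
      split
      · rfl
      · rename_i hlt
        rw [List.getElem?_eq_none (l := l.reverse) (by omega)]
        rcases hb : a - l.reverse.length with _ | b <;> simp
    simpa using this
  | cons x r => simp

theorem Runs.moveRight (τ : ℕ) : Runs N it rem (moveRight τ) 1 c
    (fun d => d = { c with pos := update c.pos τ (c.pos τ + 1) }) :=
  Runs.act fun s hs => by
    refine ⟨?_, ?_, ?_, ?_, ?_, ?_⟩
    · simpa [runOps, Op.run] using hs.dom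
    · simpa [runOps, Op.run] using hs.up
    · simpa [runOps, Op.run] using hs.dn
    · simpa [runOps, Op.run] using hs.aux
    · intro σ
      by_cases h : σ = τ
      · subst h
        simpa [runOps, Op.run] using (hs.tape σ).right
      · simpa [runOps, Op.run, h] using hs.tape σ
    · simpa [runOps, Op.run] using hs.flag

/-- Moves the head of a tape to the left. -/
def moveLeft (τ : ℕ) : Prog Stk :=
  .act [.pop (.left τ), .pushOpt (.right τ) fun r => r.1]

/-- At the left end neither half changes, in accordance with `0 - 1 = 0`. -/
theorem TapeRep.left {A : Set ℕ} {p : ℕ} {l r : List Sym} (h : TapeRep A p l r) :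
    TapeRep A (p - 1) l.tail (l.head?.toList ++ r) := by
  refine ⟨by simp [h.1], fun a => ?_⟩
  rw [← h.2 a]
  cases l <;> simp

theorem Runs.moveLeft (τ : ℕ) : Runs N it rem (moveLeft τ) 1 c
    (fun d => d = { c with pos := update c.pos τ (c.pos τ - 1) }) :=
  Runs.act fun s hs => by
    refine ⟨?_, ?_, ?_, ?_, ?_, ?_⟩
    · simpa [runOps, Op.run] using hs.dom
    · simpa [runOps, Op.run] using hs.up
    · simpa [runOps, Op.run] using hs.dn
    · simpa [runOps, Op.run] using hs.aux
    · intro σ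
      by_cases h : σ = τ
      · subst h
        simpa [runOps, Op.run] using (hs.tape σ).left
      · simpa [runOps, Op.run, h] using hs.tape σ
    · simpa [runOps, Op.run] using hs.flag

/-- Reads the bit under the head of a tape into the flag. -/
def readBit (τ : ℕ) : Prog Stk :=
  .act [.peek (.right τ), .load fun r => (r.1, (r.1.getD (some false)).getD false)]

theorem TapeRep.head {A : Set ℕ} {p : ℕ} {l r : List Sym} (h : TapeRep A p l r) :
    r.head?.getD (some false) = some (open Classical in decide (p ∈ A)) := by
  rw [← h.2 p, ← h.1]
  cases r <;> simp

open Classical in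
theorem Runs.readBit (τ : ℕ) : Runs N it rem (readBit τ) 1 c
    (fun d => d = { c with flag := decide (c.pos τ ∈ c.mem τ) }) :=
  Runs.act fun s hs => ⟨hs.dom, hs.up, hs.dn, hs.aux, hs.tape, by
    simp [runOps, Op.run, (hs.tape τ).head]⟩

/-- Writes a function of the flag under the head of a tape. -/
def writeBit (τ : ℕ) (f : Bool → Bool) : Prog Stk :=
  .act [.pop (.right τ), .push (.right τ) fun r => some (f r.2)]

theorem TapeRep.write {A B : Set ℕ} {p : ℕ} {l r : List Sym} (h : TapeRep A p l r) (b : Bool)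
    (hB : ∀ a, a ∈ B ↔ if a = p then b = true else a ∈ A) :
    TapeRep B p l (some b :: r.tail) := by
  classical
  refine ⟨h.1, fun a => ?_⟩
  have hA := h.2 a
  rcases lt_trichotomy a p with hlt | rfl | hlt
  · have : decide (a ∈ B) = decide (a ∈ A) := by simp [hB, hlt.ne]
    rw [List.getElem?_append_left (by simp [h.1, hlt])] at hA ⊢
    rw [this, hA]
  · have : decide (a ∈ B) = b := by simp [hB]
    rw [List.getElem?_append_right (by simp [h.1])]
    simp [h.1, this]
  · have : decide (a ∈ B) = decide (a ∈ A) := by simp [hB, hlt.ne']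
    rw [List.getElem?_append_right (by simp [h.1, hlt.le])] at hA ⊢
    obtain ⟨m, hm⟩ : ∃ m, a - l.reverse.length = m + 1 :=
      ⟨a - p - 1, by simp [h.1]; omega⟩
    rw [hm] at hA ⊢
    rw [this, ← hA]
    cases r <;> simp

theorem Runs.writeBit (τ : ℕ) (f : Bool → Bool) {B : Set ℕ}
    (hB : ∀ a, a ∈ B ↔ if a = c.pos τ then f c.flag = true else a ∈ c.mem τ) :
    Runs N it rem (writeBit τ f) 1 c
    (fun d => d = { c with mem := update c.mem τ B }) :=
  Runs.act fun s hs => by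
    refine ⟨?_, ?_, ?_, ?_, ?_, ?_⟩
    · simpa [runOps, Op.run] using hs.dom
    · simpa [runOps, Op.run] using hs.up
    · simpa [runOps, Op.run] using hs.dn
    · simpa [runOps, Op.run] using hs.aux
    · intro σ
      by_cases h : σ = τ
      · subst h
        simpa [runOps, Op.run, hs.flag] using (hs.tape σ).write _ hB
      · simpa [runOps, Op.run, h] using hs.tape σ
    · simpa [runOps, Op.run] using hs.flag

end Rules

/-! ### Loops -/

/-- Empties the stack `k`, while pushing as many symbols on all stacks in `ks`. -/
def drain (k : Stk) (ks : List Stk) : Prog Stk :=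
  .seq (.act [.peek k]) (.loop (fun r => r.1.isSome)
    (.act (.pop k :: (ks.map (fun k => Op.push k fun _ => none) ++ [.peek k]))))

theorem runOps_append (l l' : List (Op Stk)) (s : St Stk) :
    runOps (l ++ l') s = runOps l' (runOps l s) := by
  induction l generalizing s with
  | nil => rfl
  | cons o l ih => exact ih _

theorem runOps_pushes (ks : List Stk) (s : St Stk) :
    runOps (ks.map (fun k => Op.push k fun _ => none)) s =
      ⟨s.reg, fun k => List.replicate (ks.count k) none ++ s.stk k⟩ := by
  induction ks generalizing s with
  | nil => rfl
  | cons j ks ih =>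
    simp only [List.map_cons, runOps, ih, Op.run]
    congr 1
    funext k
    by_cases h : k = j
    · subst h
      simp [List.replicate_succ']
    · simp [h, List.count_cons_of_ne (Ne.symm h)]

/-- Each symbol costs two steps, the loop test and the block of operations; the first peek and the
last test account for the other two. The register always holds the top symbol of `k`. -/
theorem exec_drain (π : ℕ → St Stk → Bool) {k : Stk} {ks : List Stk} (hk : k ∉ ks) (n t : ℕ)
    (s : St Stk) (hs : s.stk k = List.replicate n none) :
    ∃ s', Exec π (drain k ks) t s (t + 2 * n + 2) s' 0 ∧ s'.reg.2 = s.reg.2 ∧ s'.stk k = [] ∧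
      ∀ j, j ≠ k → s'.stk j = List.replicate (n * ks.count j) none ++ s.stk j := by
  have main : ∀ n t (s : St Stk), s.stk k = List.replicate n none → s.reg.1 = (s.stk k).head? →
      ∃ s', Exec π (.loop (fun r => r.1.isSome)
        (.act (.pop k :: (ks.map (fun k => Op.push k fun _ => none) ++ [.peek k]))))
        t s (t + 2 * n + 1) s' 0 ∧ s'.reg.2 = s.reg.2 ∧ s'.stk k = [] ∧
      ∀ j, j ≠ k → s'.stk j = List.replicate (n * ks.count j) none ++ s.stk j := by
    intro n
    induction n with
    | zero =>
      intro t s hs hr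
      exact ⟨s, .loop_false (by simp [hr, hs]), rfl, by simpa using hs, by simp⟩
    | succ n ih =>
      intro t s hs hr
      let s1 := runOps (.pop k :: (ks.map (fun k => Op.push k fun _ => none) ++ [.peek k])) s
      have e1 : s1 = runOps (.pop k :: (ks.map (fun k => Op.push k fun _ => none) ++ [.peek k])) s :=
        rfl
      simp only [runOps, runOps_append, runOps_pushes, Op.run] at e1
      have k1 : s1.stk k = List.replicate n none := by
        simp [e1, hs, List.count_eq_zero_of_not_mem hk]
      obtain ⟨s', h1, h2, h3, h4⟩ := ih (t + 1 + 1) s1 k1 (by rw [e1])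
      refine ⟨s', ?_, ?_, h3, fun j hj => ?_⟩
      · have := Exec.loop_true (c := fun r : Reg => r.1.isSome) (by simp [hr, hs])
          (.act _ _ _) h1
        convert! this using 1
        ring
      · rw [h2, e1]
      · rw [h4 j hj, e1]
        simp only [update_of_ne hj]
        rw [← List.append_assoc, ← List.replicate_add, Nat.succ_mul]
  obtain ⟨s', h1, h2, h3, h4⟩ := main n (t + 1) (runOps [.peek k] s) hs rfl
  refine ⟨s', ?_, h2, h3, h4⟩
  have := Exec.seq (.act [.peek k] t s) h1
  convert! this using 1
  ring

/-- The stack over which a loop iterates: the domain, or the predecessors of an iterator. -/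
def srcStk : Option ℕ → Stk
  | none => .dom
  | some v => .up v

/-- The number of iterations of a loop. -/
def srcCount (N : ℕ) (it : ℕ → ℕ) : Option ℕ → ℕ
  | none => N
  | some v => it v

/-- The loop with iterator `d`; if `brk` holds, it is left as soon as the flag is set. -/
def loopOver (src : Option ℕ) (d : ℕ) (brk : Bool) (body : Prog Stk) : Prog Stk :=
  .seq (drain (srcStk src) [.dn d, .aux d]) <|
  .seq (drain (.aux d) [srcStk src]) <|
  .seq (.act [.peek (.dn d)]) <|
  .seq (.loop (fun r => r.1.isSome && !(brk && r.2))
    (.seq body (.act [.pop (.dn d), .push (.up d) fun _ => none, .peek (.dn d)]))) <|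
  .seq (drain (.up d) []) (drain (.dn d) [])

section Loop

variable {N : ℕ} {it rem : ℕ → ℕ}

theorem Rep.src {c : Core} {s : St Stk} (h : Rep N it rem c s) (src : Option ℕ) :
    s.stk (srcStk src) = List.replicate (srcCount N it src) none := by
  cases src
  · exact h.dom
  · exact h.up _

/-- Reading a stack destroys it. The source is therefore drained into two stacks, `dn d` and `aux
d`, and then restored from `aux d`, which ends up empty again. -/
theorem Rep.copy {c : Core} {s s1 s2 : St Stk} (h : Rep N it rem c s) (src : Option ℕ) (d : ℕ)
    (hsrc : ∀ v ∈ src, v < d) (hr : rem d = 0)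
    (h1 : s1.reg.2 = s.reg.2 ∧ s1.stk (srcStk src) = [] ∧ ∀ j, j ≠ srcStk src → s1.stk j =
      List.replicate (srcCount N it src * [Stk.dn d, .aux d].count j) none ++ s.stk j)
    (h2 : s2.reg.2 = s1.reg.2 ∧ s2.stk (.aux d) = [] ∧ ∀ j, j ≠ .aux d → s2.stk j =
      List.replicate (srcCount N it src * [srcStk src].count j) none ++ s1.stk j) :
    Rep N it (update rem d (srcCount N it src)) c s2 := by
  obtain ⟨f1, e1, g1⟩ := h1
  obtain ⟨f2, e2, g2⟩ := h2
  have hsrcd : srcStk src ≠ .up d := by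
    cases src with
    | none => simp [srcStk]
    | some v =>
      have := hsrc v rfl
      simp only [srcStk, ne_eq, Stk.up.injEq]; omega
  have other : ∀ j, j ≠ srcStk src → j ≠ .aux d → j ≠ .dn d → s2.stk j = s.stk j := by
    intro j a b e
    rw [g2 j b, g1 j a]
    simp [Ne.symm a, Ne.symm b, Ne.symm e]
  have hsrc2 : s2.stk (srcStk src) = s.stk (srcStk src) := by
    have hne : srcStk src ≠ .aux d := by cases src <;> simp [srcStk]
    rw [g2 _ hne, e1, h.src]; simp
  have same : ∀ j, j ≠ .aux d → j ≠ .dn d → s2.stk j = s.stk j := by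
    intro j hb he
    by_cases ha : j = srcStk src
    · rw [ha, hsrc2]
    · exact other j ha hb he
  refine ⟨?_, fun v => ?_, fun v => ?_, fun v => ?_, fun τ => ?_, ?_⟩
  · rw [same _ (by simp) (by simp), h.dom]
  · rw [same _ (by simp) (by simp), h.up]
  · by_cases hv : v = d
    · subst hv
      have hne : Stk.dn v ≠ srcStk src := by cases src <;> simp [srcStk]
      rw [g2 _ (by simp), g1 _ hne, h.dn, hr]
      simp [hne.symm]
    · rw [same _ (by simp) (by simp [hv]), h.dn]
      simp [hv]
  · by_cases hv : v = d
    · subst hv; exact e2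
    · rw [same _ (by simp [hv]) (by simp), h.aux]
  · rw [same _ (by simp) (by simp), same _ (by simp) (by simp)]
    exact h.tape τ
  · rw [f2, f1, h.flag]

theorem Rep.clear {c : Core} {s s1 s2 : St Stk} {d i j : ℕ}
    (h : Rep N (update it d i) (update rem d j) c s) (hi : it d = 0) (hr : rem d = 0)
    (h1 : s1.reg.2 = s.reg.2 ∧ s1.stk (.up d) = [] ∧ ∀ j, j ≠ .up d → s1.stk j = s.stk j)
    (h2 : s2.reg.2 = s1.reg.2 ∧ s2.stk (.dn d) = [] ∧ ∀ j, j ≠ .dn d → s2.stk j = s1.stk j) :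
    Rep N it rem c s2 := by
  obtain ⟨f1, e1, g1⟩ := h1
  obtain ⟨f2, e2, g2⟩ := h2
  have same : ∀ j, j ≠ .up d → j ≠ .dn d → s2.stk j = s.stk j :=
    fun j a b => (g2 j b).trans (g1 j a)
  refine ⟨?_, fun v => ?_, fun v => ?_, fun v => ?_, fun τ => ?_, ?_⟩
  · rw [same _ (by simp) (by simp), h.dom]
  · by_cases hv : v = d
    · subst hv
      rw [g2 _ (by simp), e1, hi]; rfl
    · rw [same _ (by simp [hv]) (by simp), h.up]; simp [hv]
  · by_cases hv : v = d
    · subst hv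
      rw [e2, hr]; rfl
    · rw [same _ (by simp) (by simp [hv]), h.dn]; simp [hv]
  · rw [same _ (by simp) (by simp), h.aux]
  · rw [same _ (by simp) (by simp), same _ (by simp) (by simp)]
    exact h.tape τ
  · rw [f2, f1, h.flag]

/-- The loop rule of Hoare logic. The invariant `I i` describes the core after `i` completed rounds;
the loop ends with `i = n` or, if breaking is allowed, with the flag set. -/
theorem Runs.loopOver {src : Option ℕ} {d n : ℕ} {brk : Bool} {body : Prog Stk} {T : ℕ} {c : Core}
    {I : ℕ → Core → Prop} {Q : Core → Prop} (hsrc : ∀ v ∈ src, v < d) (hi : it d = 0)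
    (hr : rem d = 0) (hn : srcCount N it src = n) (h0 : I 0 c)
    (hbody : ∀ i < n, ∀ c, I i c → (brk && c.flag) = false →
      Runs N (update it d i) (update rem d (n - i)) body T c (I (i + 1)))
    (hQ : ∀ i ≤ n, ∀ c, I i c → (i = n ∨ (brk && c.flag) = true) → Q c) :
    Runs N it rem (loopOver src d brk body) (n * (T + 10) + 10) c Q := by
  intro π t s hs
  have hne : srcStk src ∉ [Stk.dn d, .aux d] := by cases src <;> simp [srcStk]
  have hne' : Stk.aux d ∉ [srcStk src] := by cases src <;> simp [srcStk]
  obtain ⟨s1, x1, y1⟩ := exec_drain π hne n t s (by rw [hs.src, hn])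
  have haux : s1.stk (.aux d) = List.replicate n none := by
    rw [y1.2.2 _ (by simpa using hne'), hs.aux]
    simp
  obtain ⟨s2, x2, y2⟩ := exec_drain π hne' n (t + 2 * n + 2) s1 haux
  have r2 : Rep N it (update rem d n) c s2 := by
    subst hn
    exact hs.copy src d hsrc hr y1 y2
  -- Induction on the number `j` of rounds that remain at most.
  have loop : ∀ j, ∀ i t (c : Core) s, i + j = n → I i c →
      Rep N (update it d i) (update rem d (n - i)) c s → s.reg.1 = (s.stk (.dn d)).head? →
      ∃ t' s' c' i', Exec π (.loop (fun r => r.1.isSome && !(brk && r.2))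
        (.seq body (.act [.pop (.dn d), .push (.up d) fun _ => none, .peek (.dn d)]))) t s t' s' 0 ∧
        t' ≤ t + j * (T + 2) + 1 ∧ i' ≤ n ∧ Rep N (update it d i') (update rem d (n - i')) c' s' ∧
        I i' c' ∧ (i' = n ∨ (brk && c'.flag) = true) := by
    intro j
    induction j with
    | zero =>
      intro i t c s hij hI hs hreg
      obtain rfl : i = n := by omega
      refine ⟨t + 1, s, c, i, .loop_false ?_, by omega, le_rfl, hs, hI, .inl rfl⟩
      rw [hreg, hs.dn]; simp
    | succ j ih =>
      intro i t c s hij hI hs hreg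
      have hin : i < n := by omega
      cases hb : (brk && c.flag) with
      | true =>
        refine ⟨t + 1, s, c, i, .loop_false ?_, by omega, hin.le, hs, hI, .inr hb⟩
        rw [hs.flag, hb]; simp
      | false =>
        obtain ⟨t1, s1, c1, e1, e2, e3, e4⟩ := hbody i hin c hI hb π (t + 1) s hs
        let s2 := runOps [.pop (.dn d), .push (.up d) fun _ => none, .peek (.dn d)] s1
        have hs2 : Rep N (update it d (i + 1)) (update rem d (n - (i + 1))) c1 s2 := by
          refine ⟨?_, fun v => ?_, fun v => ?_, ?_, ?_, e3.flag⟩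
          · simpa [s2, runOps, Op.run] using e3.dom
          · by_cases hv : v = d
            · subst hv
              simp [s2, runOps, Op.run, e3.up, List.replicate_succ]
            · simp [s2, runOps, Op.run, e3.up, hv]
          · by_cases hv : v = d
            · subst hv
              simp [s2, runOps, Op.run, e3.dn]
              omega
            · simp [s2, runOps, Op.run, e3.dn, hv]
          · simpa [s2, runOps, Op.run] using e3.aux
          · simpa [s2, runOps, Op.run] using e3.tape
        obtain ⟨t', s', c', i', g1, g2, g3, g4, g5, g6⟩ :=
          ih (i + 1) (t1 + 1) c1 s2 (by omega) e4 hs2 rfl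
        refine ⟨t', s', c', i', ?_, ?_, g3, g4, g5, g6⟩
        · refine Exec.loop_true (g := 0) (g' := 0) ?_
            (Exec.seq (g := 0) (g' := 0) e1 (.act _ _ _)) g1
          rw [hreg, hs.dn, hs.flag, hb]
          have : n - i ≠ 0 := by omega
          simp [List.head?_replicate, this]
        · rw [Nat.succ_mul]; omega
  let s3 := runOps [.peek (.dn d)] s2
  have r3 : Rep N (update it d 0) (update rem d (n - 0)) c s3 := by
    have hu : update it d 0 = it := by rw [← hi, update_eq_self]
    rw [hu]
    exact ⟨r2.dom, r2.up, r2.dn, r2.aux, r2.tape, r2.flag⟩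
  obtain ⟨t4, s4, c4, i, x4, b4, hin, r4, I4, hex⟩ :=
    loop n 0 (t + 2 * n + 2 + 2 * n + 2 + 1) c s3 (by omega) h0 r3 rfl
  obtain ⟨s5, x5, y5⟩ := exec_drain π (k := .up d) (ks := []) (by simp) i t4 s4
    (by rw [r4.up, update_self])
  have y5' : s5.reg.2 = s4.reg.2 ∧ s5.stk (.up d) = [] ∧ ∀ j, j ≠ .up d → s5.stk j = s4.stk j :=
    ⟨y5.1, y5.2.1, fun j hj => by simpa using y5.2.2 j hj⟩
  obtain ⟨s6, x6, y6⟩ := exec_drain π (k := .dn d) (ks := []) (by simp) (n - i)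
    (t4 + 2 * i + 2) s5 (by rw [y5'.2.2 _ (by simp), r4.dn, update_self])
  have r6 : Rep N it rem c4 s6 := r4.clear hi hr y5'
    ⟨y6.1, y6.2.1, fun j hj => by simpa using y6.2.2 j hj⟩
  refine ⟨t4 + 2 * i + 2 + 2 * (n - i) + 2, s6, c4, ?_, ?_, r6, hQ i hin c4 I4 hex⟩
  · exact Exec.seq (g := 0) (g' := 0) x1 (Exec.seq (g := 0) (g' := 0) x2
      (Exec.seq (g := 0) (g' := 0) (.act _ _ _) (Exec.seq (g := 0) (g' := 0) x4
        (Exec.seq (g := 0) (g' := 0) x5 x6))))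
  -- The rounds cost at most `n * (T + 2) + 1` steps; copying and clearing the stacks costs `6 * n +
  -- 9` more.
  · have : n * (T + 10) = n * (T + 2) + 8 * n := by ring
    omega

end Loop

end StackProgram


/-! ## Definable predicates and computable transformations of the memory -/

namespace StackProgram

open Function

/-- Polynomial bounds. -/
def polyBound (k N : ℕ) : ℕ := k * (N + 1) ^ k

theorem polyBound_mono {k k' : ℕ} (h : k ≤ k') (N : ℕ) : polyBound k N ≤ polyBound k' N :=
  Nat.mul_le_mul h (Nat.pow_le_pow_right N.succ_pos h)

/-- A single index serves as coefficient and as exponent, so adding bounds becomes adding indices.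
-/
theorem polyBound_add (a b N : ℕ) : polyBound a N + polyBound b N ≤ polyBound (a + b) N := by
  have h1 : (N + 1) ^ a ≤ (N + 1) ^ (a + b) := Nat.pow_le_pow_right N.succ_pos (by omega)
  have h2 : (N + 1) ^ b ≤ (N + 1) ^ (a + b) := Nat.pow_le_pow_right N.succ_pos (by omega)
  calc polyBound a N + polyBound b N
      ≤ a * (N + 1) ^ (a + b) + b * (N + 1) ^ (a + b) :=
        Nat.add_le_add (Nat.mul_le_mul_left _ h1) (Nat.mul_le_mul_left _ h2)
    _ = polyBound (a + b) N := by rw [polyBound]; ring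

theorem le_polyBound (a N : ℕ) : a ≤ polyBound a N :=
  Nat.le_mul_of_pos_right _ (by positivity)

theorem mul_polyBound (a N : ℕ) : N * polyBound a N ≤ polyBound (a + 1) N := by
  calc N * (a * (N + 1) ^ a) ≤ (N + 1) * ((a + 1) * (N + 1) ^ a) := by gcongr <;> omega
    _ = polyBound (a + 1) N := by rw [polyBound]; ring

/-- The increment `21` is `10` for the overhead in each round, `1` for the factor `N`, and `10` for
the overhead outside the rounds. -/
theorem loop_polyBound {n N : ℕ} (h : n ≤ N) (a : ℕ) :
    n * (polyBound a N + 10) + 10 ≤ polyBound (a + 21) N := by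
  have h1 := mul_polyBound (a + 10) N
  have h2 := polyBound_add a 10 N
  have h3 := le_polyBound 10 N
  have h4 := polyBound_add (a + 10 + 1) 10 N
  have h5 : n * (polyBound a N + 10) ≤ N * polyBound (a + 10) N :=
    Nat.mul_le_mul h (by omega)
  have h6 : a + 21 = a + 10 + 1 + 10 := by omega
  rw [h6]
  omega

/-- The iterators below `d` are in use. -/
def Iter (N d : ℕ) (it rem : ℕ → ℕ) : Prop :=
  (∀ v < d, it v < N) ∧ ∀ v, d ≤ v → it v = 0 ∧ rem v = 0

theorem Iter.succ {N d : ℕ} {it rem : ℕ → ℕ} (h : Iter N d it rem) {i : ℕ} (hi : i < N) (j : ℕ) :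
    Iter N (d + 1) (update it d i) (update rem d j) := by
  refine ⟨fun v hv => ?_, fun v hv => ?_⟩
  · by_cases hvd : v = d
    · simpa [hvd] using hi
    · simpa [hvd] using h.1 v (by omega)
  · have : v ≠ d := by omega
    simpa [this] using h.2 v (by omega)

/-- The variables in scope live in iterators below `d`, so a loop that uses the iterator `d` does
not disturb them. -/
theorem update_comp_of_lt {V : Type} {ρ : V → ℕ} {d : ℕ} (hρ : ∀ v, ρ v < d) (it : ℕ → ℕ) (i : ℕ) :
    update it d i ∘ ρ = it ∘ ρ := by
  funext v
  have : ρ v ≠ d := (hρ v).ne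
  simp [this]

/-! ### Addresses -/

/-- `g` can be iterated `f x e` times in polynomial time, for every elementary program `u` with
effect `g`. -/
def Repeatable {C : Type} (size : C → ℕ) {V : Type} (f : C → (V → ℕ) → ℕ) : Prop :=
  ∀ (d : ℕ) (ρ : V → ℕ), (∀ v, ρ v < d) → ∀ (u : Prog Stk) (g : Core → Core),
    (∀ N it rem c, Runs N it rem u 1 c (fun c' => c' = g c)) →
    ∃ p k, ∀ x it rem, Iter (size x) d it rem → ∀ c,
      Runs (size x) it rem p (polyBound k (size x)) c (fun c' => c' = g^[f x (it ∘ ρ)] c)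

section Repeatable

variable {C : Type} {size : C → ℕ} {V : Type} {f g : C → (V → ℕ) → ℕ}

theorem Repeatable.zero : Repeatable size (fun _ (_ : V → ℕ) => 0) := by
  intro d ρ hρ u g hu
  exact ⟨.act [], 1, fun x it rem _ c => Runs.skip.mono (le_polyBound 1 _) fun _ h => h⟩

theorem Repeatable.one : Repeatable size (fun _ (_ : V → ℕ) => 1) := by
  intro d ρ hρ u g hu
  exact ⟨u, 1, fun x it rem _ c => (hu _ _ _ _).mono (le_polyBound 1 _) fun _ h => h⟩

theorem Repeatable.add (hf : Repeatable size f) (hg : Repeatable size g) :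
    Repeatable size (fun x e => f x e + g x e) := by
  intro d ρ hρ u γ hu
  obtain ⟨p, k, hp⟩ := hf d ρ hρ u γ hu
  obtain ⟨q, l, hq⟩ := hg d ρ hρ u γ hu
  refine ⟨.seq p q, k + l, fun x it rem hi c => ?_⟩
  refine Runs.mono (Runs.seq (hp x it rem hi c) (R := fun c' => c' = γ^[f x (it ∘ ρ) +
    g x (it ∘ ρ)] c) ?_) (polyBound_add _ _ _) fun _ h => h
  rintro _ rfl
  refine (hq x it rem hi _).mono le_rfl ?_
  rintro _ rfl
  rw [← iterate_add_apply, Nat.add_comm]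

/-- Numbers are handled in unary, as numbers of repetitions; a product is a loop around a
repetition. The available factors are the size of the domain and the values of variables, which
suffices for polynomial addresses. -/
theorem Repeatable.loop (src : Option V) (hf : Repeatable size f) :
    Repeatable size (fun x e => (src.elim (size x) e) * f x e) := by
  intro d ρ hρ u γ hu
  obtain ⟨p, k, hp⟩ := hf (d + 1) ρ (fun v => (hρ v).trans (Nat.lt_succ_self d)) u γ hu
  refine ⟨loopOver (src.map ρ) d false p, k + 21, fun x it rem hi c => ?_⟩
  have hc : srcCount (size x) it (src.map ρ) = src.elim (size x) (it ∘ ρ) := by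
    cases src <;> rfl
  have hle : srcCount (size x) it (src.map ρ) ≤ size x := by
    cases src with
    | none => exact le_rfl
    | some v => exact (hi.1 _ (hρ v)).le
  refine Runs.mono (Runs.loopOver (I := fun i c' => c' = γ^[i * f x (it ∘ ρ)] c)
    (T := polyBound k (size x)) ?_ (hi.2 d le_rfl).1
    (hi.2 d le_rfl).2 rfl (by simp) ?_ fun i _ c' hI hor => ?_) (loop_polyBound hle k)
    fun _ h => h
  · intro v hv
    obtain ⟨w, -, rfl⟩ := Option.mem_map.mp hv
    exact hρ w
  · rintro i hi' _ rfl -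
    refine (hp x _ _ (hi.succ (hi'.trans_le hle) _) _).mono le_rfl ?_
    rintro _ rfl
    rw [update_comp_of_lt hρ, ← iterate_add_apply]
    congr 1
    ring
  · rcases hor with rfl | h
    · rw [hI, hc]
    · simp at h

theorem Repeatable.dom_mul (hf : Repeatable size f) :
    Repeatable size (fun x e => size x * f x e) := Repeatable.loop none hf

theorem Repeatable.var_mul (v : V) (hf : Repeatable size f) :
    Repeatable size (fun x e => e v * f x e) := Repeatable.loop (some v) hf

theorem Repeatable.var (v : V) : Repeatable size (fun _ e => e v) := by
  simpa using Repeatable.var_mul v (Repeatable.one (size := size))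

theorem Repeatable.const (n : ℕ) : Repeatable size (fun _ (_ : V → ℕ) => n) := by
  induction n with
  | zero => exact .zero
  | succ n ih => exact ih.add .one

theorem Repeatable.var_pow_mul (v : V) (hf : Repeatable size f) (n : ℕ) :
    Repeatable size (fun x e => e v ^ n * f x e) := by
  induction n with
  | zero => simpa using hf
  | succ n ih =>
    have := ih.var_mul v
    simpa only [pow_succ', mul_assoc] using this

theorem Repeatable.dom_pow_mul (hf : Repeatable size f) (n : ℕ) :
    Repeatable size (fun x e => size x ^ n * f x e) := by
  induction n with
  | zero => simpa using hf
  | succ n ih =>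
    have := ih.dom_mul
    simpa only [pow_succ', mul_assoc] using this

theorem Repeatable.sum {ι : Type} (s : Finset ι) {F : ι → C → (V → ℕ) → ℕ}
    (h : ∀ i ∈ s, Repeatable size (F i)) : Repeatable size (fun x e => ∑ i ∈ s, F i x e) := by
  classical
  induction s using Finset.induction_on with
  | empty => simpa using Repeatable.zero
  | insert i s hi ih =>
    simp only [Finset.sum_insert hi]
    exact (h i (Finset.mem_insert_self _ _)).add
      (ih fun j hj => h j (Finset.mem_insert_of_mem hj))

theorem Repeatable.listSum {ι : Type} (l : List ι) {F : ι → C → (V → ℕ) → ℕ}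
    (h : ∀ i, Repeatable size (F i)) :
    Repeatable size (fun x e => (l.map fun i => F i x e).sum) := by
  induction l with
  | nil => simpa using Repeatable.zero
  | cons i l ih => simpa using (h i).add ih

/-- Going to an address, performing an elementary program, and going back. -/
theorem Repeatable.access (hf : Repeatable size f) {d : ℕ} {ρ : V → ℕ} (hρ : ∀ v, ρ v < d) (σ : ℕ)
    (u : Prog Stk) : ∃ p k, ∀ x it rem, Iter (size x) d it rem → ∀ c m b, c.pos = (fun _ => 0) →
      Runs (size x) it rem u 1 { c with pos := update c.pos σ (f x (it ∘ ρ)) }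
        (fun c' => c' = ⟨m, update c.pos σ (f x (it ∘ ρ)), b⟩) →
      Runs (size x) it rem p (polyBound k (size x)) c (fun c' => c' = ⟨m, c.pos, b⟩) := by
  obtain ⟨p, k, hp⟩ := hf d ρ hρ (moveRight σ) _ fun N it rem c => Runs.moveRight σ
  obtain ⟨q, l, hq⟩ := hf d ρ hρ (moveLeft σ) _ fun N it rem c => Runs.moveLeft σ
  refine ⟨.seq p (.seq u q), k + (1 + l), fun x it rem hi c m b hc hu => ?_⟩
  -- All heads rest at cell `0`, so `n` moves to the right lead to cell `n`, and `n` moves back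
  -- restore the positions.
  have right : ∀ n, (fun c : Core => { c with pos := update c.pos σ (c.pos σ + 1) })^[n] c =
      { c with pos := update c.pos σ n } := by
    intro n
    induction n with
    | zero =>
      have : update c.pos σ 0 = c.pos := by rw [hc]; exact update_eq_self σ (fun _ => 0)
      simp [this]
    | succ n ih => rw [iterate_succ_apply', ih]; simp
  have left : ∀ n, (fun c : Core => { c with pos := update c.pos σ (c.pos σ - 1) })^[n]
      ⟨m, update c.pos σ n, b⟩ = ⟨m, c.pos, b⟩ := by
    intro n
    induction n with
    | zero =>
      have : update c.pos σ 0 = c.pos := by rw [hc]; exact update_eq_self σ (fun _ => 0)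
      rw [this, iterate_zero, id]
    | succ n ih => rw [iterate_succ_apply]; simpa using ih
  refine Runs.mono (Runs.seq (T' := 1 + polyBound l (size x)) (hp x it rem hi c)
    (R := fun c' => c' = ⟨m, c.pos, b⟩) ?_) ?_ fun _ h => h
  · rintro _ rfl
    rw [right]
    refine Runs.seq hu ?_
    rintro _ rfl
    refine (hq x it rem hi _).mono le_rfl ?_
    rintro _ rfl
    rw [left]
  · have h1 := polyBound_add 1 l (size x)
    have h2 := le_polyBound 1 (size x)
    have h3 := polyBound_add k (1 + l) (size x)
    omega

end Repeatable

/-! ### Definable predicates -/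

/-- The contents of the tapes. -/
abbrev Mem := ℕ → Set ℕ

/-- The core holds the tapes `mem`; the tapes `0` and `1` are auxiliary. -/
def Holds (mem : Mem) (c : Core) : Prop :=
  c.pos = (fun _ => 0) ∧ c.mem 0 = ∅ ∧ ∀ τ, c.mem (τ + 2) = mem τ

/-- The truth value of a proposition. -/
noncomputable def truth (p : Prop) : Bool := open Classical in decide p

theorem truth_eq_true {p : Prop} : truth p = true ↔ p := by simp [truth]

theorem truth_eq_false {p : Prop} : truth p = false ↔ ¬ p := by simp [truth]

theorem Runs.readBit' {N it rem c} (τ : ℕ) : Runs N it rem (StackProgram.readBit τ) 1 c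
    (fun d => d = { c with flag := truth (c.pos τ ∈ c.mem τ) }) := Runs.readBit τ

theorem Runs.seq' {N it rem p q T T' T'' c Q R} (h : Runs N it rem p T c Q)
    (h' : ∀ c, Q c → Runs N it rem q T' c R) (hT : T + T' ≤ T'') :
    Runs N it rem (.seq p q) T'' c R := (h.seq h').mono hT fun _ h => h

/-- The predicate `P` can be evaluated in polynomial time. -/
def Definable {C : Type} (size : C → ℕ) (Inv : C → Mem → Prop) {V : Type}
    (P : C → Mem → (V → ℕ) → Prop) : Prop :=
  ∀ (d : ℕ) (ρ : V → ℕ), (∀ v, ρ v < d) → ∃ p k, ∀ x mem, Inv x mem → ∀ it rem,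
    Iter (size x) d it rem → ∀ c, Holds mem c →
      Runs (size x) it rem p (polyBound k (size x)) c
        (fun c' => c' = { c with flag := truth (P x mem (it ∘ ρ)) })

section Definable

variable {C : Type} {size : C → ℕ} {Inv : C → Mem → Prop} {V W : Type}
  {P Q : C → Mem → (V → ℕ) → Prop} {f g : C → (V → ℕ) → ℕ}

theorem Definable.congr (h : Definable size Inv P)
    (hPQ : ∀ x mem e, Inv x mem → (∀ v, e v < size x) → (P x mem e ↔ Q x mem e)) :
    Definable size Inv Q := by
  intro d ρ hρ
  obtain ⟨p, k, hp⟩ := h d ρ hρ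
  refine ⟨p, k, fun x mem hI it rem hi c hc => (hp x mem hI it rem hi c hc).mono le_rfl ?_⟩
  rintro _ rfl
  simp only [hPQ x mem (it ∘ ρ) hI fun v => hi.1 _ (hρ v)]

theorem Definable.mono {Inv' : C → Mem → Prop} (h : Definable size Inv P)
    (hI : ∀ x mem, Inv' x mem → Inv x mem) : Definable size Inv' P := by
  intro d ρ hρ
  obtain ⟨p, k, hp⟩ := h d ρ hρ
  exact ⟨p, k, fun x mem hI' => hp x mem (hI x mem hI')⟩

theorem Definable.comp {P : C → Mem → (W → ℕ) → Prop} (h : Definable size Inv P) (φ : W → V) :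
    Definable size Inv (fun x mem (e : V → ℕ) => P x mem (fun w => e (φ w))) :=
  fun d ρ hρ => h d (fun w => ρ (φ w)) fun w => hρ (φ w)

theorem Definable.read (τ : ℕ) (hf : Repeatable size f) :
    Definable size Inv (fun x mem e => f x e ∈ mem τ) := by
  intro d ρ hρ
  obtain ⟨p, k, hp⟩ := hf.access hρ (τ + 2) (readBit (τ + 2))
  refine ⟨p, k, fun x mem _ it rem hi c hc => hp x it rem hi c c.mem _ hc.1 ?_⟩
  refine (Runs.readBit' (τ + 2)).mono le_rfl ?_
  rintro _ rfl
  simp [hc.2.2 τ]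

/-- Two addresses are compared on the auxiliary tape `0`, which is empty between uses: the cell `f x
e` is marked, the cell `g x e` is read, and the mark is erased. -/
theorem Definable.eq (hf : Repeatable size f) (hg : Repeatable size g) :
    Definable size Inv (fun x _ e => f x e = g x e) := by
  intro d ρ hρ
  obtain ⟨p, k, hp⟩ := hf.access hρ 0 (writeBit 0 fun _ => true)
  obtain ⟨q, l, hq⟩ := hg.access hρ 0 (readBit 0)
  obtain ⟨r, m, hr⟩ := hf.access hρ 0 (writeBit 0 fun _ => false)
  refine ⟨.seq p (.seq q r), k + (l + m), fun x mem _ it rem hi c hc => ?_⟩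
  dsimp only
  set a := f x (it ∘ ρ) with ha
  set b := g x (it ∘ ρ) with hb
  refine Runs.seq' (T' := polyBound (l + m) (size x))
    (hp x it rem hi c (update c.mem 0 {a}) c.flag hc.1 ?_) ?_ (polyBound_add _ _ _)
  · refine (Runs.writeBit 0 _ (B := {a}) ?_).mono le_rfl ?_
    · intro n
      simp only [hc.2.1, ← ha]
      by_cases hn : n = a <;> simp [hn]
    · rintro _ rfl
      rfl
  · rintro _ rfl
    refine Runs.seq' (hq x it rem hi _ (update c.mem 0 {a}) (truth (a = b)) hc.1 ?_) ?_
      (polyBound_add _ _ _)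
    · refine (Runs.readBit' 0).mono le_rfl ?_
      rintro _ rfl
      simp [← hb, eq_comm]
    · rintro _ rfl
      have hm : c.mem = update (update c.mem 0 {a}) 0 ∅ := by
        rw [update_idem, ← hc.2.1, update_eq_self]
      refine (hr x it rem hi ⟨update c.mem 0 {a}, c.pos, truth (a = b)⟩ c.mem (truth (a = b))
        hc.1 ?_).mono le_rfl fun _ h => h
      refine (Runs.writeBit 0 _ (B := ∅) ?_).mono le_rfl ?_
      · intro n
        simp only [← ha]
        by_cases hn : n = a <;> simp [hn]
      · rintro _ rfl
        simp [← hm, ← ha]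

theorem Definable.trivial : Definable size Inv (fun _ _ (_ : V → ℕ) => True) :=
  (Definable.eq (Repeatable.zero (size := size)) Repeatable.zero).congr (by simp)

theorem Definable.not (h : Definable size Inv P) :
    Definable size Inv (fun x mem e => ¬ P x mem e) := by
  intro d ρ hρ
  obtain ⟨p, k, hp⟩ := h d ρ hρ
  refine ⟨.seq p (mapFlag Bool.not), k + 1, fun x mem hI it rem hi c hc => ?_⟩
  refine Runs.seq' (hp x mem hI it rem hi c hc) ?_
    ((Nat.add_le_add_left (le_polyBound 1 _) _).trans (polyBound_add _ _ _))
  rintro _ rfl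
  refine (Runs.mapFlag Bool.not).mono le_rfl ?_
  rintro _ rfl
  simp [truth]

theorem Definable.and (h : Definable size Inv P) (h' : Definable size Inv Q) :
    Definable size Inv (fun x mem e => P x mem e ∧ Q x mem e) := by
  intro d ρ hρ
  obtain ⟨p, k, hp⟩ := h d ρ hρ
  obtain ⟨q, l, hq⟩ := h' d ρ hρ
  refine ⟨.seq p (.cond (fun r => r.2) q (.act [])), k + (l + 2),
    fun x mem hI it rem hi c hc => ?_⟩
  have h1 := polyBound_add l 2 (size x)
  have h2 := le_polyBound 2 (size x)
  refine Runs.seq' (T' := polyBound l (size x) + 1 + 1) (hp x mem hI it rem hi c hc) ?_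
    ((Nat.add_le_add_left (show polyBound l (size x) + 1 + 1 ≤ polyBound (l + 2) (size x) by
      omega) _).trans (polyBound_add _ _ _))
  rintro _ rfl
  refine Runs.cond (T := polyBound l (size x) + 1) (fun hf => ?_) fun hf => ?_
  · refine (hq x mem hI it rem hi ⟨c.mem, c.pos, truth (P x mem (it ∘ ρ))⟩ hc).mono
      (Nat.le_succ _) ?_
    rintro _ rfl
    have hf : truth (P x mem (it ∘ ρ)) = true := hf
    simp [truth_eq_true.mp hf]
  · refine Runs.skip.mono (by omega) ?_
    rintro _ rfl
    have hf' := truth_eq_false.mp hf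
    simp [truth, hf']

theorem Definable.or (h : Definable size Inv P) (h' : Definable size Inv Q) :
    Definable size Inv (fun x mem e => P x mem e ∨ Q x mem e) :=
  (h.not.and h'.not).not.congr fun _ _ _ _ _ => by tauto

theorem Definable.imp (h : Definable size Inv P) (h' : Definable size Inv Q) :
    Definable size Inv (fun x mem e => P x mem e → Q x mem e) :=
  (h.and h'.not).not.congr fun _ _ _ _ _ => by tauto

theorem Definable.iff (h : Definable size Inv P) (h' : Definable size Inv Q) :
    Definable size Inv (fun x mem e => P x mem e ↔ Q x mem e) :=
  ((h.imp h').and (h'.imp h)).congr fun _ _ _ _ _ => by tauto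

/-- Quantification over the domain; the new variable is `none`. -/
theorem Definable.exists {P : C → Mem → (Option V → ℕ) → Prop} (h : Definable size Inv P) :
    Definable size Inv
      (fun x mem (e : V → ℕ) => ∃ a < size x, P x mem (fun v => v.elim a e)) := by
  intro d ρ hρ
  obtain ⟨p, k, hp⟩ := h (d + 1) (fun v => v.elim d ρ) (by
    rintro (_ | v)
    · exact Nat.lt_succ_self d
    · exact (hρ v).trans (Nat.lt_succ_self d))
  refine ⟨.seq (mapFlag fun _ => false) (loopOver none d true p), 1 + (k + 21),
    fun x mem hI it rem hi c hc => ?_⟩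
  refine Runs.seq' (T' := polyBound (k + 21) (size x)) (Runs.mapFlag _) ?_
    ((Nat.add_le_add_right (le_polyBound 1 _) _).trans (polyBound_add _ _ _))
  rintro _ rfl
  have henv : ∀ i, (update it d i ∘ fun v : Option V => v.elim d ρ) =
      fun v => v.elim i (it ∘ ρ) := by
    intro i
    funext v
    cases v with
    | none => simp
    | some v => exact congrFun (update_comp_of_lt hρ it i) v
  -- The flag tells whether a value below `i` is a witness. It is `false` at the start, and the loop
  -- is left as soon as it is set.
  refine (Runs.loopOver (T := polyBound k (size x)) (n := size x) (I := fun i c' => c' =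
      { c with flag := truth (∃ a < i, P x mem (fun v => v.elim a (it ∘ ρ))) }) (by simp)
    (hi.2 d le_rfl).1 (hi.2 d le_rfl).2 rfl (by simp [truth]) ?_
    ?_).mono (loop_polyBound le_rfl k) fun _ h => h
  · rintro i hlt _ rfl hfl
    have hno : ¬ ∃ a < i, P x mem (fun v => v.elim a (it ∘ ρ)) := by
      simpa [truth_eq_false] using hfl
    refine (hp x mem hI _ _ (hi.succ hlt _)
      ⟨c.mem, c.pos, truth (∃ a < i, P x mem fun v => v.elim a (it ∘ ρ))⟩ hc).mono le_rfl ?_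
    rintro _ rfl
    rw [henv i]
    simp only [Core.mk.injEq, true_and]
    unfold truth
    congr 1
    refine propext ⟨fun h => ⟨i, Nat.lt_succ_self i, h⟩, ?_⟩
    rintro ⟨a, ha, h⟩
    rcases Nat.lt_succ_iff_lt_or_eq.mp ha with ha | rfl
    · exact absurd ⟨a, ha, h⟩ hno
    · exact h
  · rintro i hle _ rfl hor
    simp only [Core.mk.injEq, true_and]
    rcases hor with rfl | h
    · rfl
    · have hyes : ∃ a < i, P x mem (fun v => v.elim a (it ∘ ρ)) := by
        simpa [truth_eq_true] using h
      obtain ⟨a, ha, h⟩ := hyes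
      rw [truth_eq_true.mpr ⟨a, ha, h⟩, truth_eq_true.mpr ⟨a, ha.trans_le hle, h⟩]

theorem Definable.forall {P : C → Mem → (Option V → ℕ) → Prop} (h : Definable size Inv P) :
    Definable size Inv
      (fun x mem (e : V → ℕ) => ∀ a < size x, P x mem (fun v => v.elim a e)) :=
  h.not.exists.not.congr fun _ _ _ _ _ => by push Not; rfl

/-- `V` varies in the induction, because the first coordinate of the tuple is absorbed into `Option
V`. -/
theorem Definable.exists_fin {r : ℕ} : ∀ {V : Type} {P : C → Mem → (V ⊕ Fin r → ℕ) → Prop},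
    Definable size Inv P → Definable size Inv (fun x mem (e : V → ℕ) =>
      ∃ a : Fin r → ℕ, (∀ i, a i < size x) ∧ P x mem (Sum.elim e a)) := by
  induction r with
  | zero =>
    intro V P h
    refine (h.comp (V := V) (Sum.elim id Fin.elim0)).congr fun x mem e _ _ => ?_
    have key : ∀ a : Fin 0 → ℕ, (Sum.elim e a) =
        fun w => e (Sum.elim id Fin.elim0 w) := by
      intro a
      funext w
      rcases w with v | i
      · rfl
      · exact i.elim0
    constructor
    · intro h
      exact ⟨Fin.elim0, fun i => i.elim0, by rwa [key]⟩
    · rintro ⟨a, -, h⟩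
      rwa [key] at h
  | succ r ih =>
    intro V P h
    let φ : V ⊕ Fin (r + 1) → Option V ⊕ Fin r :=
      Sum.elim (fun v => .inl (some v)) (Fin.cases (.inl none) (fun i => .inr i))
    refine (ih (h.comp φ)).exists.congr fun x mem e _ _ => ?_
    have key : ∀ (b : ℕ) (a : Fin r → ℕ),
        (fun w => Sum.elim (fun v : Option V => v.elim b e) a (φ w)) =
          Sum.elim e (Fin.cons b a : Fin (r + 1) → ℕ) := by
      intro b a
      funext w
      rcases w with v | i
      · rfl
      · refine Fin.cases ?_ (fun i => ?_) i <;> rfl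
    constructor
    · rintro ⟨b, hb, a, ha, h⟩
      rw [key] at h
      refine ⟨Fin.cons b a, fun i => ?_, h⟩
      refine Fin.cases ?_ (fun i => ?_) i
      · exact hb
      · exact ha i
    · rintro ⟨a, ha, h⟩
      refine ⟨a 0, ha 0, fun i => a i.succ, fun i => ha _, ?_⟩
      rw [key]
      have : (Fin.cons (a 0) (fun i => a i.succ) : Fin (r + 1) → ℕ) = a := Fin.cons_self_tail a
      rwa [this]

theorem Definable.exists_fun {ι : Type} [Finite ι] {P : C → Mem → (V ⊕ ι → ℕ) → Prop}
    (h : Definable size Inv P) : Definable size Inv (fun x mem (e : V → ℕ) =>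
      ∃ a : ι → ℕ, (∀ i, a i < size x) ∧ P x mem (Sum.elim e a)) := by
  obtain ⟨r, ⟨φ⟩⟩ := Finite.exists_equiv_fin ι
  refine (h.comp (Sum.map id φ)).exists_fin.congr fun x mem e _ _ => ?_
  have key : ∀ a : Fin r → ℕ, (fun w => Sum.elim e a (Sum.map id φ w)) =
      Sum.elim e (fun i => a (φ i)) := by
    intro a
    funext w
    rcases w with v | i <;> rfl
  constructor
  · rintro ⟨a, ha, h⟩
    exact ⟨fun i => a (φ i), fun i => ha _, by rwa [key] at h⟩
  · rintro ⟨a, ha, h⟩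
    exact ⟨fun i => a (φ.symm i), fun i => ha _, by rw [key]; simpa using h⟩

theorem Definable.forall_fun {ι : Type} [Finite ι] {P : C → Mem → (V ⊕ ι → ℕ) → Prop}
    (h : Definable size Inv P) : Definable size Inv (fun x mem (e : V → ℕ) =>
      ∀ a : ι → ℕ, (∀ i, a i < size x) → P x mem (Sum.elim e a)) :=
  h.not.exists_fun.not.congr fun _ _ _ _ _ => by push Not; rfl

theorem Definable.finite_forall {ι : Type} [Finite ι] {P : ι → C → Mem → (V → ℕ) → Prop}
    (h : ∀ i, Definable size Inv (P i)) :
    Definable size Inv (fun x mem e => ∀ i, P i x mem e) := by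
  classical
  have := Fintype.ofFinite ι
  have key : ∀ s : Finset ι, Definable size Inv (fun x mem e => ∀ i ∈ s, P i x mem e) := by
    intro s
    induction s using Finset.induction_on with
    | empty => simpa using Definable.trivial
    | insert i s hi ih => simpa using (h i).and ih
  simpa using key Finset.univ

/-- The order is defined by `e u + (a + 1) = e v`; the witness `a` stays in the domain because `e v`
does. -/
theorem Definable.lt (u v : V) : Definable size Inv (fun _ _ e => e u < e v) := by
  refine ((Definable.eq (V := Option V) ((Repeatable.var (some u)).add
    ((Repeatable.var none).add .one)) (Repeatable.var (some v))).exists).congr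
    fun x mem e _ he => ?_
  constructor
  · rintro ⟨a, -, h⟩
    simp only [Option.elim] at h
    omega
  · intro h
    refine ⟨e v - e u - 1, ?_, ?_⟩
    · have := he v; omega
    · simp only [Option.elim]; omega

end Definable

end StackProgram


namespace StackProgram

open Function

/-! ### Computable transformations of the memory -/

/-- A transformation of the tapes that satisfies the relation `R` can be computed in polynomial
time. -/
def Computes {C : Type} (size : C → ℕ) (Inv : C → Mem → Prop) (R : C → Mem → Mem → Prop) : Prop :=
  ∀ d : ℕ, ∃ p k, ∀ x mem, Inv x mem → ∀ it rem, Iter (size x) d it rem → ∀ c, Holds mem c →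
    Runs (size x) it rem p (polyBound k (size x)) c (fun c' => ∃ mem', Holds mem' c' ∧ R x mem mem')

/-- Nested loops over `r` iterators, beginning with `d`. -/
def nest (body : Prog Stk) : ℕ → ℕ → Prog Stk
  | 0, _ => body
  | r + 1, d => loopOver none d false (nest body r (d + 1))

/-- The values of the iterators in nested loops over `r` iterators, beginning with `d`. -/
def nestSet (N r d : ℕ) (it : ℕ → ℕ) : Set (ℕ → ℕ) :=
  {e | (∀ v, d ≤ v → v < d + r → e v < N) ∧ ∀ v, v < d ∨ d + r ≤ v → e v = it v}

/-- The invariant `J` is indexed by the set `S` of iterator values for which the body has been run.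
A set rather than a counter avoids any mention of the order in which tuples are visited. -/
theorem Runs.nest {N r : ℕ} {body : Prog Stk} {k D : ℕ} {J : Set (ℕ → ℕ) → Core → Prop}
    (hbody : ∀ it rem S c, Iter N D it rem → J S c →
      Runs N it rem body (polyBound k N) c (J (insert it S))) {d : ℕ} (hD : d + r = D)
    {it rem : ℕ → ℕ} (hi : Iter N d it rem) {S : Set (ℕ → ℕ)} {c : Core} (hJ : J S c) :
    Runs N it rem (nest body r d) (polyBound (k + 21 * r) N) c (J (S ∪ nestSet N r d it)) := by
  induction r generalizing d it rem S c with
  | zero =>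
    obtain rfl : d = D := hD
    have : S ∪ nestSet N 0 d it = insert it S := by
      have : nestSet N 0 d it = {it} := by
        ext e
        simp only [nestSet, Set.mem_ofPred_eq, Set.mem_singleton_iff, add_zero]
        constructor
        · rintro ⟨-, h⟩
          funext v
          exact h v (lt_or_ge v d)
        · rintro rfl
          exact ⟨fun v h h' => absurd h' (by omega), fun _ _ => rfl⟩
      rw [this, Set.union_singleton]
    rw [this]
    exact hbody it rem S c hi hJ
  | succ r ih =>
    have hstep : ∀ i, {e | ∃ j < i, e ∈ nestSet N r (d + 1) (update it d j)} ∪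
        nestSet N r (d + 1) (update it d i) =
        {e | ∃ j < i + 1, e ∈ nestSet N r (d + 1) (update it d j)} := by
      intro i
      ext e
      simp only [Set.mem_union, Set.mem_ofPred_eq]
      constructor
      · rintro (⟨j, hj, h⟩ | h)
        · exact ⟨j, by omega, h⟩
        · exact ⟨i, by omega, h⟩
      · rintro ⟨j, hj, h⟩
        rcases Nat.lt_succ_iff_lt_or_eq.mp hj with hj | rfl
        · exact .inl ⟨j, hj, h⟩
        · exact .inr h
    have hall : {e | ∃ j < N, e ∈ nestSet N r (d + 1) (update it d j)} =
        nestSet N (r + 1) d it := by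
      ext e
      simp only [nestSet, Set.mem_ofPred_eq]
      constructor
      · rintro ⟨j, hj, h1, h2⟩
        have hd : e d = j := by simpa using h2 d (.inl (by omega))
        refine ⟨fun v h3 h4 => ?_, fun v hv => ?_⟩
        · rcases h3.eq_or_lt with rfl | h3
          · rw [hd]; exact hj
          · exact h1 v h3 (by omega)
        · have hne : v ≠ d := by omega
          have := h2 v (by omega)
          simpa [hne] using this
      · rintro ⟨h1, h2⟩
        refine ⟨e d, h1 d le_rfl (by omega), fun v h3 h4 => h1 v (by omega) (by omega),
          fun v hv => ?_⟩
        by_cases hvd : v = d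
        · simp [hvd]
        · have := h2 v (by omega)
          simpa [hvd] using this
    refine (Runs.loopOver (T := polyBound (k + 21 * r) N) (n := N)
      (I := fun i => J (S ∪ {e | ∃ j < i, e ∈ nestSet N r (d + 1) (update it d j)})) (by simp)
      (hi.2 d le_rfl).1 (hi.2 d le_rfl).2 rfl (by simpa using hJ) ?_ ?_).mono ?_ fun _ h => h
    · intro i hlt c hJ _
      refine (ih (by omega) (hi.succ hlt _) hJ).mono le_rfl ?_
      intro c' h
      rwa [Set.union_assoc, hstep] at h
    · rintro i - c' hI (rfl | h)
      · rwa [hall] at hI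
      · simp at h
    · refine (loop_polyBound le_rfl _).trans (polyBound_mono (by omega) _)

/-- The address of a tuple over the domain `{0, …, N - 1}`. -/
noncomputable def address {V : Type} [Fintype V] (N : ℕ) (e : V → ℕ) : ℕ :=
  ∑ v, N ^ (Fintype.equivFin V v : ℕ) * e v

/-- An address is a number in base `N` whose digits are the entries of the tuple. -/
theorem address_injOn {V : Type} [Fintype V] {N : ℕ} {e e' : V → ℕ} (he : ∀ v, e v < N)
    (he' : ∀ v, e' v < N) (h : address N e = address N e') : e = e' := by
  let φ := Fintype.equivFin V
  let a : Fin (Fintype.card V) → Fin N := fun i => ⟨e (φ.symm i), he _⟩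
  let a' : Fin (Fintype.card V) → Fin N := fun i => ⟨e' (φ.symm i), he' _⟩
  have key : ∀ (e : V → ℕ) (he : ∀ v, e v < N), address N e =
      (finFunctionFinEquiv (fun i => (⟨e (φ.symm i), he _⟩ : Fin N)) : ℕ) := by
    intro e he
    rw [finFunctionFinEquiv_apply, address, ← φ.symm.sum_comp]
    refine Finset.sum_congr rfl fun i _ => ?_
    rw [mul_comm]
    simp [φ]
  have : a = a' := finFunctionFinEquiv.injective (Fin.ext (by rw [← key, ← key, h]))
  funext v
  simpa [a, a'] using congrArg Fin.val (congrFun this (φ v))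

theorem Repeatable.address {C : Type} {size : C → ℕ} {V W : Type} [Fintype W] (φ : W → V) :
    Repeatable size (fun x (e : V → ℕ) => address (size x) fun w => e (φ w)) :=
  Repeatable.sum _ fun w _ => (Repeatable.var (φ w)).dom_pow_mul _

/-- A loop over all tuples that stores a predicate in the tape `σ`. -/
theorem runs_fill {C : Type} {size : C → ℕ} {V : Type} [Fintype V] (σ d : ℕ) (q : Prog Stk)
    (k : ℕ) : ∃ p l, ∀ x it rem (c₀ : Core) (P : (V → ℕ) → Prop), Iter (size x) d it rem →
      c₀.pos = (fun _ => 0) →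
      (∀ it rem c, Iter (size x) (d + Fintype.card V) it rem → c.pos = (fun _ => 0) →
        (∀ τ, τ ≠ σ → c.mem τ = c₀.mem τ) → Runs (size x) it rem q (polyBound k (size x)) c
          (fun c' => c' = { c with flag := truth (P fun v => it (d + Fintype.equivFin V v)) })) →
      Runs (size x) it rem p (polyBound l (size x)) c₀ (fun c => c.pos = (fun _ => 0) ∧
        (∀ τ, τ ≠ σ → c.mem τ = c₀.mem τ) ∧
        (∀ e : V → ℕ, (∀ v, e v < size x) → (address (size x) e ∈ c.mem σ ↔ P e)) ∧
        ∀ a ∈ c.mem σ, a ∈ c₀.mem σ ∨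
          ∃ e : V → ℕ, (∀ v, e v < size x) ∧ a = address (size x) e) := by
  set r := Fintype.card V with hr
  let ρ : V → ℕ := fun v => d + Fintype.equivFin V v
  have hρ : ∀ v, ρ v < d + r := fun v => Nat.add_lt_add_left (Fintype.equivFin V v).2 d
  obtain ⟨w, l, hw⟩ := (Repeatable.address (size := size) (id : V → V)).access hρ σ
    (writeBit σ id)
  refine ⟨nest (.seq q w) r d, k + l + 21 * r, fun x it rem c₀ P hi hc₀ hq => ?_⟩
  -- The last two clauses say that the cells of the visited tuples are correct and that every other
  -- marked cell was marked initially.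
  let J : Set (ℕ → ℕ) → Core → Prop := fun S c => c.pos = (fun _ => 0) ∧
    (∀ τ, τ ≠ σ → c.mem τ = c₀.mem τ) ∧ (∀ e ∈ S, ∀ v : V, e (ρ v) < size x) ∧
    (∀ e ∈ S, address (size x) (e ∘ ρ) ∈ c.mem σ ↔ P (e ∘ ρ)) ∧
    ∀ a ∈ c.mem σ, a ∈ c₀.mem σ ∨ ∃ e ∈ S, a = address (size x) (e ∘ ρ)
  have hJ : J ∅ c₀ := ⟨hc₀, fun _ _ => rfl, by simp, by simp, fun a ha => .inl ha⟩
  refine (Runs.nest (J := J) (k := k + l) ?_ rfl hi hJ).mono le_rfl ?_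
  · rintro it rem S c hi' ⟨h1, h2, h3, h4, h5⟩
    refine Runs.seq' (hq it rem c hi' h1 h2) ?_ (polyBound_add _ _ _)
    rintro _ rfl
    set A := address (size x) (it ∘ ρ) with hA
    let B : Set ℕ := {a | (a = A ∧ P (it ∘ ρ)) ∨ (a ≠ A ∧ a ∈ c.mem σ)}
    refine (hw x it rem hi' ⟨c.mem, c.pos, truth (P (it ∘ ρ))⟩ (update c.mem σ B)
      (truth (P (it ∘ ρ))) h1 ?_).mono le_rfl ?_
    · refine (Runs.writeBit σ id (B := B) ?_).mono le_rfl ?_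
      · intro a
        simp only [update_self, id, truth_eq_true]
        change (a = A ∧ P (it ∘ ρ)) ∨ (a ≠ A ∧ a ∈ c.mem σ) ↔ if a = A then _ else _
        by_cases ha : a = A <;> simp [ha]
      · rintro _ rfl
        rfl
    · rintro _ rfl
      have hlt : ∀ v, it (ρ v) < size x := fun v => hi'.1 _ (hρ v)
      refine ⟨h1, fun τ hτ => by simp [hτ, h2 τ hτ], ?_, ?_, ?_⟩
      · rintro e (rfl | he)
        · exact hlt
        · exact h3 e he
      -- A write can affect an earlier cell only if the addresses agree; then the tuples agree, and
      -- the value written is correct for both.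
      · have : ∀ e : ℕ → ℕ, (∀ v, e (ρ v) < size x) →
            (e ∉ S → e = it) → (address (size x) (e ∘ ρ) ∈ B ↔ P (e ∘ ρ)) := by
          intro e he heS
          by_cases ha : address (size x) (e ∘ ρ) = A
          · have : e ∘ ρ = it ∘ ρ := address_injOn he hlt ha
            rw [this]
            simp [B, ← hA]
          · have heS : e ∈ S := by
              by_contra h
              exact ha (by rw [heS h])
            simp only [B, Set.mem_ofPred_eq, ha, false_and, ne_eq, not_false_eq_true, true_and,
              false_or]
            exact h4 e heS
        rintro e he
        simp only [update_self]
        rcases he with rfl | he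
        · exact this _ hlt fun _ => rfl
        · exact this e (h3 e he) fun h => absurd he h
      · intro a ha
        simp only [update_self] at ha
        rcases ha with ⟨rfl, -⟩ | ⟨-, ha⟩
        · exact .inr ⟨it, Set.mem_insert _ _, rfl⟩
        · rcases h5 a ha with h | ⟨e, he, h⟩
          · exact .inl h
          · exact .inr ⟨e, Set.mem_insert_of_mem _ he, h⟩
  · rintro c ⟨h1, h2, -, h4, h5⟩
    rw [Set.empty_union] at h4 h5
    refine ⟨h1, h2, fun e he => ?_, fun a ha => ?_⟩
    -- The tuple `e` is spread over the iterators `d, …, d + r - 1`; the other iterators keep their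
    -- values, so that `e'` is among the visited ones.
    · let e' : ℕ → ℕ := fun v => if h : d ≤ v ∧ v < d + r then
        e ((Fintype.equivFin V).symm ⟨v - d, by omega⟩) else it v
      have he' : e' ∘ ρ = e := by
        funext v
        have h : d ≤ ρ v ∧ ρ v < d + r := ⟨Nat.le_add_right _ _, hρ v⟩
        simp only [comp_apply, e', dif_pos h]
        congr 1
        rw [Equiv.symm_apply_eq]
        apply Fin.ext
        simp [ρ]
      rw [← he']
      refine h4 e' ⟨fun v hv hv' => ?_, fun v hv => ?_⟩
      · simp only [e', dif_pos (And.intro hv hv')]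
        exact he _
      · have : ¬ (d ≤ v ∧ v < d + r) := by omega
        simp [e', this]
    · rcases h5 a ha with h | ⟨e, he, h⟩
      · exact .inl h
      · exact .inr ⟨e ∘ ρ, fun v => he.1 _ (Nat.le_add_right _ _) (hρ v), h⟩

section Computes

variable {C : Type} {size : C → ℕ} {Inv Inv' : C → Mem → Prop} {R R' : C → Mem → Mem → Prop}

theorem Computes.mono (h : Computes size Inv R)
    (hR : ∀ x m m', Inv x m → R x m m' → R' x m m') : Computes size Inv R' := by
  intro d
  obtain ⟨p, k, hp⟩ := h d
  refine ⟨p, k, fun x m hI it rem hi c hc => (hp x m hI it rem hi c hc).mono le_rfl ?_⟩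
  rintro c' ⟨m', h1, h2⟩
  exact ⟨m', h1, hR x m m' hI h2⟩

theorem Computes.restrict (h : Computes size Inv R) (hI : ∀ x m, Inv' x m → Inv x m) :
    Computes size Inv' R := by
  intro d
  obtain ⟨p, k, hp⟩ := h d
  exact ⟨p, k, fun x m hI' => hp x m (hI x m hI')⟩

theorem Computes.seq (h : Computes size Inv R) (h' : Computes size Inv' R')
    (hI : ∀ x m m', Inv x m → R x m m' → Inv' x m') :
    Computes size Inv (fun x m m'' => ∃ m', R x m m' ∧ R' x m' m'') := by
  intro d
  obtain ⟨p, k, hp⟩ := h d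
  obtain ⟨q, l, hq⟩ := h' d
  refine ⟨.seq p q, k + l, fun x m hm it rem hi c hc => ?_⟩
  refine Runs.seq' (hp x m hm it rem hi c hc) ?_ (polyBound_add _ _ _)
  rintro c' ⟨m', hc', hR⟩
  refine (hq x m' (hI x m m' hm hR) it rem hi c' hc').mono le_rfl ?_
  rintro c'' ⟨m'', hc'', hR'⟩
  exact ⟨m'', hc'', m', hR, hR'⟩

/-- Iterating a transformation `size ^ D` times. The relation `J` describes the state after
some number of iterations. -/
theorem Computes.iterate (h : Computes size Inv R) (D : ℕ) (J : C → Mem → ℕ → Mem → Prop)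
    (h0 : ∀ x m, Inv x m → J x m 0 m) (hI : ∀ x m i m', Inv x m → J x m i m' → Inv x m')
    (hJ : ∀ x m i m' m'', Inv x m → J x m i m' → R x m' m'' → J x m (i + 1) m'') :
    Computes size Inv (fun x m m' => J x m (size x ^ D) m') := by
  -- Starting from an arbitrary stage `i` permits induction on `D`: one more loop performs `size x`
  -- blocks of `size x ^ D` iterations.
  suffices ∀ d, ∃ p k, ∀ x m₀ i m, Inv x m₀ → J x m₀ i m → ∀ it rem, Iter (size x) d it rem →
      ∀ c, Holds m c → Runs (size x) it rem p (polyBound k (size x)) c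
        (fun c' => ∃ m', Holds m' c' ∧ J x m₀ (i + size x ^ D) m') by
    intro d
    obtain ⟨p, k, hp⟩ := this d
    refine ⟨p, k, fun x m hm it rem hi c hc => ?_⟩
    simpa using hp x m 0 m hm (h0 x m hm) it rem hi c hc
  induction D with
  | zero =>
    intro d
    obtain ⟨p, k, hp⟩ := h d
    refine ⟨p, k, fun x m₀ i m hm hJm it rem hi c hc =>
      (hp x m (hI x m₀ i m hm hJm) it rem hi c hc).mono le_rfl ?_⟩
    rintro c' ⟨m', h1, h2⟩
    exact ⟨m', h1, hJ x m₀ i m m' hm hJm h2⟩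
  | succ D ih =>
    intro d
    obtain ⟨p, k, hp⟩ := ih (d + 1)
    refine ⟨loopOver none d false p, k + 21, fun x m₀ i m hm hJm it rem hi c hc => ?_⟩
    refine (Runs.loopOver (T := polyBound k (size x)) (n := size x)
      (I := fun j c' => ∃ m', Holds m' c' ∧ J x m₀ (i + j * size x ^ D) m') (by simp)
      (hi.2 d le_rfl).1 (hi.2 d le_rfl).2 rfl ⟨m, hc, by simpa using hJm⟩ ?_ ?_).mono
      (loop_polyBound le_rfl k) fun _ h => h
    · rintro j hlt c' ⟨m', hc', hJ'⟩ -
      refine (hp x m₀ _ m' hm hJ' _ _ (hi.succ hlt _) c' hc').mono le_rfl ?_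
      rintro c'' ⟨m'', h1, h2⟩
      refine ⟨m'', h1, ?_⟩
      convert! h2 using 1
      ring
    · rintro j - c' ⟨m', h1, h2⟩ (rfl | h)
      · refine ⟨m', h1, ?_⟩
        convert! h2 using 1
        ring
      · simp at h

/-- Storing a definable predicate in the tape `τ`. -/
theorem Computes.assign {V : Type} [Fintype V] {P : C → Mem → (V → ℕ) → Prop}
    (h : Definable size Inv P) (τ : ℕ) :
    Computes size Inv (fun x m m' => (∀ σ, σ ≠ τ → m' σ = m σ) ∧
      (∀ e : V → ℕ, (∀ v, e v < size x) → (address (size x) e ∈ m' τ ↔ P x m e)) ∧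
      ∀ a ∈ m' τ, a ∈ m τ ∨ ∃ e : V → ℕ, (∀ v, e v < size x) ∧ a = address (size x) e) := by
  intro d
  let ρ : V → ℕ := fun v => d + Fintype.equivFin V v
  have hρ : ∀ v, ρ v < d + Fintype.card V :=
    fun v => Nat.add_lt_add_left (Fintype.equivFin V v).2 d
  -- As `P` may depend on the tape `τ` itself, its values are first collected on the auxiliary tape
  -- `1` and only then copied. Old marks on tape `1` do no harm: only cells of tuples are read, and
  -- these have been overwritten.
  obtain ⟨p₁, k₁, hp₁⟩ := h (d + Fintype.card V) ρ hρ
  obtain ⟨q₁, l₁, hq₁⟩ := runs_fill (size := size) (V := V) 1 d p₁ k₁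
  obtain ⟨p₂, k₂, hp₂⟩ := (Repeatable.address (size := size) (id : V → V)).access hρ 1
    (readBit 1)
  obtain ⟨q₂, l₂, hq₂⟩ := runs_fill (size := size) (V := V) (τ + 2) d p₂ k₂
  refine ⟨.seq q₁ q₂, l₁ + l₂, fun x m hm it rem hi c hc => ?_⟩
  refine Runs.seq' (hq₁ x it rem c (P x m) hi hc.1 fun it rem c' hi' hc' hmem =>
    hp₁ x m hm it rem hi' c' ⟨hc', (hmem 0 (by omega)).trans hc.2.1, fun σ =>
      (hmem _ (by omega)).trans (hc.2.2 σ)⟩) ?_ (polyBound_add _ _ _)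
  rintro c₁ ⟨h1, h2, h3, h4⟩
  refine (hq₂ x it rem c₁ (fun e => address (size x) e ∈ c₁.mem 1) hi h1
    fun it rem c' hi' hc' hmem => hp₂ x it rem hi' c' _ _ hc' ?_).mono le_rfl ?_
  · refine (Runs.readBit' 1).mono le_rfl ?_
    rintro _ rfl
    simp only [update_self, Core.mk.injEq, true_and]
    rw [hmem 1 (by omega)]
    rfl
  · rintro c₂ ⟨g1, g2, g3, g4⟩
    refine ⟨fun σ => c₂.mem (σ + 2), ⟨g1, ?_, fun _ => rfl⟩, fun σ hσ => ?_, fun e he => ?_,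
      fun a ha => ?_⟩
    · rw [g2 0 (by omega), h2 0 (by omega), hc.2.1]
    · change c₂.mem (σ + 2) = m σ
      rw [g2 _ (by omega), h2 _ (by omega), hc.2.2]
    · change address (size x) e ∈ c₂.mem (τ + 2) ↔ _
      rw [g3 e he, h3 e he]
    · rcases g4 a ha with h | h
      · rw [h2 _ (by omega), hc.2.2] at h
        exact .inl h
      · exact .inr h

end Computes

end StackProgram


namespace StackProgram

open Function

/-! ### Guessing a subset of a tape -/

/-- Guesses a bit for every element of the tape `α`; the result is written to the left half of the
tape `β`. -/
def guessBits (α β : ℕ) : Prog Stk :=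
  .seq (.act [.pop (.right α)]) (.loop (fun r => r.1.isSome)
    (.seq (.cond (fun r => r.1 == some (some true))
      (.guess fun b => [.push (.left β) fun _ => some b])
      (.act [.push (.left β) fun _ => some false])) (.act [.pop (.right α)])))

/-- Moves the head of a tape to the left end. -/
def rewind (β : ℕ) : Prog Stk :=
  .seq (.act [.pop (.left β)]) (.loop (fun r => r.1.isSome)
    (.act [.push (.right β) fun r => r.1.getD (some false), .pop (.left β)]))

theorem exec_rewind (π : ℕ → St Stk → Bool) (β : ℕ) (t : ℕ) (s : St Stk) :
    ∃ s', Exec π (rewind β) t s (t + 2 * (s.stk (.left β)).length + 2) s' 0 ∧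
      s'.reg.2 = s.reg.2 ∧ s'.stk (.left β) = [] ∧
      s'.stk (.right β) = (s.stk (.left β)).reverse ++ s.stk (.right β) ∧
      ∀ k, k ≠ .left β → k ≠ .right β → s'.stk k = s.stk k := by
  have main : ∀ (l : List Sym) t (s : St Stk), s.reg.1 = l.head? → s.stk (.left β) = l.tail →
      ∃ s', Exec π (.loop (fun r => r.1.isSome)
          (.act [.push (.right β) fun r => r.1.getD (some false), .pop (.left β)]))
          t s (t + 2 * l.length + 1) s' 0 ∧
        s'.reg.2 = s.reg.2 ∧ s'.stk (.left β) = [] ∧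
        s'.stk (.right β) = l.reverse ++ s.stk (.right β) ∧
        ∀ k, k ≠ .left β → k ≠ .right β → s'.stk k = s.stk k := by
    intro l
    induction l with
    | nil =>
      intro t s h1 h2
      exact ⟨s, .loop_false (by simp [h1]), rfl, by simpa using h2, by simp, by simp⟩
    | cons x l ih =>
      intro t s h1 h2
      let s1 := runOps [.push (.right β) fun r => r.1.getD (some false), .pop (.left β)] s
      obtain ⟨s', g1, g2, g3, g4, g5⟩ := ih (t + 1 + 1) s1
        (by simp [s1, runOps, Op.run, h2]) (by simp [s1, runOps, Op.run, h2])
      refine ⟨s', ?_, g2, g3, ?_, fun k h h' => ?_⟩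
      · have := Exec.loop_true (c := fun r : Reg => r.1.isSome) (by simp [h1]) (.act _ _ _) g1
        convert! this using 1
        simp only [List.length_cons]; ring
      · rw [g4]
        simp [s1, runOps, Op.run, h1]
      · rw [g5 k h h']
        simp [s1, runOps, Op.run, h, h']
  obtain ⟨s', g1, g2, g3, g4, g5⟩ := main (s.stk (.left β)) (t + 1) (runOps [.pop (.left β)] s)
    rfl (by simp [runOps, Op.run])
  refine ⟨s', ?_, g2, g3, ?_, fun k h h' => ?_⟩
  · have := Exec.seq (.act _ t s) g1
    convert! this using 1
    ring
  · rw [g4]; simp [runOps, Op.run]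
  · rw [g5 k h h']; simp [runOps, Op.run, h]

/-- A guess is made only where `α` has a `true`; elsewhere `false` is written deterministically, so
guesses are counted by the marked cells. The number of symbols in the left half of `β` tells which
bit comes next. A policy that depends on this number through `H` can thus enforce the intersection
of `α` with any prescribed set. -/
theorem exec_guessBits (π : ℕ → St Stk → Bool) {α β : ℕ} (t : ℕ) (s : St Stk) :
    ∃ (t' : ℕ) (s' : St Stk) (bs : List Sym), Exec π (guessBits α β) t s t' s' ((s.stk (.right α)).count (some true)) ∧
      t' ≤ t + 5 * (s.stk (.right α)).length + 2 ∧ s'.reg.2 = s.reg.2 ∧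
      s'.stk (.right α) = [] ∧ s'.stk (.left β) = bs.reverse ++ s.stk (.left β) ∧
      bs.length = (s.stk (.right α)).length ∧
      (∀ i : ℕ, bs[i]? = some (some true) → (s.stk (.right α))[i]? = some (some true)) ∧
      (∀ i, i < bs.length → ∃ b, bs[i]? = some (some b)) ∧
      (∀ H : ℕ → Bool, (∀ t s, π t s = H (s.stk (.left β)).length) → ∀ i,
        (s.stk (.right α))[i]? = some (some true) → H (i + (s.stk (.left β)).length) = true →
          bs[i]? = some (some true)) ∧
      (∀ H : ℕ → Bool, (∀ t s, π t s = H (s.stk (.left β)).length) → ∀ i,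
        bs[i]? = some (some true) → H (i + (s.stk (.left β)).length) = true) ∧
      ∀ k, k ≠ .right α → k ≠ .left β → s'.stk k = s.stk k := by
  have main : ∀ (l : List Sym) t (s : St Stk), s.reg.1 = l.head? → s.stk (.right α) = l.tail →
      ∃ (t' : ℕ) (s' : St Stk) (bs : List Sym), Exec π (.loop (fun r => r.1.isSome)
        (.seq (.cond (fun r => r.1 == some (some true))
          (.guess fun b => [.push (.left β) fun _ => some b])
          (.act [.push (.left β) fun _ => some false])) (.act [.pop (.right α)])))
          t s t' s' (l.count (some true)) ∧
      t' ≤ t + 5 * l.length + 1 ∧ s'.reg.2 = s.reg.2 ∧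
      s'.stk (.right α) = [] ∧ s'.stk (.left β) = bs.reverse ++ s.stk (.left β) ∧
      bs.length = l.length ∧
      (∀ i : ℕ, bs[i]? = some (some true) → l[i]? = some (some true)) ∧
      (∀ i, i < bs.length → ∃ b, bs[i]? = some (some b)) ∧
      (∀ H : ℕ → Bool, (∀ t s, π t s = H (s.stk (.left β)).length) → ∀ i : ℕ,
        l[i]? = some (some true) → H (i + (s.stk (.left β)).length) = true →
          bs[i]? = some (some true)) ∧
      (∀ H : ℕ → Bool, (∀ t s, π t s = H (s.stk (.left β)).length) → ∀ i,
        bs[i]? = some (some true) → H (i + (s.stk (.left β)).length) = true) ∧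
      ∀ k, k ≠ .right α → k ≠ .left β → s'.stk k = s.stk k := by
    intro l
    induction l with
    | nil =>
      intro t s h1 h2
      exact ⟨t + 1, s, [], .loop_false (by simp [h1]), by simp, rfl, by simpa using h2, by simp,
        rfl, by simp, by simp, by simp, by simp, by simp⟩
    | cons x l ih =>
      intro t s h1 h2
      -- One round writes a bit `b` with `n ≤ 1` guesses. A guess takes place at time `t + 2`, after
      -- the loop test and the case distinction.
      obtain ⟨b, s1, n, hex, hs1, hn, hbx, hbH⟩ : ∃ (b : Bool) (s1 : St Stk) (n : ℕ),
          Exec π (.seq (.cond (fun r => r.1 == some (some true))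
            (.guess fun b => [.push (.left β) fun _ => some b])
            (.act [.push (.left β) fun _ => some false])) (.act [.pop (.right α)]))
            (t + 1) s (t + 4) s1 n ∧
          s1 = runOps [.push (.left β) fun _ => some b, .pop (.right α)] s ∧
          n + l.count (some true) = (x :: l).count (some true) ∧
          (b = true → x = some true) ∧
          (x = some true → b = π (t + 2) s) := by
        by_cases hx : x = some true
        · refine ⟨π (t + 2) s, _, 1, ?_, rfl, by simp [hx]; ring, fun _ => hx, fun _ => rfl⟩
          exact Exec.seq (g := 1) (g' := 0) (.cond_true (by simp [h1, hx]) (.guess _ _ _))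
            (.act _ _ _)
        · refine ⟨false, _, 0, ?_, rfl, by simp [hx], by simp, fun h => absurd h hx⟩
          exact Exec.seq (g := 0) (g' := 0) (.cond_false (by simp [h1, hx]) (.act _ _ _))
            (.act _ _ _)
      have hleft : s1.stk (.left β) = some b :: s.stk (.left β) := by
        simp [hs1, runOps, Op.run]
      obtain ⟨t', s', bs, g1, g2, g3, g4, g5, g6, g7, g8, g9, g10, g11⟩ := ih (t + 4) s1
        (by simp [hs1, runOps, Op.run, h2]) (by simp [hs1, runOps, Op.run, h2])
      refine ⟨t', s', some b :: bs, ?_, ?_, ?_, g4, ?_, by simp [g6], ?_, ?_, ?_, ?_, ?_⟩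
      · have := Exec.loop_true (c := fun r : Reg => r.1.isSome) (by simp [h1]) hex g1
        rwa [hn] at this
      · simp only [List.length_cons]; omega
      · rw [g3]; simp [hs1, runOps, Op.run]
      · rw [g5, hleft]; simp
      · rintro (_ | i) h
        · have : b = true := by simpa using h
          simp [hbx this]
        · exact g7 i h
      · rintro (_ | i) h
        · exact ⟨b, rfl⟩
        · exact g8 i (by simpa using h)
      · rintro H hH (_ | i) hi hHi
        · have hx : x = some true := by simpa using hi
          have : b = true := by
            rw [hbH hx, hH]; simpa using hHi
          simp [this]
        · refine g9 H hH i hi ?_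
          rw [hleft, List.length_cons, ← hHi]
          congr 1; ring
      · rintro H hH (_ | i) hi
        · have hb : b = true := by simpa using hi
          rw [zero_add, ← hH (t + 2) s, ← hbH (hbx hb), hb]
        · have := g10 H hH i hi
          rw [hleft, List.length_cons] at this
          rw [← this]
          congr 1; ring
      · intro k h h'
        rw [g11 k h h']
        simp [hs1, runOps, Op.run, h, h']
  obtain ⟨t', s', bs, g1, g2, g3, g4, g5, g6, g7, g8, g9, g10, g11⟩ :=
    main (s.stk (.right α)) (t + 1) (runOps [.pop (.right α)] s) rfl (by simp [runOps, Op.run])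
  have hleft : (runOps [.pop (.right α)] s).stk (.left β) = s.stk (.left β) := by
    simp [runOps, Op.run]
  rw [hleft] at g5 g9 g10
  refine ⟨t', s', bs, ?_, by omega, g3, g4, g5, g6, g7, g8, g9, g10, fun k h h' => ?_⟩
  · have := Exec.seq (.act _ t s) g1
    rwa [zero_add] at this
  · rw [g11 k h h']; simp [runOps, Op.run, h]

theorem count_eq_encard (l : List Sym) (x : Sym) :
    (l.count x : ℕ∞) = {i : ℕ | l[i]? = some x}.encard := by
  induction l with
  | nil => simp
  | cons y l ih =>
    have himg : {i : ℕ | (y :: l)[i]? = some x} =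
        (if y = x then {0} else ∅) ∪ Nat.succ '' {i : ℕ | l[i]? = some x} := by
      ext i
      rcases i with _ | i
      · by_cases h : y = x <;> simp [h]
      · by_cases h : y = x <;> simp [h]
    have hdisj : Disjoint (if y = x then ({0} : Set ℕ) else ∅)
        (Nat.succ '' {i : ℕ | l[i]? = some x}) := by
      rw [Set.disjoint_left]
      rintro a ha ⟨b, -, rfl⟩
      by_cases h : y = x <;> simp [h] at ha
    rw [himg, Set.encard_union_eq hdisj, Nat.succ_injective.injOn.encard_image, ← ih]
    by_cases h : y = x
    · simp [h, add_comm]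
    · simp [h]

/-- Guesses a subset of the tape `α`, which becomes the contents of the tape `β`. The tape `α` is
cleared. -/
def guessTape (α β : ℕ) : Prog Stk := .seq (guessBits α β) (rewind β)

/-- The number of guesses is the number of candidates in `α`, whereas the time depends on the length
of the whole stack. For policies of the special form, `G` is determined, which is needed to exhibit
accepting runs. -/
theorem exec_guessTape (π : ℕ → St Stk → Bool) {α β : ℕ} (hαβ : α ≠ β) (t : ℕ) (s : St Stk)
    {N : ℕ} {it rem : ℕ → ℕ} {c : Core} (hs : Rep N it rem c s) (hpos : c.pos = fun _ => 0)
    (hβ : c.mem β = ∅) :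
    ∃ t' s' g G, Exec π (guessTape α β) t s t' s' g ∧
      t' ≤ t + 7 * (s.stk (.right α)).length + 4 ∧ (g : ℕ∞) = (c.mem α).encard ∧ G ⊆ c.mem α ∧
      Rep N it rem { c with mem := update (update c.mem α ∅) β G } s' ∧
      ∀ H : ℕ → Bool, (∀ t s, π t s = H (s.stk (.left β)).length) →
        G = {a | a ∈ c.mem α ∧ H a = true} := by
  obtain ⟨t1, s1, bs, g1, g2, g3, g4, g5, g6, g7, g8, g9, g10, g11⟩ :=
    exec_guessBits π (α := α) (β := β) t s
  obtain ⟨s2, f1, f2, f3, f4, f5⟩ := exec_rewind π β t1 s1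
  have tape0 : ∀ τ, s.stk (.left τ) = [] := fun τ => by
    have := (hs.tape τ).1
    rw [hpos] at this
    simpa using this
  have hα : ∀ i : ℕ, (s.stk (.right α))[i]? = some (some true) ↔ i ∈ c.mem α := by
    intro i
    have := (hs.tape α).2 i
    rw [tape0, List.reverse_nil, List.nil_append] at this
    constructor
    · intro h
      rw [h] at this
      simpa using this
    · intro h
      cases hx : (s.stk (.right α))[i]? with
      | none => rw [hx] at this; simp [h] at this
      | some y => rw [hx] at this; simp [h] at this; rw [this]
  rw [tape0] at g5 g9 g10
  rw [List.append_nil] at g5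
  refine ⟨_, s2, _, {i | bs[i]? = some (some true)}, g1.seq f1, ?_, ?_, ?_, ?_, ?_⟩
  · rw [g5, List.length_reverse, g6]; omega
  · rw [add_zero, count_eq_encard]
    congr 1
    ext i
    exact hα i
  · intro i hi
    exact (hα i).mp (g7 i hi)
  · have same : ∀ k, k ≠ .right α → k ≠ .left β → k ≠ .right β → s2.stk k = s.stk k :=
      fun k h1 h2 h3 => (f5 k h2 h3).trans (g11 k h1 h2)
    refine ⟨?_, fun v => ?_, fun v => ?_, fun v => ?_, fun τ => ?_, ?_⟩
    · rw [same _ (by simp) (by simp) (by simp), hs.dom]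
    · rw [same _ (by simp) (by simp) (by simp), hs.up]
    · rw [same _ (by simp) (by simp) (by simp), hs.dn]
    · rw [same _ (by simp) (by simp) (by simp), hs.aux]
    · by_cases hβτ : τ = β
      · subst hβτ
        -- The guessed bits come before the old right half, which reads as `false` throughout
        -- because `β` was empty.
        have hR : s2.stk (.right τ) = bs ++ s.stk (.right τ) := by
          rw [f4, g5, List.reverse_reverse, g11 _ (by simpa using hαβ.symm) (by simp)]
        rw [f3, hR]
        refine ⟨by simp [hpos], fun a => ?_⟩
        have h0 := (hs.tape τ).2
        rw [hβ, tape0] at h0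
        simp only [List.reverse_nil, List.nil_append, update_self]
        rcases lt_or_ge a bs.length with ha | ha
        · rw [List.getElem?_append_left ha]
          obtain ⟨b, hb⟩ := g8 a ha
          simp [hb]
        · rw [List.getElem?_append_right ha]
          have h1 : bs[a]? = none := List.getElem?_eq_none ha
          have := h0 (a - bs.length)
          simp only [List.reverse_nil, List.nil_append] at this
          rw [this]
          simp [h1]
      · rw [show s2.stk (.left τ) = s.stk (.left τ) from
          same _ (by simp) (by simpa using hβτ) (by simp)]
        by_cases hατ : τ = α
        · subst hατ
          rw [f5 _ (by simp) (by simpa using hβτ), g4, tape0]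
          refine ⟨by simp [hpos], fun a => ?_⟩
          simp [hβτ]
        · rw [same _ (by simpa using hατ) (by simp) (by simpa using hβτ)]
          have := hs.tape τ
          simpa [hβτ, hατ] using this
    · rw [f2, g3]; exact hs.flag
  · intro H hH
    ext i
    simp only [Set.mem_ofPred_eq]
    constructor
    · intro h
      exact ⟨(hα i).mp (g7 i h), by simpa using g10 H hH i h⟩
    · rintro ⟨h1, h2⟩
      exact g9 H hH i ((hα i).mpr h1) (by simpa using h2)

/-! ### Reading the input -/

/-- Reads the input. The domain gets `b` more elements than the input has symbols, and the tapes
`2`, `3`, `4` hold the positions of the three symbols. -/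
def load (b : ℕ) : Prog Stk :=
  .seq (.act (List.replicate b (.push .dom fun _ => none))) <|
  .seq (.act [.pop .inp]) <|
  .seq (.loop (fun r => r.1.isSome)
    (.act [.push .tmp fun r => r.1.getD none, .push .dom fun _ => none, .pop .inp])) <|
  .seq (.act [.pop .tmp]) <|
  .loop (fun r => r.1.isSome)
    (.act [.push (.right 2) fun r => some (r.1 == some (some true)),
      .push (.right 3) fun r => some (r.1 == some (some false)),
      .push (.right 4) fun r => some (r.1 == some none), .pop .tmp])

/-- The contents of the tapes after reading the input. -/
def inputMem (u : List Sym) : Mem := fun τ =>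
  if τ = 0 then {i | u[i]? = some (some true)}
  else if τ = 1 then {i | u[i]? = some (some false)}
  else if τ = 2 then {i | u[i]? = some none}
  else ∅

/-- The input is reversed onto `tmp` while the domain is being counted; the second pass reverses it
again, so that the tapes carry the input in its original order. -/
theorem exec_load (π : ℕ → St Stk → Bool) (b : ℕ) (u : List Sym) :
    ∃ s', Exec π (load b) 0 (.init .inp u) (4 * u.length + 5) s' 0 ∧ ∃ c,
      Rep (u.length + b) (fun _ => 0) (fun _ => 0) c s' ∧ Holds (inputMem u) c ∧
      c.flag = false := by
  have loop1 : ∀ (l : List Sym) t (s : St Stk), s.reg.1 = l.head? → s.stk .inp = l.tail →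
      ∃ s', Exec π (.loop (fun r => r.1.isSome)
          (.act [.push .tmp fun r => r.1.getD none, .push .dom fun _ => none, .pop .inp]))
          t s (t + 2 * l.length + 1) s' 0 ∧ s'.reg.2 = s.reg.2 ∧ s'.stk .inp = [] ∧
        s'.stk .tmp = l.reverse ++ s.stk .tmp ∧
        s'.stk .dom = List.replicate l.length none ++ s.stk .dom ∧
        ∀ k, k ≠ .inp → k ≠ .tmp → k ≠ .dom → s'.stk k = s.stk k := by
    intro l
    induction l with
    | nil =>
      intro t s h1 h2
      exact ⟨s, .loop_false (by simp [h1]), rfl, by simpa using h2, by simp, by simp, by simp⟩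
    | cons x l ih =>
      intro t s h1 h2
      let s1 := runOps [.push .tmp fun r => r.1.getD none, .push .dom fun _ => none, .pop .inp] s
      obtain ⟨s', g1, g2, g3, g4, g5, g6⟩ := ih (t + 1 + 1) s1
        (by simp [s1, runOps, Op.run, h2]) (by simp [s1, runOps, Op.run, h2])
      refine ⟨s', ?_, g2, g3, ?_, ?_, fun k h h' h'' => ?_⟩
      · have := Exec.loop_true (c := fun r : Reg => r.1.isSome) (by simp [h1]) (.act _ _ _) g1
        convert! this using 1
        simp only [List.length_cons]; ring
      · rw [g4]
        simp [s1, runOps, Op.run, h1]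
      · rw [g5]
        simp [s1, runOps, Op.run, List.replicate_succ']
      · rw [g6 k h h' h'']
        simp [s1, runOps, Op.run, h, h', h'']
  have loop2 : ∀ (l : List Sym) t (s : St Stk), s.reg.1 = l.head? → s.stk .tmp = l.tail →
      ∃ s', Exec π (.loop (fun r => r.1.isSome)
          (.act [.push (.right 2) fun r => some (r.1 == some (some true)),
            .push (.right 3) fun r => some (r.1 == some (some false)),
            .push (.right 4) fun r => some (r.1 == some none), .pop .tmp]))
          t s (t + 2 * l.length + 1) s' 0 ∧ s'.reg.2 = s.reg.2 ∧
        s'.stk (.right 2) = (l.map fun x => some (x == some true)).reverse ++ s.stk (.right 2) ∧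
        s'.stk (.right 3) = (l.map fun x => some (x == some false)).reverse ++ s.stk (.right 3) ∧
        s'.stk (.right 4) = (l.map fun x => some (x == none)).reverse ++ s.stk (.right 4) ∧
        ∀ k, k ≠ .tmp → k ≠ .right 2 → k ≠ .right 3 → k ≠ .right 4 → s'.stk k = s.stk k := by
    intro l
    induction l with
    | nil =>
      intro t s h1 h2
      exact ⟨s, .loop_false (by simp [h1]), rfl, by simp, by simp, by simp, by simp⟩
    | cons x l ih =>
      intro t s h1 h2
      let s1 := runOps [.push (.right 2) fun r => some (r.1 == some (some true)),
            .push (.right 3) fun r => some (r.1 == some (some false)),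
            .push (.right 4) fun r => some (r.1 == some none), .pop .tmp] s
      obtain ⟨s', g1, g2, g3, g4, g5, g6⟩ := ih (t + 1 + 1) s1
        (by simp [s1, runOps, Op.run, h2]) (by simp [s1, runOps, Op.run, h2])
      refine ⟨s', ?_, g2, ?_, ?_, ?_, fun k h h2 h3 h4 => ?_⟩
      · have := Exec.loop_true (c := fun r : Reg => r.1.isSome) (by simp [h1]) (.act _ _ _) g1
        convert! this using 1
        simp only [List.length_cons]; ring
      · rw [g3]
        simp [s1, runOps, Op.run, h1]
      · rw [g4]
        simp [s1, runOps, Op.run, h1]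
      · rw [g5]
        simp [s1, runOps, Op.run, h1]
      · rw [g6 k h h2 h3 h4]
        simp [s1, runOps, Op.run, h, h2, h3, h4]
  have e0 : ∀ b (s : St Stk), runOps (List.replicate b (.push .dom fun _ => none)) s =
      ⟨s.reg, update s.stk .dom (List.replicate b none ++ s.stk .dom)⟩ := by
    intro b
    induction b with
    | zero => intro s; simp [runOps]
    | succ b ih =>
      intro s
      rw [List.replicate_succ, runOps, ih]
      simp [Op.run, List.replicate_succ']
  obtain ⟨s1, a1, a2, a3, a4, a5, a6⟩ := loop1 u 2
    (runOps [.pop .inp] (runOps (List.replicate b (.push .dom fun _ => none)) (.init .inp u)))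
    (by rw [e0]; simp [runOps, Op.run, St.init]) (by rw [e0]; simp [runOps, Op.run, St.init])
  have htmp : s1.stk .tmp = u.reverse := by
    rw [a4, e0]; simp [runOps, Op.run, St.init]
  obtain ⟨s2, b1, b2, b3, b4, b5, b6⟩ := loop2 u.reverse (2 + 2 * u.length + 1 + 1)
    (runOps [.pop .tmp] s1) (by simp [runOps, Op.run, htmp]) (by simp [runOps, Op.run, htmp])
  refine ⟨s2, ?_, ?_⟩
  · have := Exec.seq (.act _ 0 _) (Exec.seq (.act _ _ _) (Exec.seq a1 (Exec.seq (.act _ _ _) b1)))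
    convert! this using 1
    rw [List.length_reverse]; ring
  · have init : ∀ k, k ≠ .inp → k ≠ .tmp → k ≠ .dom → k ≠ .right 2 → k ≠ .right 3 →
        k ≠ .right 4 → s2.stk k = [] := by
      intro k h1 h2 h3 h4 h5 h6
      rw [b6 k h2 h4 h5 h6]
      simp only [runOps, Op.run, ne_eq, h2, not_false_eq_true, update_of_ne]
      rw [a6 k h1 h2 h3, e0]
      simp [runOps, Op.run, h1, h3, St.init]
    have mid : ∀ k, k ≠ .inp → k ≠ .tmp → k ≠ .dom → (runOps [.pop .tmp] s1).stk k = [] := by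
      intro k h1 h2 h3
      simp only [runOps, Op.run, ne_eq, h2, not_false_eq_true, update_of_ne]
      rw [a6 k h1 h2 h3, e0]
      simp [runOps, Op.run, h1, h3, St.init]
    rw [mid _ (by simp) (by simp) (by simp), List.append_nil, List.map_reverse,
      List.reverse_reverse] at b3 b4 b5
    have tapeOf : ∀ y : Sym, TapeRep {i | u[i]? = some y} 0 [] (u.map fun x => some (x == y)) := by
      intro y
      refine ⟨rfl, fun a => ?_⟩
      cases h : u[a]? with
      | none => simp [h]
      | some z =>
        simp only [List.reverse_nil, List.nil_append, List.getElem?_map, h, Option.map_some,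
          Option.getD_some, Set.mem_ofPred_eq, Option.some.injEq]
        exact Bool.eq_iff_iff.mpr (by simp)
    refine ⟨⟨fun τ => if τ < 2 then ∅ else inputMem u (τ - 2), fun _ => 0, false⟩,
      ⟨?_, fun v => ?_, fun v => ?_, fun v => ?_, fun τ => ?_, ?_⟩, ⟨rfl, rfl, fun τ => ?_⟩, rfl⟩
    · rw [b6 _ (by simp) (by simp) (by simp) (by simp)]
      simp only [runOps, Op.run, ne_eq, reduceCtorEq, not_false_eq_true, update_of_ne]
      rw [a5, e0]
      simp [runOps, Op.run, St.init]
    · rw [init] <;> simp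
    · rw [init] <;> simp
    · rw [init] <;> simp
    · rw [init (.left τ)] <;> try simp
      by_cases h2 : τ = 2
      · subst h2
        rw [b3]; simpa [inputMem] using tapeOf (some true)
      by_cases h3 : τ = 3
      · subst h3
        rw [b4]; simpa [inputMem] using tapeOf (some false)
      by_cases h4 : τ = 4
      · subst h4
        rw [b5]; simpa [inputMem] using tapeOf none
      rw [init (.right τ) (by simp) (by simp) (by simp) (by simp [h2]) (by simp [h3])
        (by simp [h4])]
      refine ⟨rfl, fun a => ?_⟩
      by_cases hlt : τ < 2
      · simp
        omega
      · have k0 : τ - 2 ≠ 0 := by omega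
        have k1 : τ - 2 ≠ 1 := by omega
        have k2 : τ - 2 ≠ 2 := by omega
        simp [inputMem, k0, k1, k2]
    · rw [b2]
      simp only [runOps, Op.run]
      rw [a2, e0]
      simp [runOps, Op.run, St.init]
    · simp

end StackProgram


/-! ## Guess-and-check machines -/

theorem NTM.Halted.run_eq {α : Type} {M : NTM α} {w : List α} {ω : ℕ → Bool} {T : ℕ}
    (h : M.Halted (M.run w ω T)) {u : ℕ} (hu : T ≤ u) : M.run w ω u = M.run w ω T := by
  induction u, hu using Nat.le_induction with
  | base => rfl
  | succ u _ ih =>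
    rw [NTM.run, ih]
    revert h
    generalize M.run w ω T = c
    rcases c with ⟨_ | l, v, S⟩
    · intro _; rfl
    · intro h; cases h

theorem NTM.Halted.of_le {α : Type} {M : NTM α} {w : List α} {ω : ℕ → Bool} {T u : ℕ}
    (h : M.Halted (M.run w ω T)) (hu : T ≤ u) : M.Halted (M.run w ω u) := by
  rwa [h.run_eq hu]

namespace StackProgram

open Function

theorem const_mul_polyBound (c a N : ℕ) : c * polyBound a N ≤ polyBound (c * a + a) N := by
  have h : (N + 1) ^ a ≤ (N + 1) ^ (c * a + a) := Nat.pow_le_pow_right N.succ_pos (by omega)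
  calc c * polyBound a N = c * a * (N + 1) ^ a := by rw [polyBound]; ring
    _ ≤ (c * a + a) * (N + 1) ^ (c * a + a) := by gcongr; omega

/-- The bounds refer to the domain of size `N + b`; because of `N + b + 1 ≤ (b + 1) * (N + 1)` they
are polynomial in the length `N` of the input. -/
theorem polyBound_add_le (a b N : ℕ) :
    polyBound a (N + b) ≤ polyBound (a * (b + 1) ^ a + a) N := by
  have h : (N + b + 1) ^ a ≤ (b + 1) ^ a * (N + 1) ^ a := by
    rw [← mul_pow]
    refine Nat.pow_le_pow_left ?_ a
    nlinarith [Nat.zero_le (b * N)]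
  have h' : (N + 1) ^ a ≤ (N + 1) ^ (a * (b + 1) ^ a + a) :=
    Nat.pow_le_pow_right N.succ_pos (by omega)
  calc polyBound a (N + b) ≤ a * ((b + 1) ^ a * (N + 1) ^ a) := Nat.mul_le_mul_left _ h
    _ = a * (b + 1) ^ a * (N + 1) ^ a := by ring
    _ ≤ (a * (b + 1) ^ a + a) * (N + 1) ^ (a * (b + 1) ^ a + a) := by gcongr; omega

/-- The words that encode an instance are recognized; for such a word the tape `3` is filled, a
subset of the tape `3` is guessed and written to the tape `4`, and this guess is checked. -/
theorem exists_guess_machine {C : Type} (enc : C → List Sym) (b : ℕ)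
    {R R' : C → Mem → Mem → Prop} {Acc : C → Mem → Prop}
    (hvalid : Definable (fun u : List Sym => u.length + b) (fun u m => m = inputMem u)
      (fun u _ (_ : Empty → ℕ) => ∃ x, enc x = u))
    (hR : Computes (fun x => (enc x).length + b) (fun x m => m = inputMem (enc x)) R)
    (hempty : ∀ x m, R x (inputMem (enc x)) m → m 4 = ∅)
    (hR' : Computes (fun x => (enc x).length + b) (fun x m => ∃ m₀ G, R x (inputMem (enc x)) m₀ ∧
      G ⊆ m₀ 3 ∧ m = update (update m₀ 3 ∅) 4 G) R')
    (hAcc : Definable (fun x => (enc x).length + b) (fun x m => ∃ m₀ G,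
      R x (inputMem (enc x)) m₀ ∧ G ⊆ m₀ 3 ∧ R' x (update (update m₀ 3 ∅) 4 G) m)
      (fun x m (_ : Empty → ℕ) => Acc x m)) :
    ∃ (M : NTM Sym) (k : ℕ),
      (∀ u, M.HaltsWithin u (polyBound k u.length)) ∧
      (∀ u, ∀ B : ℕ, (∀ x, enc x = u → ∀ m, R x (inputMem u) m → (m 3).encard ≤ B) →
        M.NondetStepsWithin u B) ∧
      (∀ u, M.Accepts u → ∃ x, enc x = u ∧ ∃ m₀ G m, R x (inputMem u) m₀ ∧ G ⊆ m₀ 3 ∧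
        R' x (update (update m₀ 3 ∅) 4 G) m ∧ Acc x m) ∧
      ∀ x, (∃ H : Set ℕ, ∀ m₀ m, R x (inputMem (enc x)) m₀ →
        R' x (update (update m₀ 3 ∅) 4 {a | a ∈ m₀ 3 ∧ a ∈ H}) m → Acc x m) →
        M.Accepts (enc x) := by
  obtain ⟨p₁, k₁, hp₁⟩ := hvalid 0 Empty.elim (fun v => v.elim)
  obtain ⟨p₂, k₂, hp₂⟩ := hR 0
  obtain ⟨p₃, k₃, hp₃⟩ := hR' 0
  obtain ⟨p₄, k₄, hp₄⟩ := hAcc 0 Empty.elim (fun v => v.elim)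
  let p : Prog Stk := .seq (load b) (.seq p₁ (.cond (fun r => r.2)
    (.seq p₂ (.seq (guessTape 5 6) (.seq p₃ p₄))) (.act [])))
  -- Only the stages before the guess matter for `W`, as they determine the length of the candidate
  -- tape.
  let W := (Prog.seq (load b) (.seq p₁ p₂)).width
  let a := 7 + k₁ + k₂
  -- The summands bound the stages before the guess, seven steps for each cell of a tape of length
  -- at most `W * polyBound a N`, the constant overhead of guessing, and the two stages after it.
  let K := a + (7 * W * a + a) + 5 + k₃ + k₄
  have hpre : ∀ N, 4 * N + 5 + polyBound k₁ N + 2 + polyBound k₂ N ≤ polyBound a N := by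
    intro N
    have h0 : 4 * N + 7 ≤ polyBound 7 N := by
      have : N + 1 ≤ (N + 1) ^ 7 := Nat.le_self_pow (by norm_num) _
      simp only [polyBound]
      omega
    have h1 := polyBound_add 7 k₁ N
    have h2 := polyBound_add (7 + k₁) k₂ N
    change _ ≤ polyBound (7 + k₁ + k₂) N
    omega
  have hmono : ∀ N, polyBound a N ≤ polyBound K N := fun N => polyBound_mono (by omega) N
  have init0 : ∀ N, Iter N 0 (fun _ => 0) (fun _ => 0) :=
    fun N => ⟨fun v hv => absurd hv (by omega), fun _ _ => ⟨rfl, rfl⟩⟩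
  have invalid : ∀ π u, (¬ ∃ x, enc x = u) → ∃ t' s', Exec π p 0 (.init .inp u) t' s' 0 ∧
      t' ≤ polyBound K (u.length + b) ∧ s'.reg.2 = false := by
    intro π u hu
    obtain ⟨s₁, e₁, c₁, r₁, h₁, -⟩ := exec_load π b u
    obtain ⟨t₂, s₂, c₂, e₂, ht₂, r₂, h₂⟩ := hp₁ u _ rfl _ _ (init0 _) c₁ h₁ π _ s₁ r₁
    beta_reduce at ht₂
    have hflag : s₂.reg.2 = false := by
      rw [r₂.flag, h₂]; exact truth_eq_false.mpr hu
    refine ⟨_, s₂, Exec.seq e₁ (Exec.seq e₂ (.cond_false hflag (.act _ _ _))), ?_, hflag⟩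
    have := hpre (u.length + b)
    have := hmono (u.length + b)
    have h1 := le_polyBound 1 (u.length + b)
    omega
  have valid : ∀ π x, ∃ t' s' g m₀ G m, Exec π p 0 (.init .inp (enc x)) t' s' g ∧
      t' ≤ polyBound K ((enc x).length + b) ∧ R x (inputMem (enc x)) m₀ ∧
      (g : ℕ∞) = (m₀ 3).encard ∧ G ⊆ m₀ 3 ∧ R' x (update (update m₀ 3 ∅) 4 G) m ∧
      s'.reg.2 = truth (Acc x m) ∧
      ∀ H : ℕ → Bool, (∀ t s, π t s = H (s.stk (.left 6)).length) →
        G = {a | a ∈ m₀ 3 ∧ H a = true} := by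
    intro π x
    obtain ⟨s₁, e₁, c₁, r₁, h₁, -⟩ := exec_load π b (enc x)
    obtain ⟨t₂, s₂, c₂, e₂, ht₂, r₂, h₂⟩ := hp₁ (enc x) _ rfl _ _ (init0 _) c₁ h₁ π _ s₁ r₁
    beta_reduce at ht₂
    have hflag : s₂.reg.2 = true := by
      rw [r₂.flag, h₂]; exact truth_eq_true.mpr ⟨x, rfl⟩
    have h₂' : Holds (inputMem (enc x)) c₂ := by rw [h₂]; exact h₁
    obtain ⟨t₃, s₃, c₃, e₃, ht₃, r₃, m₀, h₃, hR₃⟩ :=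
      hp₂ x _ rfl _ _ (init0 _) c₂ h₂' π (t₂ + 1) s₂ r₂
    -- The tapes `5` and `6` of the core are the tapes `3` and `4` of the memory, since two
    -- auxiliary tapes come first.
    obtain ⟨t₄, s₄, g, G, e₄, ht₄, hg, hG, r₄, hH⟩ := exec_guessTape π (α := 5) (β := 6)
      (by norm_num) t₃ s₃ r₃ h₃.1 (by rw [h₃.2.2 4]; exact hempty x m₀ hR₃)
    rw [h₃.2.2 3] at hg hG hH
    have h₄ : Holds (update (update m₀ 3 ∅) 4 G)
        ⟨update (update c₃.mem 5 ∅) 6 G, c₃.pos, c₃.flag⟩ := by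
      refine ⟨h₃.1, by simp [h₃.2.1], fun τ => ?_⟩
      by_cases h4 : τ = 4
      · simp [h4]
      · by_cases h3 : τ = 3
        · simp [h3]
        · have : τ + 2 ≠ 6 := by omega
          have : τ + 2 ≠ 5 := by omega
          simp [*, h₃.2.2 τ]
    obtain ⟨t₅, s₅, c₅, e₅, ht₅, r₅, m, h₅, hR₅⟩ :=
      hp₃ x _ ⟨m₀, G, hR₃, hG, rfl⟩ _ _ (init0 _) _ h₄ π t₄ s₄ r₄
    obtain ⟨t₆, s₆, c₆, e₆, ht₆, r₆, h₆⟩ :=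
      hp₄ x _ ⟨m₀, G, hR₃, hG, hR₅⟩ _ _ (init0 _) _ h₅ π t₅ s₅ r₅
    have e := Exec.seq e₁ (Exec.seq e₂ (.cond_true (c := fun r : Reg => r.2)
      (q := .act []) hflag (Exec.seq e₃ (Exec.seq e₄ (Exec.seq e₅ e₆)))))
    simp only [zero_add, add_zero] at e
    refine ⟨_, s₆, g, m₀, G, m, e, ?_, hR₃, hg, hG, hR₅, ?_, hH⟩
    · beta_reduce at ht₃ ht₅ ht₆
      -- The stack of candidates is empty at the start and grows by at most `W` symbols per step.
      have l₁ := e₁.length_le (.right 5) W (by simp only [W, Prog.width]; omega)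
      have l₂ := e₂.length_le (.right 5) W (by simp only [W, Prog.width]; omega)
      have l₃ := e₃.length_le (.right 5) W (by simp only [W, Prog.width]; omega)
      have l₀ : ((St.init (.inp : Stk) (enc x)).stk (.right 5)).length = 0 := by simp [St.init]
      set N := (enc x).length + b
      have hW : W * t₂ ≤ W * (t₂ + 1) := Nat.mul_le_mul_left _ (by omega)
      have hlen : (s₃.stk (.right 5)).length ≤ W * t₃ := by omega
      have ht : t₃ ≤ polyBound a N := by
        have := hpre N
        omega
      have hc := const_mul_polyBound (7 * W) a N
      have h7 : 7 * (s₃.stk (.right 5)).length ≤ 7 * W * polyBound a N := by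
        have := Nat.mul_le_mul_left W ht
        have h : 7 * W * polyBound a N = 7 * (W * polyBound a N) := by ring
        omega
      have q1 := polyBound_add a (7 * W * a + a) N
      have q2 := polyBound_add (a + (7 * W * a + a)) 5 N
      have q3 := polyBound_add (a + (7 * W * a + a) + 5) k₃ N
      have q4 := polyBound_add (a + (7 * W * a + a) + 5 + k₃) k₄ N
      have q5 := le_polyBound 5 N
      simp only [K]
      omega
    · rw [r₆.flag, h₆]
  refine ⟨p.toNTM .inp, K * (b + 1) ^ K + K, fun u ω => ?_, fun u B hB ω => ?_, ?_, ?_⟩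
  · have hle := polyBound_add_le K b u.length
    by_cases hu : ∃ x, enc x = u
    · obtain ⟨x, rfl⟩ := hu
      obtain ⟨t', s', g, -, -, -, e, ht, -⟩ := valid (fun t _ => ω t) x
      have := (p.run_of_exec .inp _ ω e).1 _ (ht.trans hle)
      rw [NTM.Halted, this]; rfl
    · obtain ⟨t', s', e, ht, -⟩ := invalid (fun t _ => ω t) u hu
      have := (p.run_of_exec .inp _ ω e).1 _ (ht.trans hle)
      rw [NTM.Halted, this]; rfl
  · by_cases hu : ∃ x, enc x = u
    · obtain ⟨x, rfl⟩ := hu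
      obtain ⟨t', s', g, m₀, -, -, e, -, hm, hg, -⟩ := valid (fun t _ => ω t) x
      have h := (p.run_of_exec .inp _ ω e).2
      rw [hg] at h
      exact h.trans (hB x rfl m₀ hm)
    · obtain ⟨t', s', e, -⟩ := invalid (fun t _ => ω t) u hu
      exact (p.run_of_exec .inp _ ω e).2.trans (by simp)
  · rintro u ⟨ω, T, hhalt, hacc⟩
    have final : ∀ {t' s' g}, Exec (fun t _ => ω t) p 0 (.init .inp u) t' s' g →
        s'.reg.2 = true := by
      intro t' s' g e
      have h1 := (p.run_of_exec .inp _ ω e).1 (max T t') (le_max_right _ _)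
      rw [NTM.Halted.run_eq hhalt (le_max_left T t')] at h1
      rw [h1] at hacc
      exact hacc
    by_cases hu : ∃ x, enc x = u
    · obtain ⟨x, rfl⟩ := hu
      obtain ⟨t', s', g, m₀, G, m, e, -, hm, -, hG, hR', hs, -⟩ := valid (fun t _ => ω t) x
      have h := final e
      rw [hs] at h
      exact ⟨x, rfl, m₀, G, m, hm, hG, hR', truth_eq_true.mp h⟩
    · obtain ⟨t', s', e, -, hs⟩ := invalid (fun t _ => ω t) u hu
      have h := final e
      rw [hs] at h
      cases h
  · rintro x ⟨H, hH⟩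
    let S : Finset Stk := insert .inp p.stacks
    -- The bit at position `a` is guessed as the truth value of `a ∈ H`; the position is read off
    -- the left half of the guessed tape.
    let π : ℕ → Reg → (S → List Sym) → Bool := fun _ _ f =>
      if h : Stk.left 6 ∈ S then truth ((f ⟨_, h⟩).length ∈ H) else false
    have h6 : Stk.left 6 ∈ S := by
      simp [S, p, guessTape, guessBits, Prog.stacks, opsStacks, Op.stack]
    obtain ⟨t', s', g, m₀, G, m, e, -, hm, -, -, hR', hs, hG⟩ :=
      valid (fun t s => π t s.reg fun k => s.stk k) x
    obtain rfl := hG (fun a => truth (a ∈ H)) (fun t s => by simp [π, h6])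
    obtain ⟨ω, hω⟩ := p.exists_run_of_exec .inp (enc x) π e
    refine ⟨ω, t', ?_, ?_⟩
    · rw [NTM.Halted, hω]; rfl
    · rw [hω]
      change s'.reg.2 = true
      rw [hs, truth_eq_true]
      exact hH m₀ m hm (by simpa [truth_eq_true] using hR')

end StackProgram


/-! ## Maximal subteams -/

/-- Iterating a decreasing monotone operator on a finite type leads to the largest post-fixed set
below the initial set. -/
theorem iterate_eq_sUnion {α : Type} [Finite α] {F : Set α → Set α} (hF : ∀ S, F S ⊆ S)
    (hmono : Monotone F) (T : Set α) {m : ℕ} (hm : Nat.card α ≤ m) :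
    F^[m] T = ⋃₀ {S | S ⊆ T ∧ S ⊆ F S} := by
  have sub : ∀ i, F^[i] T ⊆ T := by
    intro i
    induction i with
    | zero => exact subset_rfl
    | succ i ih => rw [Function.iterate_succ_apply']; exact (hF _).trans ih
  -- As long as the iteration is not stationary, every round removes at least one element.
  have card : ∀ i, F (F^[i] T) = F^[i] T ∨ (F^[i] T).ncard + i ≤ Nat.card α := by
    intro i
    induction i with
    | zero =>
      right
      simpa using Set.ncard_le_card T
    | succ i ih =>
      by_cases h : F (F^[i + 1] T) = F^[i + 1] T
      · exact .inl h
      right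
      rw [Function.iterate_succ_apply'] at h ⊢
      rcases ih with ih | ih
      · rw [ih] at h
        exact absurd ih h
      · have hne : F (F^[i] T) ≠ F^[i] T := fun e => h (by rw [e, e])
        have := Set.ncard_lt_ncard ((hF (F^[i] T)).ssubset_of_ne hne) (Set.toFinite _)
        omega
  have fix : F (F^[m] T) = F^[m] T := by
    rcases card m with h | h
    · exact h
    · have : (F^[m] T).ncard = 0 := by omega
      rw [(Set.ncard_eq_zero (Set.toFinite _)).mp this]
      exact Set.subset_empty_iff.mp (hF ∅)
  refine Set.Subset.antisymm (Set.subset_sUnion_of_mem ⟨sub m, fix.ge⟩) (Set.sUnion_subset ?_)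
  rintro S ⟨h1, h2⟩
  have : ∀ i, S ⊆ F^[i] T := by
    intro i
    induction i with
    | zero => exact h1
    | succ i ih => rw [Function.iterate_succ_apply']; exact h2.trans (hmono ih)
  exact this m

namespace InclusionFormula

variable {L : FirstOrder.Language.{0, 0}} {A : Type} [Nonempty A] [L.Structure A]

/-- Witnesses for inclusion atoms remain in the union, splittings for disjunctions are united
componentwise, and supplementation commutes with unions. The empty family is included, so the empty
team satisfies every formula. -/
theorem Sat.sUnion (φ : InclusionFormula L) {X : Finset ℕ} (𝒯 : Set (Team X A))
    (h : ∀ T ∈ 𝒯, Sat A φ X T) : Sat A φ X (⋃₀ 𝒯) := by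
  induction φ generalizing X with
  | eq t u => rintro s ⟨T, hT, hs⟩; exact h T hT s hs
  | neq t u => rintro s ⟨T, hT, hs⟩; exact h T hT s hs
  | rel R t => rintro s ⟨T, hT, hs⟩; exact h T hT s hs
  | nrel R t => rintro s ⟨T, hT, hs⟩; exact h T hT s hs
  | incl t u =>
    rintro s ⟨T, hT, hs⟩
    obtain ⟨s', hs', h'⟩ := h T hT s hs
    exact ⟨s', ⟨T, hT, hs'⟩, h'⟩
  | and φ ψ hφ hψ =>
    exact ⟨hφ 𝒯 fun T hT => (h T hT).1, hψ 𝒯 fun T hT => (h T hT).2⟩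
  | or φ ψ hφ hψ =>
    have h' : ∀ T : 𝒯, ∃ T₀ T₁ : Team X A, T₀ ∪ T₁ = T ∧ Sat A φ X T₀ ∧ Sat A ψ X T₁ :=
      fun T => h T.1 T.2
    choose T₀ T₁ hT hT₀ hT₁ using h'
    refine ⟨⋃₀ Set.range T₀, ⋃₀ Set.range T₁, ?_, hφ _ ?_, hψ _ ?_⟩
    · rw [Set.sUnion_range, Set.sUnion_range, ← Set.iUnion_union_distrib, Set.sUnion_eq_iUnion]
      exact Set.iUnion_congr hT
    · rintro _ ⟨T, rfl⟩; exact hT₀ T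
    · rintro _ ⟨T, rfl⟩; exact hT₁ T
  | ex x φ hφ =>
    have h' : ∀ T : 𝒯, ∃ f : T.1 → Set A, (∀ s, (f s).Nonempty) ∧
      Sat A φ (insert x X) (Team.supplement T.1 x f) := fun T => h T.1 T.2
    choose f hf hf' using h'
    -- An assignment may belong to several teams; its values are those offered by any of them. Here
    -- it is used that the values in the semantics of `∃` form sets.
    refine ⟨fun s => {a | ∃ (T : 𝒯) (hs : s.1 ∈ T.1), a ∈ f T ⟨s.1, hs⟩}, ?_, ?_⟩
    · rintro ⟨s, T, hT, hs⟩
      obtain ⟨a, ha⟩ := hf ⟨T, hT⟩ ⟨s, hs⟩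
      exact ⟨a, ⟨T, hT⟩, hs, ha⟩
    · have : Team.supplement (⋃₀ 𝒯) x
          (fun s => {a | ∃ (T : 𝒯) (hs : s.1 ∈ T.1), a ∈ f T ⟨s.1, hs⟩}) =
          ⋃₀ Set.range fun T : 𝒯 => Team.supplement T.1 x (f T) := by
        ext s'
        constructor
        · rintro ⟨s, a, ⟨T, hs, ha⟩, rfl⟩
          exact ⟨_, ⟨T, rfl⟩, ⟨s.1, hs⟩, a, ha, rfl⟩
        · rintro ⟨_, ⟨T, rfl⟩, s, a, ha, rfl⟩
          exact ⟨⟨s.1, T.1, T.2, s.2⟩, a, ⟨T, s.2, ha⟩, rfl⟩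
      rw [this]
      refine hφ _ ?_
      rintro _ ⟨T, rfl⟩
      exact hf' T
  | all x φ hφ =>
    have : Team.supplement (⋃₀ 𝒯) x (fun _ => (Set.univ : Set A)) =
        ⋃₀ ((fun T : Team X A => Team.supplement T x fun _ => Set.univ) '' 𝒯) := by
      ext s'
      constructor
      · rintro ⟨⟨s, T, hT, hs⟩, a, ha, rfl⟩
        exact ⟨_, ⟨T, hT, rfl⟩, ⟨s, hs⟩, a, ha, rfl⟩
      · rintro ⟨_, ⟨T, hT, rfl⟩, s, a, ha, rfl⟩
        exact ⟨⟨s.1, T, hT, s.2⟩, a, ha, rfl⟩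
    change Sat A φ (insert x X) _
    rw [this]
    refine hφ _ ?_
    rintro _ ⟨T, hT, rfl⟩
    exact h T hT

/-- The largest subteam of `T` that satisfies `φ`. -/
def maxTeam (φ : InclusionFormula L) (X : Finset ℕ) (T : Team X A) : Team X A :=
  ⋃₀ {S | S ⊆ T ∧ Sat A φ X S}

variable {φ ψ : InclusionFormula L} {X : Finset ℕ} {S T : Team X A}

theorem maxTeam_subset : maxTeam φ X T ⊆ T := Set.sUnion_subset fun _ h => h.1

theorem sat_maxTeam : Sat A φ X (maxTeam φ X T) := Sat.sUnion φ _ fun _ h => h.2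

theorem subset_maxTeam (h : S ⊆ T) (hS : Sat A φ X S) : S ⊆ maxTeam φ X T :=
  Set.subset_sUnion_of_mem ⟨h, hS⟩

theorem maxTeam_mono : Monotone (maxTeam φ X : Team X A → Team X A) :=
  fun _ _ h => subset_maxTeam (maxTeam_subset.trans h) sat_maxTeam

/-- This reduces checking a formula to computing a largest subteam and testing one inclusion. -/
theorem sat_iff : Sat A φ X T ↔ T ⊆ maxTeam φ X T :=
  ⟨subset_maxTeam subset_rfl, fun h => by
    rw [h.antisymm maxTeam_subset]; exact sat_maxTeam⟩

theorem maxTeam_eq_iterate [Finite A] {F : Team X A → Team X A} (hF : ∀ S, F S ⊆ S)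
    (hmono : Monotone F) (hsat : ∀ S, Sat A φ X S ↔ S ⊆ F S) {m : ℕ}
    (hm : Nat.card (X → A) ≤ m) : maxTeam φ X T = F^[m] T := by
  rw [iterate_eq_sUnion hF hmono T hm, maxTeam]
  simp only [hsat]

theorem maxTeam_eq_filter {p : (X → A) → Prop} (h : ∀ S, Sat A φ X S ↔ ∀ s ∈ S, p s) :
    maxTeam φ X T = {s | s ∈ T ∧ p s} :=
  Set.Subset.antisymm (fun s hs => ⟨maxTeam_subset hs, (h _).mp sat_maxTeam s hs⟩)
    (subset_maxTeam (fun _ h => h.1) ((h _).mpr fun _ h => h.2))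

/-- Both parts of a split subteam lie in `T`, hence below the respective largest subteams of `T`; no
iteration is needed. -/
theorem maxTeam_or : maxTeam (.or φ ψ) X T = maxTeam φ X T ∪ maxTeam ψ X T := by
  refine Set.Subset.antisymm ?_ (subset_maxTeam
    (Set.union_subset maxTeam_subset maxTeam_subset) ⟨_, _, rfl, sat_maxTeam, sat_maxTeam⟩)
  refine Set.sUnion_subset ?_
  rintro S ⟨hS, T₀, T₁, rfl, h0, h1⟩
  exact Set.union_subset_union
    (subset_maxTeam (Set.subset_union_left.trans hS) h0)
    (subset_maxTeam (Set.subset_union_right.trans hS) h1)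

/-- No iteration is needed: every member of the largest `φ`-subteam of the full supplement comes
from an assignment that is retained, so dropping the other assignments does not disturb that
subteam. -/
theorem maxTeam_ex {x : ℕ} : maxTeam (.ex x φ) X T = {s | s ∈ T ∧ ∃ a,
    Team.update s x a ∈ maxTeam φ (insert x X) (T.supplement x fun _ => Set.univ)} := by
  refine Set.Subset.antisymm ?_ (subset_maxTeam (fun _ h => h.1) ?_)
  · refine Set.sUnion_subset ?_
    rintro S ⟨hS, f, hf, h⟩ s hs
    refine ⟨hS hs, ?_⟩
    obtain ⟨a, ha⟩ := hf ⟨s, hs⟩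
    refine ⟨a, subset_maxTeam ?_ h ⟨⟨s, hs⟩, a, ha, rfl⟩⟩
    rintro _ ⟨s, a, -, rfl⟩
    exact ⟨⟨s.1, hS s.2⟩, a, trivial, rfl⟩
  -- All surviving values are chosen, which makes the supplemented team equal to the largest
  -- subteam.
  · refine ⟨fun s => {a | Team.update s.1 x a ∈ maxTeam φ (insert x X)
      (T.supplement x fun _ => Set.univ)}, fun s => s.2.2, ?_⟩
    convert! sat_maxTeam (φ := φ) (T := T.supplement x fun _ => Set.univ) using 1
    ext s'
    constructor
    · rintro ⟨s, a, ha, rfl⟩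
      exact ha
    · intro h
      obtain ⟨s, a, -, rfl⟩ := maxTeam_subset h
      exact ⟨⟨s.1, s.2, a, h⟩, a, h, rfl⟩

omit [Nonempty A] in
theorem supplement_mono {x : ℕ} (h : S ⊆ T) : Team.supplement S x (fun _ => (Set.univ : Set A)) ⊆
    Team.supplement T x fun _ => Set.univ := by
  rintro _ ⟨s, a, -, rfl⟩
  exact ⟨⟨s.1, h s.2⟩, a, trivial, rfl⟩

/-- Dropping an assignment removes its extensions from the supplement, and other extensions may have
depended on these. The deletion must therefore be repeated. -/
theorem maxTeam_all [Finite A] {x m : ℕ} (hm : Nat.card (X → A) ≤ m) :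
    maxTeam (.all x φ) X T = (fun S : Team X A => {s | s ∈ S ∧ ∀ a, Team.update s x a ∈
      maxTeam φ (insert x X) (S.supplement x fun _ => Set.univ)})^[m] T := by
  refine maxTeam_eq_iterate (fun S s h => h.1) ?_ (fun S => ?_) hm
  · intro S S' h s hs
    exact ⟨h hs.1, fun a => maxTeam_mono (supplement_mono h) (hs.2 a)⟩
  · change Sat A φ _ _ ↔ _
    rw [sat_iff]
    constructor
    · intro h s hs
      exact ⟨hs, fun a => h ⟨⟨s, hs⟩, a, trivial, rfl⟩⟩
    · rintro h _ ⟨s, a, -, rfl⟩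
      exact (h s.2).2 a

/-- Passing to the largest `ψ`-subteam may destroy `φ`, as inclusion atoms are not preserved by
subteams; the two operators alternate until nothing changes. -/
theorem maxTeam_and [Finite A] {m : ℕ} (hm : Nat.card (X → A) ≤ m) :
    maxTeam (.and φ ψ) X T = (fun S => maxTeam ψ X (maxTeam φ X S))^[m] T := by
  refine maxTeam_eq_iterate (fun S => maxTeam_subset.trans maxTeam_subset)
    (fun S S' h => maxTeam_mono (maxTeam_mono h)) (fun S => ?_) hm
  change Sat A φ X S ∧ Sat A ψ X S ↔ _
  constructor
  · rintro ⟨h1, h2⟩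
    exact subset_maxTeam (sat_iff.mp h1) h2
  · intro h
    have h1 : maxTeam φ X S = S := maxTeam_subset.antisymm (h.trans maxTeam_subset)
    rw [h1] at h
    exact ⟨sat_iff.mpr h1.ge, sat_iff.mpr h⟩

theorem maxTeam_incl [Finite A] {r m : ℕ} {t u : Fin r → L.Term ℕ} (hm : Nat.card (X → A) ≤ m) :
    maxTeam (.incl t u) X T = (fun S : Team X A => {s | s ∈ S ∧ ∃ s' ∈ S,
      ∀ i, Team.value s (t i) = Team.value s' (u i)})^[m] T := by
  refine maxTeam_eq_iterate (fun S s h => h.1) ?_ (fun S => ?_) hm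
  · rintro S S' h s ⟨hs, s', hs', h'⟩
    exact ⟨h hs, s', h hs', h'⟩
  · exact ⟨fun h s hs => ⟨hs, h s hs⟩, fun h s hs => (h hs).2⟩

end InclusionFormula


/-! ## The encoding of structures -/

section FlatMap

variable {ι β : Type} [DecidableEq ι]

/-- The total length of the blocks before the block of `y`. -/
def List.offset (l : List ι) (len : ι → ℕ) (y : ι) : ℕ := ((l.take (l.idxOf y)).map len).sum

theorem List.offset_cons (z : ι) (l : List ι) (len : ι → ℕ) (y : ι) :
    (z :: l).offset len y = if z = y then 0 else len z + l.offset len y := by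
  by_cases h : z = y
  · subst h; simp [offset]
  · rw [offset, List.idxOf_cons_ne _ h]
    simp [h, offset]

theorem List.getElem?_flatMap_offset (l : List ι) {len : ι → ℕ} {T : ι → List β}
    (hT : ∀ y, (T y).length = len y) {y : ι} (hy : y ∈ l) {j : ℕ} (hj : j < len y) :
    (l.flatMap T)[l.offset len y + j]? = (T y)[j]? := by
  induction l with
  | nil => cases hy
  | cons z l ih =>
    rw [offset_cons, List.flatMap_cons]
    by_cases h : z = y
    · subst h
      rw [if_pos rfl, Nat.zero_add, List.getElem?_append_left (by rw [hT]; exact hj)]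
    · rw [if_neg h, List.getElem?_append_right (by rw [hT]; omega), hT,
        show len z + l.offset len y + j - len z = l.offset len y + j by omega]
      exact ih ((List.mem_cons.mp hy).resolve_left fun e => h e.symm)

/-- Repetitions are excluded because `offset` always refers to the first occurrence. -/
theorem List.exists_offset {l : List ι} (hl : l.Nodup) (len : ι → ℕ) {i : ℕ}
    (hi : i < (l.map len).sum) : ∃ y ∈ l, ∃ j < len y, i = l.offset len y + j := by
  induction l generalizing i with
  | nil => simp at hi
  | cons z l ih =>
    rw [List.nodup_cons] at hl
    rw [List.map_cons, List.sum_cons] at hi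
    rcases lt_or_ge i (len z) with h | h
    · exact ⟨z, List.mem_cons_self, i, h, by simp [offset_cons]⟩
    · obtain ⟨y, hy, j, hj, e⟩ := ih hl.2 (i := i - len z) (by omega)
      have hne : z ≠ y := by rintro rfl; exact hl.1 hy
      refine ⟨y, List.mem_cons_of_mem _ hy, j, hj, ?_⟩
      rw [offset_cons, if_neg hne]
      omega

end FlatMap

namespace FirstOrder.Language

variable (L : FirstOrder.Language.{0, 0})

/-- The symbols of a vocabulary. -/
abbrev Symbol := (Σ r, L.Relations r) ⊕ (Σ r, L.Functions r)

variable {L}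

/-- The arity of the relation or of the graph that interprets a symbol. -/
def Symbol.arity : L.Symbol → ℕ
  | .inl R => R.1
  | .inr f => f.1 + 1

/-- The relation or the graph that interprets a symbol. -/
def Symbol.Holds {A : Type} [L.Structure A] : (y : L.Symbol) → (Fin y.arity → A) → Prop
  | .inl R, a => Structure.RelMap R.2 a
  | .inr f, a => Structure.funMap f.2 (fun i => a i.castSucc) = a (Fin.last f.1)

variable [FinEnum (Σ r, L.Functions r)] [FinEnum (Σ r, L.Relations r)]

variable (L) in
/-- The symbols in the order in which their tables are written. -/
def symbols : List L.Symbol :=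
  (FinEnum.toList (Σ r, L.Relations r)).map .inl ++ (FinEnum.toList (Σ r, L.Functions r)).map .inr

theorem mem_symbols (y : L.Symbol) : y ∈ L.symbols := by
  rcases y with R | f <;> simp [symbols]

theorem nodup_symbols : L.symbols.Nodup := by
  refine List.Nodup.append ((FinEnum.nodup_toList).map Sum.inl_injective)
    ((FinEnum.nodup_toList).map Sum.inr_injective) ?_
  intro y h h'
  obtain ⟨R, -, rfl⟩ := List.mem_map.mp h
  obtain ⟨f, -, h⟩ := List.mem_map.mp h'
  cases h

/-- The position of a tuple in the encoding of a structure with `n` elements. -/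
def tableAddress (n : ℕ) (y : L.Symbol) (a : Fin y.arity → ℕ) : ℕ :=
  n + 1 + L.symbols.offset (fun z => n ^ z.arity) y + ∑ i : Fin y.arity, n ^ (i : ℕ) * a i

/-- Functions are represented by their graphs, so relations and functions can be treated uniformly
as symbols with a table. -/
theorem encodeStructure_eq (n : ℕ) [L.Structure (Fin n)] : encodeStructure L n =
    List.replicate n true ++ [false] ++
      L.symbols.flatMap fun y => relationTable (Symbol.Holds (A := Fin n) y) := by
  rw [encodeStructure, symbols, List.flatMap_append, List.flatMap_map, List.flatMap_map,
    List.append_assoc _ (List.flatMap _ _)]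
  rfl

omit [FinEnum (Σ r, L.Functions r)] [FinEnum (Σ r, L.Relations r)] in
theorem length_relationTable {n r : ℕ} (R : (Fin r → Fin n) → Prop) :
    (relationTable R).length = n ^ r := by simp [relationTable]

omit [FinEnum (Σ r, L.Functions r)] [FinEnum (Σ r, L.Relations r)] in
theorem coe_finFunctionFinEquiv {n r : ℕ} (a : Fin r → Fin n) :
    (finFunctionFinEquiv a : ℕ) = ∑ i : Fin r, n ^ (i : ℕ) * (a i : ℕ) := by
  rw [finFunctionFinEquiv_apply]
  exact Finset.sum_congr rfl fun _ _ => mul_comm _ _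

omit [FinEnum (Σ r, L.Functions r)] [FinEnum (Σ r, L.Relations r)] in
theorem getElem?_relationTable {n r : ℕ} (R : (Fin r → Fin n) → Prop) (a : Fin r → Fin n) :
    (relationTable R)[∑ i : Fin r, n ^ (i : ℕ) * (a i : ℕ)]? =
      some (StackProgram.truth (R a)) := by
  rw [← coe_finFunctionFinEquiv, relationTable, List.getElem?_ofFn,
    dif_pos (finFunctionFinEquiv a).2]
  simp [StackProgram.truth]

theorem length_encodeStructure (n : ℕ) [L.Structure (Fin n)] : (encodeStructure L n).length =
    n + 1 + (L.symbols.map fun y => n ^ y.arity).sum := by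
  rw [encodeStructure_eq]
  simp [List.length_flatMap, length_relationTable]
  ring

theorem getElem?_encodeStructure_lt {n : ℕ} [L.Structure (Fin n)] {i : ℕ} (hi : i < n) :
    (encodeStructure L n)[i]? = some true := by
  rw [encodeStructure_eq, List.append_assoc, List.getElem?_append_left (by simpa using hi)]
  simp [hi]

theorem getElem?_encodeStructure_self (n : ℕ) [L.Structure (Fin n)] :
    (encodeStructure L n)[n]? = some false := by
  rw [encodeStructure_eq, List.append_assoc, List.getElem?_append_right (by simp)]
  simp

theorem getElem?_encodeStructure {n : ℕ} [L.Structure (Fin n)] (y : L.Symbol)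
    (a : Fin y.arity → Fin n) : (encodeStructure L n)[tableAddress n y fun i => a i]? =
      some (StackProgram.truth (y.Holds a)) := by
  rw [encodeStructure_eq, List.getElem?_append_right (by simp [tableAddress]; omega),
    show tableAddress n y (fun i => a i) - (List.replicate n true ++ [false]).length =
      L.symbols.offset (fun z => n ^ z.arity) y +
        ∑ i : Fin y.arity, n ^ (i : ℕ) * (a i : ℕ) by
        simp only [tableAddress, List.length_append, List.length_replicate, List.length_cons,
          List.length_nil]; omega,
    List.getElem?_flatMap_offset _ (fun _ => length_relationTable _) (mem_symbols y)
      (by rw [← coe_finFunctionFinEquiv]; exact (finFunctionFinEquiv a).2), getElem?_relationTable]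

/-- A word is the encoding of a structure if its symbols are right. -/
theorem eq_encodeStructure {n : ℕ} [L.Structure (Fin n)] {w : List Bool}
    (hlen : w.length = n + 1 + (L.symbols.map fun y => n ^ y.arity).sum)
    (hlt : ∀ i < n, w[i]? = some true) (hn : w[n]? = some false)
    (h : ∀ (y : L.Symbol) (a : Fin y.arity → Fin n),
      w[tableAddress n y fun i => a i]? = some (StackProgram.truth (y.Holds a))) :
    w = encodeStructure L n := by
  refine List.ext_getElem? fun i => ?_
  rcases lt_trichotomy i n with hi | rfl | hi
  · rw [hlt i hi, getElem?_encodeStructure_lt hi]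
  · rw [hn, getElem?_encodeStructure_self]
  · rcases lt_or_ge i w.length with hi' | hi'
    -- A position behind the prefix `1ⁿ0` lies in the table of a unique symbol, and its place `j` in
    -- the table is decoded into a tuple.
    · obtain ⟨y, -, j, hj, e⟩ := List.exists_offset nodup_symbols (fun y : L.Symbol => n ^ y.arity)
        (i := i - (n + 1)) (by omega)
      have : i = tableAddress n y fun i =>
          (finFunctionFinEquiv.symm (⟨j, hj⟩ : Fin (n ^ y.arity)) i : ℕ) := by
        have h := coe_finFunctionFinEquiv (finFunctionFinEquiv.symm (⟨j, hj⟩ : Fin (n ^ y.arity)))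
        have h' : ((finFunctionFinEquiv (finFunctionFinEquiv.symm
            (⟨j, hj⟩ : Fin (n ^ y.arity)))) : ℕ) = j :=
          congrArg Fin.val (finFunctionFinEquiv.apply_symm_apply _)
        rw [h'] at h
        rw [tableAddress, ← h]
        omega
      rw [this, h, getElem?_encodeStructure]
    · rw [List.getElem?_eq_none hi', List.getElem?_eq_none]
      rwa [length_encodeStructure, ← hlen]

end FirstOrder.Language

/-! ## Instances of the weighted team problem -/

/-- A structure on `{0, …, n - 1}` with a parameter `k`. -/
structure WTInstance (L : FirstOrder.Language.{0, 0}) where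
  n : ℕ
  neZero : NeZero n
  str : L.Structure (Fin n)
  k : ℕ

namespace WTInstance

variable {L : FirstOrder.Language.{0, 0}}

instance (x : WTInstance L) : NeZero x.n := x.neZero

instance (x : WTInstance L) : L.Structure (Fin x.n) := x.str

variable [FinEnum (Σ r, L.Functions r)] [FinEnum (Σ r, L.Relations r)]

/-- The word that encodes an instance. -/
noncomputable def enc (x : WTInstance L) : List StackProgram.Sym :=
  encodeInstance (encodeStructure L x.n, x.k)

end WTInstance


/-! ### First-order definability over the structure of an instance -/

namespace StackProgram

open Function FirstOrder.Language

variable {L : FirstOrder.Language.{0, 0}} [FinEnum (Σ r, L.Functions r)]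
  [FinEnum (Σ r, L.Relations r)]

/-- The number of elements of the structure is the value of a variable `ν`, as it differs from the
size of the machine's domain. -/
theorem Repeatable.tableAddress {C : Type} {size : C → ℕ} {V : Type} (ν : V) (y : L.Symbol)
    (φ : Fin y.arity → V) : Repeatable size
      (fun _ (e : V → ℕ) => tableAddress (e ν) y fun i => e (φ i)) := by
  have pow : ∀ r, Repeatable size (fun _ (e : V → ℕ) => e ν ^ r) := fun r => by
    simpa using Repeatable.var_pow_mul ν (Repeatable.one (size := size)) r
  exact (((Repeatable.var ν).add .one).add (Repeatable.listSum _ fun z : L.Symbol => pow z.arity)).add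
    (Repeatable.sum _ fun i _ => Repeatable.var_pow_mul ν (Repeatable.var (φ i)) i)

/-- The domain in which the machine works has `b` elements more than the input has symbols. -/
noncomputable def size (b : ℕ) (x : WTInstance L) : ℕ := x.enc.length + b

theorem n_lt_size (b : ℕ) (x : WTInstance L) : x.n < size b x := by
  simp only [size, WTInstance.enc, encodeInstance, List.length_append, List.length_map,
    length_encodeStructure]
  omega

/-- The tapes `0`, `1`, `2` hold the input. -/
def HasInput (x : WTInstance L) (m : Mem) : Prop := ∀ τ < 3, m τ = inputMem x.enc τ

theorem getElem?_enc_of_lt {x : WTInstance L} {i : ℕ} (hi : i < (encodeStructure L x.n).length) :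
    x.enc[i]? = (encodeStructure L x.n)[i]?.map some := by
  rw [WTInstance.enc, encodeInstance, List.getElem?_append_left (by simpa using hi)]
  simp

theorem getElem?_enc {x : WTInstance L} {i : ℕ} {b : Bool}
    (h : (encodeStructure L x.n)[i]? = some b) : x.enc[i]? = some (some b) := by
  rw [getElem?_enc_of_lt (List.getElem?_eq_some_iff.mp h).1, h]; rfl

section Input

variable {x : WTInstance L} {m : Mem} (h : HasInput x m)
include h

theorem HasInput.mem_zero {i : ℕ} (hi : i < x.n) : i ∈ m 0 := by
  rw [h 0 (by norm_num)]
  exact getElem?_enc (getElem?_encodeStructure_lt hi)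

theorem HasInput.n_notMem_zero : x.n ∉ m 0 := by
  rw [h 0 (by norm_num)]
  simp [inputMem, getElem?_enc (getElem?_encodeStructure_self x.n)]

theorem HasInput.n_mem_one : x.n ∈ m 1 := by
  rw [h 1 (by norm_num)]
  simp [inputMem, getElem?_enc (getElem?_encodeStructure_self x.n)]

theorem HasInput.notMem_one {i : ℕ} (hi : i < x.n) : i ∉ m 1 := by
  rw [h 1 (by norm_num)]
  simp [inputMem, getElem?_enc (getElem?_encodeStructure_lt hi)]

theorem HasInput.table (y : L.Symbol) (a : Fin y.arity → Fin x.n) :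
    tableAddress x.n y (fun i => a i) ∈ m 0 ↔ y.Holds a := by
  rw [h 0 (by norm_num)]
  simp [inputMem, getElem?_enc (getElem?_encodeStructure y a), truth_eq_true]

end Input

variable {b : ℕ} {V W : Type}

/-- The number of elements of the structure may be used in definitions. -/
theorem Definable.withDomain {P : WTInstance L → Mem → (Option V → ℕ) → Prop}
    (h : Definable (size b) HasInput P) :
    Definable (size b) HasInput (fun x m (e : V → ℕ) => P x m fun v => v.elim x.n e) := by
  have h1 : Definable (size b) HasInput (fun (_ : WTInstance L) m (e : Option V → ℕ) =>
      e none ∈ m 1) := Definable.read 1 (Repeatable.var none)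
  have h0 : Definable (size b) HasInput (fun (_ : WTInstance L) m (e : Option (Option V) → ℕ) =>
      e none < e (some none) → e none ∈ m 0) :=
    (Definable.lt none (some none)).imp (Definable.read 0 (Repeatable.var none))
  refine ((h1.and h0.forall).and h).exists.congr fun x m e hm _ => ?_
  simp only [Option.elim]
  constructor
  · rintro ⟨a, ha, ⟨g1, g2⟩, g3⟩
    -- The first `0` of the input stands at position `n`: it is the only position with symbol
    -- `false` that is preceded by `true` alone.
    obtain rfl : a = x.n := by
      rcases lt_trichotomy a x.n with hlt | heq | hgt
      · exact absurd g1 (hm.notMem_one hlt)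
      · exact heq
      · exact absurd (g2 _ (n_lt_size b x) hgt) hm.n_notMem_zero
    exact g3
  · intro g
    exact ⟨x.n, n_lt_size b x, ⟨hm.n_mem_one, fun i _ hi => hm.mem_zero hi⟩, g⟩

/-- First-order definable relations over the domain of the structure. -/
def FODef (b : ℕ) (P : ∀ x : WTInstance L, Mem → (V → Fin x.n) → Prop) : Prop :=
  Definable (size b) HasInput fun x m e => ∃ s : V → Fin x.n, (∀ v, e v = s v) ∧ P x m s

theorem coe_inj_fun {n : ℕ} {e : V → ℕ} {s s' : V → Fin n} (h : ∀ v, e v = s v)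
    (h' : ∀ v, e v = s' v) : s = s' :=
  funext fun v => Fin.ext ((h v).symm.trans (h' v))

section FODef

variable {P Q : ∀ x : WTInstance L, Mem → (V → Fin x.n) → Prop}

theorem FODef.congr (h : FODef b P) (hPQ : ∀ x m s, HasInput x m → (P x m s ↔ Q x m s)) :
    FODef b Q :=
  Definable.congr h fun x m e hm _ => by
    constructor
    · rintro ⟨s, hs, hP⟩; exact ⟨s, hs, (hPQ x m s hm).mp hP⟩
    · rintro ⟨s, hs, hP⟩; exact ⟨s, hs, (hPQ x m s hm).mpr hP⟩

theorem inDomain [Finite V] : Definable (size b) HasInput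
    (fun (x : WTInstance L) _ (e : V → ℕ) => ∀ v, e v < x.n) :=
  Definable.finite_forall fun v => (Definable.lt (some v) none).withDomain

/-- A predicate that is definable for natural numbers. -/
theorem FODef.of_definable [Finite V] {R : WTInstance L → Mem → (V → ℕ) → Prop}
    (h : Definable (size b) HasInput R) :
    FODef b fun x m (s : V → Fin x.n) => R x m fun v => s v :=
  (h.and inDomain).congr fun x m e hm _ => by
    constructor
    · rintro ⟨h1, h2⟩
      exact ⟨fun v => ⟨e v, h2 v⟩, fun _ => rfl, h1⟩
    · rintro ⟨s, hs, hR⟩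
      obtain rfl : e = fun v => (s v : ℕ) := funext hs
      exact ⟨hR, fun v => (s v).2⟩

theorem FODef.and (h : FODef b P) (h' : FODef b Q) :
    FODef b fun x m s => P x m s ∧ Q x m s :=
  Definable.congr (Definable.and h h') fun x m e hm _ => by
    constructor
    · rintro ⟨⟨s, hs, hP⟩, s', hs', hQ⟩
      obtain rfl := coe_inj_fun hs hs'
      exact ⟨s, hs, hP, hQ⟩
    · rintro ⟨s, hs, hP, hQ⟩
      exact ⟨⟨s, hs, hP⟩, s, hs, hQ⟩

theorem FODef.or (h : FODef b P) (h' : FODef b Q) :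
    FODef b fun x m s => P x m s ∨ Q x m s :=
  Definable.congr (Definable.or h h') fun x m e hm _ => by
    constructor
    · rintro (⟨s, hs, hP⟩ | ⟨s, hs, hQ⟩)
      · exact ⟨s, hs, .inl hP⟩
      · exact ⟨s, hs, .inr hQ⟩
    · rintro ⟨s, hs, hP | hQ⟩
      · exact .inl ⟨s, hs, hP⟩
      · exact .inr ⟨s, hs, hQ⟩

/-- Tuples with an entry outside the structure violate `P` in the numerical sense and have to be
excluded by `inDomain`. -/
theorem FODef.not [Finite V] (h : FODef b P) : FODef b fun x m s => ¬ P x m s :=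
  Definable.congr (Definable.and (Definable.not h) inDomain) fun x m e hm _ => by
    constructor
    · rintro ⟨h1, h2⟩
      exact ⟨fun v => ⟨e v, h2 v⟩, fun _ => rfl, fun hP => h1 ⟨_, fun _ => rfl, hP⟩⟩
    · rintro ⟨s, hs, hP⟩
      refine ⟨?_, fun v => by rw [hs]; exact (s v).2⟩
      rintro ⟨s', hs', hP'⟩
      obtain rfl := coe_inj_fun hs hs'
      exact hP hP'

theorem FODef.exists_fun {ι : Type} [Finite ι]
    {P : ∀ x : WTInstance L, Mem → (V ⊕ ι → Fin x.n) → Prop} (h : FODef b P) :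
    FODef b fun x m (s : V → Fin x.n) => ∃ a : ι → Fin x.n, P x m (Sum.elim s a) :=
  Definable.congr (Definable.exists_fun h) fun x m e hm _ => by
    constructor
    · rintro ⟨a, ha, s, hs, hP⟩
      refine ⟨fun v => s (.inl v), fun v => hs (.inl v), fun i => s (.inr i), ?_⟩
      convert! hP using 1
      funext v
      cases v <;> rfl
    · rintro ⟨s, hs, a, hP⟩
      refine ⟨fun i => a i, fun i => (a i).2.trans (n_lt_size b x), _, ?_, hP⟩
      rintro (v | i)
      · exact hs v
      · rfl

theorem FODef.forall_fun [Finite V] {ι : Type} [Finite ι]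
    {P : ∀ x : WTInstance L, Mem → (V ⊕ ι → Fin x.n) → Prop} (h : FODef b P) :
    FODef b fun x m (s : V → Fin x.n) => ∀ a : ι → Fin x.n, P x m (Sum.elim s a) :=
  h.not.exists_fun.not.congr fun _ _ _ _ => by push Not; rfl

theorem FODef.finite_forall [Finite V] {ι : Type} [Finite ι]
    {P : ι → ∀ x : WTInstance L, Mem → (V → Fin x.n) → Prop} (h : ∀ i, FODef b (P i)) :
    FODef b fun x m s => ∀ i, P i x m s :=
  ((Definable.finite_forall h).and inDomain).congr fun x m e hm _ => by
    constructor
    · rintro ⟨h1, h2⟩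
      refine ⟨fun v => ⟨e v, h2 v⟩, fun _ => rfl, fun i => ?_⟩
      obtain ⟨s, hs, hP⟩ := h1 i
      convert! hP using 1
      exact coe_inj_fun (e := e) (fun _ => rfl) hs
    · rintro ⟨s, hs, hP⟩
      exact ⟨fun i => ⟨s, hs, hP i⟩, fun v => by rw [hs]; exact (s v).2⟩

theorem FODef.trivial [Finite V] :
    FODef (L := L) b fun x _ (_ : V → Fin x.n) => True :=
  FODef.of_definable Definable.trivial

theorem FODef.eq [Finite V] (u v : V) :
    FODef (L := L) b fun x _ (s : V → Fin x.n) => s u = s v :=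
  (FODef.of_definable (Definable.eq (Repeatable.var u) (Repeatable.var v))).congr
    fun _ _ _ _ => Fin.ext_iff.symm

theorem FODef.holds [Finite V] (y : L.Symbol) (φ : Fin y.arity → V) :
    FODef (L := L) b fun x _ (s : V → Fin x.n) => y.Holds fun i => s (φ i) := by
  have h : Definable (size b) HasInput (fun (_ : WTInstance L) m (e : Option V → ℕ) =>
      tableAddress (e none) y (fun i => e (some (φ i))) ∈ m 0) :=
    Definable.read 0 (Repeatable.tableAddress none y fun i => some (φ i))
  exact (FODef.of_definable h.withDomain).congr fun x m s hm => hm.table y _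

/-- The graph of a term. -/
theorem FODef.value [Finite V] {X : Finset ℕ} (φ : X → V) (t : L.Term ℕ) (ht : t.varFinset ⊆ X)
    (v : V) : FODef (L := L) b fun x _ (s : V → Fin x.n) => Team.value (fun i => s (φ i)) t = s v := by
  induction t generalizing V with
  | var i =>
    have hi : i ∈ X := ht (by simp [FirstOrder.Language.Term.varFinset])
    exact (FODef.eq (φ ⟨i, hi⟩) v).congr fun x m s _ => by
      simp [Team.value, hi]
  | @func r f ts ih =>
    have hts : ∀ i, (ts i).varFinset ⊆ X := fun i =>
      (Finset.subset_biUnion_of_mem (fun i => (ts i).varFinset) (Finset.mem_univ i)).trans ht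
    have h1 : ∀ i, FODef (L := L) b fun x _ (s : V ⊕ Fin r → Fin x.n) =>
        Team.value (fun j => s (.inl (φ j))) (ts i) = s (.inr i) :=
      fun i => ih i (V := V ⊕ Fin r) (fun j => .inl (φ j)) (hts i) (.inr i)
    -- The values of the arguments are quantified, and the table of the graph of `f` is consulted.
    -- This is why the induction hypothesis is needed for larger types of variables.
    have h2 := FODef.holds (b := b) (V := V ⊕ Fin r) (.inr ⟨r, f⟩ : L.Symbol)
      (Fin.snoc (α := fun _ => V ⊕ Fin r) (fun i : Fin r => .inr i) (.inl v))
    refine ((FODef.finite_forall h1).and h2).exists_fun.congr fun x m s _ => ?_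
    simp only [Symbol.Holds, Sum.elim_inl, Sum.elim_inr, Fin.snoc_castSucc, Fin.snoc_last]
    constructor
    · rintro ⟨a, h, h'⟩
      rw [← h', ← funext h]
      rfl
    · intro h
      exact ⟨_, fun i => rfl, h⟩

theorem FODef.value_eq [Finite V] {X : Finset ℕ} (φ φ' : X → V) {t u : L.Term ℕ}
    (ht : t.varFinset ⊆ X) (hu : u.varFinset ⊆ X) : FODef (L := L) b fun x _ (s : V → Fin x.n) =>
      Team.value (fun i => s (φ i)) t = Team.value (fun i => s (φ' i)) u := by
  have h1 := FODef.value (L := L) (b := b) (V := V ⊕ Unit) (fun i : X => .inl (φ i)) t ht (.inr ())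
  have h2 := FODef.value (L := L) (b := b) (V := V ⊕ Unit) (fun i : X => .inl (φ' i)) u hu (.inr ())
  refine (h1.and h2).exists_fun.congr fun x m s _ => ?_
  simp only [Sum.elim_inl, Sum.elim_inr]
  constructor
  · rintro ⟨a, h, h'⟩; rw [h, h']
  · intro h; exact ⟨fun _ => _, rfl, h.symm⟩

theorem FODef.rel [Finite V] {X : Finset ℕ} (φ : X → V) {r : ℕ} (R : L.Relations r)
    {t : Fin r → L.Term ℕ} (ht : ∀ i, (t i).varFinset ⊆ X) : FODef (L := L) b fun x _ (s : V → Fin x.n) =>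
      FirstOrder.Language.Structure.RelMap R fun i => Team.value (fun j => s (φ j)) (t i) := by
  have h1 : ∀ i, FODef (L := L) b fun x _ (s : V ⊕ Fin r → Fin x.n) =>
      Team.value (fun j => s (.inl (φ j))) (t i) = s (.inr i) :=
    fun i => FODef.value (L := L) (V := V ⊕ Fin r) (fun j : X => .inl (φ j)) (t i) (ht i) (.inr i)
  have h2 := FODef.holds (b := b) (V := V ⊕ Fin r) (.inl ⟨r, R⟩ : L.Symbol) (fun i => .inr i)
  refine ((FODef.finite_forall h1).and h2).exists_fun.congr fun x m s _ => ?_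
  simp only [Symbol.Holds, Sum.elim_inl, Sum.elim_inr]
  constructor
  · rintro ⟨a, h, h'⟩
    rwa [funext h]
  · intro h
    exact ⟨_, fun i => rfl, h⟩

end FODef

/-! ### Teams -/

/-- The team stored in the tape `τ`. -/
def team (b : ℕ) (X : Finset ℕ) (x : WTInstance L) (m : Mem) (τ : ℕ) : Team X (Fin x.n) :=
  {s | address (size b x) (fun v => (s v : ℕ)) ∈ m τ}

theorem FODef.mem_team [Finite V] (X : Finset ℕ) (τ : ℕ) (φ : X → V) :
    FODef (L := L) b fun x m (s : V → Fin x.n) => (fun i => s (φ i)) ∈ team b X x m τ :=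
  FODef.of_definable (Definable.read τ (Repeatable.address φ))

/-- Assigning a definable team to a tape. -/
theorem Computes.assignTeam {X : Finset ℕ} {P : ∀ x : WTInstance L, Mem → (X → Fin x.n) → Prop}
    (h : FODef b P) (τ : ℕ) : Computes (size b) HasInput (fun x m m' =>
      (∀ σ, σ ≠ τ → m' σ = m σ) ∧ team b X x m' τ = {s | P x m s}) := by
  refine (Computes.assign h τ).mono fun x m m' _ hm => ⟨hm.1, ?_⟩
  ext s
  rw [team, Set.mem_ofPred_eq, hm.2.1 _ fun v => (s v).2.trans (n_lt_size b x)]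
  constructor
  · rintro ⟨s', hs', hP⟩
    obtain rfl := coe_inj_fun (e := fun v => (s v : ℕ)) (fun _ => rfl) hs'
    exact hP
  · intro hP
    exact ⟨s, fun _ => rfl, hP⟩

end StackProgram


/-! ### Computing largest subteams -/

namespace StackProgram

open Function FirstOrder.Language InclusionFormula

variable {L : FirstOrder.Language.{0, 0}} [FinEnum (Σ r, L.Functions r)]
  [FinEnum (Σ r, L.Relations r)] {b : ℕ}

/-- The team in the tape `τ` is replaced by its image under `F`. Tapes below `τ` are preserved. -/
def ComputesTeam (b τ : ℕ) (X : Finset ℕ)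
    (F : ∀ x : WTInstance L, Team X (Fin x.n) → Team X (Fin x.n)) : Prop :=
  Computes (size b) HasInput fun x m m' =>
    (∀ σ < τ, m' σ = m σ) ∧ team b X x m' τ = F x (team b X x m τ)

theorem HasInput.of_eq {x : WTInstance L} {m m' : Mem} {τ : ℕ} (hτ : 3 ≤ τ) (h : HasInput x m)
    (hm : ∀ σ < τ, m' σ = m σ) : HasInput x m' :=
  fun σ hσ => (hm σ (by omega)).trans (h σ hσ)

section ComputesTeam

variable {τ : ℕ} {X : Finset ℕ} {F G : ∀ x : WTInstance L, Team X (Fin x.n) → Team X (Fin x.n)}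

theorem ComputesTeam.congr (h : ComputesTeam b τ X F) (hFG : ∀ x T, F x T = G x T) :
    ComputesTeam b τ X G :=
  Computes.mono h fun x m m' _ hm => ⟨hm.1, by rw [← hFG, hm.2]⟩

theorem ComputesTeam.comp (hτ : 3 ≤ τ) (h : ComputesTeam b τ X F) (h' : ComputesTeam b τ X G) :
    ComputesTeam b τ X fun x T => G x (F x T) :=
  (Computes.seq h h' fun _ _ _ hm h => hm.of_eq hτ h.1).mono fun x m m'' _ hm => by
    obtain ⟨m', ⟨h1, h2⟩, h3, h4⟩ := hm
    exact ⟨fun σ hσ => (h3 σ hσ).trans (h1 σ hσ), by rw [h4, h2]⟩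

theorem ComputesTeam.iterate (hτ : 3 ≤ τ) (h : ComputesTeam b τ X F) (D : ℕ) :
    ComputesTeam b τ X fun x T => (F x)^[size b x ^ D] T :=
  Computes.iterate h D (fun x m i m' => (∀ σ < τ, m' σ = m σ) ∧
      team b X x m' τ = (F x)^[i] (team b X x m τ))
    (fun x m _ => ⟨fun _ _ => rfl, rfl⟩) (fun x m i m' hm h => hm.of_eq hτ h.1)
    (fun x m i m' m'' _ h h' => ⟨fun σ hσ => (h'.1 σ hσ).trans (h.1 σ hσ), by
      rw [iterate_succ_apply', ← h.2, h'.2]⟩)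

/-- The assignment is simultaneous, so the new team may be defined from the old one in the same
tape. -/
theorem ComputesTeam.filter
    {P : ∀ x : WTInstance L, Mem → (X → Fin x.n) → Prop} (h : FODef b P)
    (hF : ∀ x m, HasInput x m → {s | P x m s} = F x (team b X x m τ)) : ComputesTeam b τ X F :=
  (Computes.assignTeam h τ).mono fun x m m' hm h =>
    ⟨fun σ hσ => h.1 σ (by omega), h.2.trans (hF x m hm)⟩

/-- This makes `size b x ^ X.card` iterations sufficient for the fixed point. -/
theorem card_le_size_pow (b : ℕ) (X : Finset ℕ) (x : WTInstance L) :
    Nat.card (X → Fin x.n) ≤ size b x ^ X.card := by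
  rw [Nat.card_fun]
  simpa using Nat.pow_le_pow_left (n_lt_size b x).le X.card

end ComputesTeam

theorem update_eq_comp {X : Finset ℕ} {A : Type} (s : X → A) (y : ℕ) (a : A) :
    Team.update s y a = fun v : ↥(insert y X) => Sum.elim s (fun _ : Unit => a)
      (if h : v.1 = y then .inr () else .inl ⟨v.1, Finset.mem_of_mem_insert_of_ne v.2 h⟩) := by
  funext v
  by_cases h : v.1 = y <;> simp [Team.update, h]

/-- Assignments in which the updated assignment belongs to a stored team. -/
theorem FODef.update_mem (X : Finset ℕ) (y τ : ℕ) :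
    FODef (L := L) b fun x m (s : X ⊕ Unit → Fin x.n) =>
      Team.update (fun v => s (.inl v)) y (s (.inr ())) ∈ team b (insert y X) x m τ := by
  refine (FODef.mem_team (b := b) (L := L) (insert y X) τ fun v => (if h : v.1 = y then .inr ()
    else .inl ⟨v.1, Finset.mem_of_mem_insert_of_ne v.2 h⟩ : X ⊕ Unit)).congr fun x m s _ => ?_
  rw [update_eq_comp]
  have : (Sum.elim (fun v => s (.inl v)) fun _ => s (.inr ())) = s := by
    funext v; rcases v with v | v <;> rfl
  rw [this]

/-- The supplemented team is first-order definable. -/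
theorem FODef.mem_supplement (X : Finset ℕ) (y τ : ℕ) :
    FODef (L := L) b fun x m (s' : ↥(insert y X) → Fin x.n) =>
      s' ∈ Team.supplement (team b X x m τ) y fun _ => Set.univ := by
  have h1 := FODef.mem_team (b := b) (L := L) (V := ↥(insert y X) ⊕ X) X τ fun v => .inr v
  have h2 : ∀ v : X, FODef (L := L) b fun x _ (s : ↥(insert y X) ⊕ X → Fin x.n) =>
      v.1 ≠ y → s (.inl ⟨v.1, Finset.mem_insert_of_mem v.2⟩) = s (.inr v) := by
    intro v
    by_cases hv : v.1 = y
    · exact FODef.trivial.congr fun _ _ _ _ => by simp [hv]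
    · exact (FODef.eq (L := L) (b := b) (.inl ⟨v.1, Finset.mem_insert_of_mem v.2⟩)
        (.inr v)).congr fun _ _ _ _ => by simp [hv]
  refine (h1.and (FODef.finite_forall h2)).exists_fun.congr fun x m s' _ => ?_
  constructor
  · rintro ⟨s, hs, h⟩
    refine ⟨⟨s, hs⟩, s' ⟨y, Finset.mem_insert_self y X⟩, Set.mem_univ _, ?_⟩
    funext v
    by_cases hv : v.1 = y
    · have : v = ⟨y, Finset.mem_insert_self y X⟩ := Subtype.ext hv
      subst this
      simp [Team.update]
    · have := h ⟨v.1, Finset.mem_of_mem_insert_of_ne v.2 hv⟩ hv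
      simp only [Sum.elim_inl, Sum.elim_inr] at this
      simp [Team.update, hv, this]
  · rintro ⟨⟨s, hs⟩, a, -, rfl⟩
    exact ⟨s, hs, fun v hv => by simp [Team.update, hv]⟩

/-- One step of the evaluation of a quantifier: the supplemented team is computed in the tape
`τ + 1`, then its largest subteam that satisfies `φ`. -/
theorem Computes.supplementTeam {τ y : ℕ} (hτ : 3 ≤ τ) {X : Finset ℕ} {φ : InclusionFormula L}
    (h : ComputesTeam (L := L) b (τ + 1) (insert y X) fun _ => maxTeam φ (insert y X)) :
    Computes (size b) HasInput fun (x : WTInstance L) m m' => (∀ σ < τ + 1, m' σ = m σ) ∧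
      team b (insert y X) x m' (τ + 1) = maxTeam φ (insert y X)
        (Team.supplement (team b X x m τ) y fun _ => Set.univ) := by
  refine ((Computes.assignTeam (FODef.mem_supplement X y τ) (τ + 1)).seq h
    fun x m m' hm h => hm.of_eq (τ := τ + 1) (by omega) fun σ hσ => h.1 σ (by omega)).mono ?_
  rintro x m m'' _ ⟨m', ⟨h1, h2⟩, h3, h4⟩
  exact ⟨fun σ hσ => (h3 σ hσ).trans (h1 σ (by omega)), by rw [h4, h2]; rfl⟩

theorem team_congr {X : Finset ℕ} {x : WTInstance L} {m m' : Mem} {τ : ℕ} (h : m' τ = m τ) :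
    team b X x m' τ = team b X x m τ := by
  rw [team, team, h]

/-- Largest subteams can be computed in polynomial time. -/
theorem computesTeam_maxTeam (φ : InclusionFormula L) {X : Finset ℕ} (hφ : φ.freeVars ⊆ X) {τ : ℕ}
    (hτ : 3 ≤ τ) : ComputesTeam (L := L) b τ X fun _ => maxTeam φ X := by
  induction φ generalizing X τ with
  | eq t u =>
    rw [freeVars, Finset.union_subset_iff] at hφ
    refine ComputesTeam.filter
      ((FODef.mem_team X τ id).and (FODef.value_eq id id hφ.1 hφ.2)) fun x m _ => ?_
    exact (maxTeam_eq_filter (A := Fin x.n) fun S => Iff.rfl).symm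
  | neq t u =>
    rw [freeVars, Finset.union_subset_iff] at hφ
    refine ComputesTeam.filter
      ((FODef.mem_team X τ id).and (FODef.value_eq id id hφ.1 hφ.2).not) fun x m _ => ?_
    exact (maxTeam_eq_filter (A := Fin x.n) fun S => Iff.rfl).symm
  | rel R t =>
    have ht : ∀ i, (t i).varFinset ⊆ X := fun i => (Finset.subset_biUnion_of_mem
      (fun i => (t i).varFinset) (Finset.mem_univ i)).trans hφ
    refine ComputesTeam.filter
      ((FODef.mem_team X τ id).and (FODef.rel id R ht)) fun x m _ => ?_
    exact (maxTeam_eq_filter (A := Fin x.n) fun S => Iff.rfl).symm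
  | nrel R t =>
    have ht : ∀ i, (t i).varFinset ⊆ X := fun i => (Finset.subset_biUnion_of_mem
      (fun i => (t i).varFinset) (Finset.mem_univ i)).trans hφ
    refine ComputesTeam.filter
      ((FODef.mem_team X τ id).and (FODef.rel id R ht).not) fun x m _ => ?_
    exact (maxTeam_eq_filter (A := Fin x.n) fun S => Iff.rfl).symm
  | incl t u =>
    have htu : ∀ i, (t i).varFinset ∪ (u i).varFinset ⊆ X := fun i =>
      (Finset.subset_biUnion_of_mem (fun i => (t i).varFinset ∪ (u i).varFinset)
        (Finset.mem_univ i)).trans hφ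
    have h1 := FODef.mem_team (b := b) (L := L) (V := X ⊕ X) X τ fun v => .inr v
    have h2 := fun i => FODef.value_eq (b := b) (L := L) (V := X ⊕ X) (fun v : X => .inl v)
      (fun v : X => .inr v) (Finset.union_subset_left (htu i)) (Finset.union_subset_right (htu i))
    refine (ComputesTeam.iterate hτ (ComputesTeam.filter ((FODef.mem_team X τ id).and
      (h1.and (FODef.finite_forall h2)).exists_fun) (F := fun x S => {s | s ∈ S ∧ ∃ s' ∈ S,
        ∀ i, Team.value s (t i) = Team.value s' (u i)}) fun x m _ => rfl) X.card).congr ?_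
    intro x T
    exact (maxTeam_incl (card_le_size_pow b X x)).symm
  | and φ ψ ihφ ihψ =>
    rw [freeVars, Finset.union_subset_iff] at hφ
    refine (ComputesTeam.iterate hτ (ComputesTeam.comp hτ (ihφ hφ.1 hτ) (ihψ hφ.2 hτ))
      X.card).congr fun x T => ?_
    exact (maxTeam_and (card_le_size_pow b X x)).symm
  | or φ ψ ihφ ihψ =>
    rw [freeVars, Finset.union_subset_iff] at hφ
    have copy : ∀ i, Computes (size b) HasInput fun (x : WTInstance L) m m' =>
        (∀ σ, σ ≠ i → m' σ = m σ) ∧ team b X x m' i = team b X x m τ := fun i =>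
      Computes.assignTeam (FODef.mem_team X τ id) i
    have h1 := (copy (τ + 1)).seq (ihφ hφ.1 (τ := τ + 1) (by omega))
      fun x m m' hm h => hm.of_eq (τ := τ + 1) (by omega) fun σ hσ => h.1 σ (by omega)
    -- The evaluation of `φ` in the tape `τ + 1` may overwrite all later tapes, so the second copy
    -- is made only afterwards; the evaluation of `ψ` then preserves the tapes up to `τ + 1`.
    have h2 := (copy (τ + 2)).seq (ihψ hφ.2 (τ := τ + 2) (by omega))
      fun x m m' hm h => hm.of_eq (τ := τ + 2) (by omega) fun σ hσ => h.1 σ (by omega)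
    have h3 := Computes.assignTeam ((FODef.mem_team (b := b) (L := L) X (τ + 1) id).or
      (FODef.mem_team X (τ + 2) id)) τ
    have h12 := h1.seq h2 fun x m m' hm h => by
      obtain ⟨m₁, g, g'⟩ := h
      exact (hm.of_eq (τ := τ + 1) (by omega) fun σ hσ => g.1 σ (by omega)).of_eq
        (τ := τ + 1) (by omega) g'.1
    refine (h12.seq h3 fun x m m' hm h => ?_).mono ?_
    · obtain ⟨m₂, ⟨m₁, a1, a2⟩, m₃, a3, a4⟩ := h
      refine HasInput.of_eq (τ := τ + 1) (by omega) hm fun σ hσ => ?_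
      rw [a4.1 σ (by omega), a3.1 σ (by omega), a2.1 σ (by omega), a1.1 σ (by omega)]
    · rintro x m m' hm ⟨m₄, ⟨m₂, ⟨m₁, a1, a2⟩, m₃, a3, a4⟩, a5⟩
      refine ⟨fun σ hσ => ?_, ?_⟩
      · rw [a5.1 σ (by omega), a4.1 σ (by omega), a3.1 σ (by omega), a2.1 σ (by omega),
          a1.1 σ (by omega)]
      · rw [a5.2]
        beta_reduce at a2 a4 ⊢
        rw [maxTeam_or]
        have e1 : team b X x m₄ (τ + 1) = maxTeam φ X (team b X x m τ) := by
          rw [team_congr (a4.1 (τ + 1) (by omega)), team_congr (a3.1 (τ + 1) (by omega)), a2.2,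
            a1.2]
        have e2 : team b X x m₄ (τ + 2) = maxTeam ψ X (team b X x m τ) := by
          rw [a4.2, a3.2, team_congr (a2.1 τ (by omega)), team_congr (a1.1 τ (by omega))]
        rw [← e1, ← e2]
        rfl
  | ex y φ ih =>
    have hφ' : φ.freeVars ⊆ insert y X := by
      intro v hv
      by_cases h : v = y
      · exact h ▸ Finset.mem_insert_self y X
      · exact Finset.mem_insert_of_mem (hφ (Finset.mem_erase.mpr ⟨h, hv⟩))
    have h1 := Computes.supplementTeam hτ (ih hφ' (τ := τ + 1) (by omega))
    have h2 := Computes.assignTeam ((FODef.mem_team (b := b) (L := L) X τ id).and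
      (FODef.update_mem X y (τ + 1)).exists_fun) τ
    refine (h1.seq h2 fun x m m' hm h => hm.of_eq (τ := τ + 1) (by omega) h.1).mono ?_
    rintro x m m'' - ⟨m', a1, a2⟩
    refine ⟨fun σ hσ => (a2.1 σ (by omega)).trans (a1.1 σ (by omega)), ?_⟩
    rw [a2.2]
    beta_reduce
    rw [maxTeam_ex, a1.2, ← team_congr (a1.1 τ (by omega))]
    ext s
    simp only [Set.mem_ofPred_eq, Sum.elim_inl, Sum.elim_inr, id]
    exact and_congr_right fun _ => ⟨fun ⟨a, h⟩ => ⟨a (), h⟩, fun ⟨a, h⟩ => ⟨fun _ => a, h⟩⟩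
  | all y φ ih =>
    have hφ' : φ.freeVars ⊆ insert y X := by
      intro v hv
      by_cases h : v = y
      · exact h ▸ Finset.mem_insert_self y X
      · exact Finset.mem_insert_of_mem (hφ (Finset.mem_erase.mpr ⟨h, hv⟩))
    have h1 := Computes.supplementTeam hτ (ih hφ' (τ := τ + 1) (by omega))
    have h2 := Computes.assignTeam ((FODef.mem_team (b := b) (L := L) X τ id).and
      (FODef.update_mem X y (τ + 1)).forall_fun) τ
    have h3 : ComputesTeam b τ X fun (x : WTInstance L) (S : Team X (Fin x.n)) =>
        {s | s ∈ S ∧ ∀ a, Team.update s y a ∈ maxTeam φ (insert y X)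
          (S.supplement y fun _ => Set.univ)} := by
      refine (h1.seq h2 fun x m m' hm h => hm.of_eq (τ := τ + 1) (by omega) h.1).mono ?_
      rintro x m m'' - ⟨m', a1, a2⟩
      refine ⟨fun σ hσ => (a2.1 σ (by omega)).trans (a1.1 σ (by omega)), ?_⟩
      rw [a2.2, a1.2, ← team_congr (a1.1 τ (by omega))]
      ext s
      simp only [Set.mem_ofPred_eq, Sum.elim_inl, Sum.elim_inr, id]
      exact and_congr_right fun _ => ⟨fun h a => h fun _ => a, fun h a => h (a ())⟩
    -- In contrast to the existential case, the whole round, including the evaluation of `φ`, is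
    -- iterated.
    exact (ComputesTeam.iterate hτ h3 X.card).congr fun x T =>
      (maxTeam_all (card_le_size_pow b X x)).symm

end StackProgram


/-! ### Guessing a team in binary and checking it -/

namespace StackProgram

open Function FirstOrder.Language InclusionFormula

section Definable

variable {C : Type} {size : C → ℕ} {Inv : C → Mem → Prop} {V : Type}

theorem Definable.read_pair (τ : ℕ) (u v : V) :
    Definable size Inv (fun x m e => address (size x) ![e u, e v] ∈ m τ) := by
  refine (Definable.read τ (Repeatable.address ![u, v])).congr fun x m e _ _ => ?_
  have : (fun w => e (![u, v] w)) = ![e u, e v] := by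
    funext w; fin_cases w <;> rfl
  rw [this]

theorem Definable.read_triple (τ : ℕ) (u v w : V) :
    Definable size Inv (fun x m e => address (size x) ![e u, e v, e w] ∈ m τ) := by
  refine (Definable.read τ (Repeatable.address ![u, v, w])).congr fun x m e _ _ => ?_
  have : (fun i => e (![u, v, w] i)) = ![e u, e v, e w] := by
    funext w; fin_cases w <;> rfl
  rw [this]

/-- A constant may be used in definitions. -/
theorem Definable.withConst {P : C → Mem → (Option V → ℕ) → Prop} (h : Definable size Inv P)
    {c : ℕ} (hc : ∀ x, c < size x) :
    Definable size Inv (fun x m (e : V → ℕ) => P x m fun v => v.elim c e) := by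
  refine ((Definable.eq (V := Option V) (Repeatable.var none) (Repeatable.const c)).and h).exists.congr
    fun x m e _ _ => ?_
  constructor
  · rintro ⟨a, -, g, g'⟩
    obtain rfl : a = c := g
    exact g'
  · intro g
    exact ⟨c, hc x, rfl, g⟩

/-! ### Binary expansions -/

/-- The tape `5` holds the binary expansions of the elements of the domain. -/
def Bits (N : ℕ) (m : Mem) : Prop :=
  ∀ a < N, ∀ i < N, (address N ![a, i] ∈ m 5 ↔ a.testBit i = true)

/-- Bit `0` of `a` is its parity, and bit `i + 1` is bit `i` of `a / 2`. After `j` rounds the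
columns below `j` are correct, whatever the tape held before. -/
theorem Computes.bits : Computes size Inv (fun x m m' => (∀ σ, σ ≠ 5 → m' σ = m σ) ∧
    Bits (size x) m') := by
  have odd : Definable size (fun _ _ => True) (fun _ _ (e : Fin 2 → ℕ) =>
      e 1 = 0 ∧ ∃ c < size _, e 0 = c + c + 1) :=
    (Definable.eq (Repeatable.var 1) Repeatable.zero).and
      (Definable.eq (V := Option (Fin 2)) (Repeatable.var (some 0))
        (((Repeatable.var none).add (Repeatable.var none)).add .one)).exists
  have half : Definable size (fun _ _ => True) (fun x m (e : Fin 2 → ℕ) =>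
      ∃ c < size x, ∃ i < size x, e 1 = i + 1 ∧ (e 0 = c + c ∨ e 0 = c + c + 1) ∧
        address (size x) ![c, i] ∈ m 5) :=
    ((Definable.eq (V := Option (Option (Fin 2))) (Repeatable.var (some (some 1)))
      ((Repeatable.var none).add .one)).and
      (((Definable.eq (Repeatable.var (some (some 0)))
        ((Repeatable.var (some none)).add (Repeatable.var (some none)))).or
      (Definable.eq (Repeatable.var (some (some 0)))
        (((Repeatable.var (some none)).add (Repeatable.var (some none))).add .one))).and
      (Definable.read_pair 5 (some none) none))).exists.exists
  have step := Computes.assign (odd.or half) 5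
  refine ((step.iterate 1 (fun x m j m' => (∀ σ, σ ≠ 5 → m' σ = m σ) ∧
    ∀ a < size x, ∀ i < size x, i < j → (address (size x) ![a, i] ∈ m' 5 ↔ a.testBit i = true))
    ?_ ?_ ?_).restrict fun _ _ _ => trivial).mono ?_
  · exact fun x m _ => ⟨fun _ _ => rfl, fun a _ i _ h => absurd h (Nat.not_lt_zero i)⟩
  · exact fun _ _ _ _ _ _ => trivial
  · rintro x m j m' m'' - ⟨h1, h2⟩ ⟨h3, h4, -⟩
    refine ⟨fun σ hσ => (h3 σ hσ).trans (h1 σ hσ), fun a ha i hi hij => ?_⟩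
    rw [h4 ![a, i] (by intro v; fin_cases v <;> assumption)]
    simp only [Matrix.cons_val_zero, Matrix.cons_val_one]
    rcases i with _ | i
    · rw [Nat.testBit_zero, decide_eq_true_iff]
      constructor
      · rintro (⟨-, c, -, rfl⟩ | ⟨c, -, i, -, h, -⟩)
        · omega
        · omega
      · intro h
        exact .inl ⟨rfl, a / 2, by omega, by omega⟩
    · rw [Nat.testBit_succ]
      constructor
      · rintro (⟨h, -⟩ | ⟨c, hc, j', hj', h, hac, hm⟩)
        · omega
        · obtain rfl : i = j' := by omega
          have : a / 2 = c := by omega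
          rw [this, ← h2 c hc i hj' (by omega)]
          exact hm
      · intro h
        refine .inr ⟨a / 2, by omega, i, by omega, rfl, by omega, ?_⟩
        rw [h2 _ (by omega) i (by omega) (by omega)]
        exact h
  · rintro x m m' - ⟨h1, h2⟩
    exact ⟨h1, fun a ha i hi => h2 a ha i hi (by simpa using hi)⟩

end Definable

variable {L : FirstOrder.Language.{0, 0}} [FinEnum (Σ r, L.Functions r)]
  [FinEnum (Σ r, L.Relations r)] {b : ℕ}

/-- The positions of the symbols of the parameter. They serve as names for the elements of the
team. -/
def rows (x : WTInstance L) : Set ℕ := {p | x.enc[p]? = some none}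

theorem encard_rows (x : WTInstance L) : (rows x).encard = x.k := by
  rw [rows, ← count_eq_encard, WTInstance.enc, encodeInstance, List.count_append,
    List.count_eq_zero_of_not_mem (by simp)]
  simp

theorem lt_size_of_mem_rows {x : WTInstance L} {p : ℕ} (hp : p ∈ rows x) : p < size b x :=
  (List.getElem?_eq_some_iff.mp hp).1.trans_le (Nat.le_add_right _ _)

theorem HasInput.mem_two {x : WTInstance L} {m : Mem} (h : HasInput x m) : m 2 = rows x := by
  rw [h 2 (by norm_num)]
  simp [inputMem, rows]

/-- The positions of the digits that are to be guessed. -/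
def Digit (X : Finset ℕ) (x : WTInstance L) (e : Fin 3 → ℕ) : Prop :=
  e 0 < X.card ∧ e 1 ∈ rows x ∧ ∃ a < x.n, a.testBit (e 2) = true

/-- The tapes are ready for the guess. -/
def Prepared (b : ℕ) (X : Finset ℕ) (x : WTInstance L) (m : Mem) : Prop :=
  HasInput x m ∧ m 4 = ∅ ∧ Bits (size b x) m ∧
    m 3 = {a | ∃ e : Fin 3 → ℕ, (∀ v, e v < size b x) ∧ Digit X x e ∧ a = address (size b x) e}

theorem hasInput_inputMem (x : WTInstance L) : HasInput x (inputMem x.enc) := fun _ _ => rfl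

/-- The hypothesis on `b` makes `X.card` an element of the machine's domain, so that it may be used
as a constant. -/
theorem Computes.prepare {X : Finset ℕ} (hb : X.card < b) :
    Computes (fun x : WTInstance L => x.enc.length + b) (fun x m => m = inputMem x.enc)
      (fun x _ m' => Prepared b X x m') := by
  have hn : Definable (size b) HasInput (fun (x : WTInstance L) m (e : Fin 3 → ℕ) =>
      ∃ a < size b x, a < x.n ∧ address (size b x) ![a, e 2] ∈ m 5) :=
    ((Definable.lt (some none) none).withDomain.and
      (Definable.read_pair (V := Option (Fin 3)) 5 none (some 2))).exists
  have hD : Definable (size b) HasInput (fun (x : WTInstance L) m (e : Fin 3 → ℕ) =>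
      e 0 < X.card ∧ e 1 ∈ m 2 ∧ ∃ a < size b x, a < x.n ∧ address (size b x) ![a, e 2] ∈ m 5) :=
    ((Definable.lt (some 0) none).withConst fun x => hb.trans_le (Nat.le_add_left _ _)).and
      ((Definable.read 2 (Repeatable.var 1)).and hn)
  have hB : Computes (size b) (fun (x : WTInstance L) m => m = inputMem x.enc) _ := Computes.bits
  refine (hB.seq (Computes.assign hD 3) ?_).mono ?_
  · rintro x m m' rfl ⟨h, -⟩ σ hσ
    exact h σ (by omega)
  · rintro x m m'' rfl ⟨m', ⟨h1, h2⟩, h3, h4, h5⟩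
    have hin : HasInput x m' := fun σ hσ => h1 σ (by omega)
    have hin' : HasInput x m'' := fun σ hσ => (h3 σ (by omega)).trans (hin σ hσ)
    have hdig : ∀ e : Fin 3 → ℕ, (∀ v, e v < size b x) →
        (address (size b x) e ∈ m'' 3 ↔ Digit X x e) := by
      intro e he
      rw [h4 e he, hin.mem_two, Digit]
      refine and_congr_right fun _ => and_congr_right fun _ => ⟨?_, ?_⟩
      · rintro ⟨a, ha, han, h⟩
        exact ⟨a, han, (h2 a ha _ (he 2)).mp h⟩
      · rintro ⟨a, han, h⟩
        have ha := han.trans (n_lt_size b x)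
        exact ⟨a, ha, han, (h2 a ha _ (he 2)).mpr h⟩
    refine ⟨hin', ?_, ?_, ?_⟩
    · rw [h3 4 (by norm_num), h1 4 (by norm_num)]; rfl
    · intro a ha i hi
      rw [h3 5 (by norm_num)]
      exact h2 a ha i hi
    · ext a
      constructor
      · intro ha
        rcases h5 a ha with h | ⟨e, he, rfl⟩
        · rw [h1 3 (by norm_num)] at h
          simp [inputMem] at h
        · exact ⟨e, he, (hdig e he).mp ha, rfl⟩
      · rintro ⟨e, he, hd, rfl⟩
        exact (hdig e he).mpr hd

/-- A candidate is a variable, a row and a bit position used by some `a < n`. Since `n ≤ 2 ^ clog 2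
n`, such positions lie below `clog 2 n`. This is the source of the bound on nondeterminism. -/
theorem Prepared.encard_le {X : Finset ℕ} {x : WTInstance L} {m : Mem} (h : Prepared b X x m) :
    (m 3).encard ≤ (X.card * (x.k * Nat.clog 2 x.n) : ℕ) := by
  have hrows : (rows x).Finite := Set.finite_of_encard_eq_coe (encard_rows x)
  have hcard : hrows.toFinset.card = x.k := by
    have := encard_rows x
    rw [hrows.encard_eq_coe_toFinset_card] at this
    exact_mod_cast this
  let S : Finset (ℕ × ℕ × ℕ) :=
    Finset.range X.card ×ˢ (hrows.toFinset ×ˢ Finset.range (Nat.clog 2 x.n))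
  have hsub : m 3 ⊆ (S.image fun t => address (size b x) ![t.1, t.2.1, t.2.2] : Finset ℕ) := by
    rw [h.2.2.2]
    rintro _ ⟨e, -, ⟨h1, h2, a, ha, hbit⟩, rfl⟩
    refine Finset.mem_coe.mpr (Finset.mem_image.mpr ⟨(e 0, e 1, e 2), ?_, ?_⟩)
    · simp only [S, Finset.mem_product, Finset.mem_range, Set.Finite.mem_toFinset]
      refine ⟨h1, h2, ?_⟩
      by_contra hle
      have : a < 2 ^ e 2 := ha.trans_le ((Nat.le_pow_clog (by norm_num) _).trans
        (Nat.pow_le_pow_right (by norm_num) (not_lt.mp hle)))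
      rw [Nat.testBit_lt_two_pow this] at hbit
      cases hbit
    · congr 1
      funext i
      fin_cases i <;> rfl
  refine (Set.encard_le_encard hsub).trans ?_
  rw [Set.encard_coe_eq_coe_finsetCard]
  refine Nat.cast_le.mpr (Finset.card_image_le.trans ?_)
  simp [S, hcard]

/-- The assignment `s` is encoded in the guessed digits with name `p`. -/
def Row (b : ℕ) (X : Finset ℕ) (x : WTInstance L) (m : Mem) (p : ℕ) (s : X → Fin x.n) : Prop :=
  ∀ v : X, ∀ i < size b x, (∃ a < size b x, a < x.n ∧ address (size b x) ![a, i] ∈ m 5) →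
    (address (size b x) ![Fintype.equivFin X v, p, i] ∈ m 4 ↔
      address (size b x) ![s v, i] ∈ m 5)

theorem Definable.row {X : Finset ℕ} (hb : X.card < b) :
    Definable (size b) HasInput (fun (x : WTInstance L) m (e : Option X → ℕ) =>
      ∃ s : X → Fin x.n, (∀ v, e (some v) = s v) ∧ Row b X x m (e none) s) := by
  have hn : Definable (size b) HasInput (fun (x : WTInstance L) m (e : Option (Option X) → ℕ) =>
      ∃ a < size b x, a < x.n ∧ address (size b x) ![a, e none] ∈ m 5) :=
    ((Definable.lt (some none) none).withDomain.and
      (Definable.read_pair (V := Option (Option (Option X))) 5 none (some none))).exists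
  have hdig : ∀ v : X, Definable (size b) HasInput
      (fun (x : WTInstance L) m (e : Option (Option X) → ℕ) =>
        address (size b x) ![Fintype.equivFin X v, e (some none), e none] ∈ m 4) := fun v =>
    (Definable.read_triple (V := Option (Option (Option X))) 4 none (some (some none))
      (some none)).withConst (c := Fintype.equivFin X v) fun x => by
        have := (Fintype.equivFin X v).2
        have := Fintype.card_coe X
        simp only [size]; omega
  have hrow : Definable (size b) HasInput (fun (x : WTInstance L) m (e : Option X → ℕ) =>
      ∀ v : X, ∀ i < size b x, (∃ a < size b x, a < x.n ∧ address (size b x) ![a, i] ∈ m 5) →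
        (address (size b x) ![Fintype.equivFin X v, e none, i] ∈ m 4 ↔
          address (size b x) ![e (some v), i] ∈ m 5)) :=
    Definable.finite_forall fun v => (hn.imp ((hdig v).iff
      (Definable.read_pair 5 (some (some v)) none))).forall
  refine (hrow.and (inDomain.comp some)).congr fun x m e _ _ => ?_
  constructor
  · rintro ⟨h1, h2⟩
    exact ⟨fun v => ⟨e (some v), h2 v⟩, fun _ => rfl, h1⟩
  · rintro ⟨s, hs, h⟩
    refine ⟨fun v i hi ha => ?_, fun v => (hs v).trans_lt (s v).2⟩
    rw [hs]
    exact h v i hi ha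

/-- The guess describes a team of the right size that satisfies the formula. -/
def Accept (b : ℕ) (X : Finset ℕ) (x : WTInstance L) (m : Mem) : Prop :=
  (∀ p ∈ m 2, ∃ s, Row b X x m p s) ∧
  (∀ p ∈ m 2, ∀ q ∈ m 2, ∀ s, Row b X x m p s → Row b X x m q s → p = q) ∧
  team b X x m 6 ⊆ team b X x m 7

/-- Names of rows are positions of the input and values of assignments lie below `n`, so all
quantifiers of `Accept` are bounded by the machine's domain. -/
theorem Definable.accept {X : Finset ℕ} (hb : X.card < b) :
    Definable (size b) HasInput (fun (x : WTInstance L) m (_ : Empty → ℕ) => Accept b X x m) := by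
  have hrow := Definable.row (L := L) hb
  have h1 := ((Definable.read (size := size b) (Inv := HasInput) (C := WTInstance L) 2
    (Repeatable.var (none : Option Empty))).imp
      (hrow.comp fun v => v.elim (.inl none) (.inr : X → Option Empty ⊕ X)).exists_fun).forall
  have h2 := ((Definable.read (size := size b) (Inv := HasInput) (C := WTInstance L) 2
    (Repeatable.var (some none : Option (Option Empty)))).imp
      ((Definable.read 2 (Repeatable.var none)).imp
      (((hrow.comp fun v => v.elim (.inl (some none)) (.inr : X → Option (Option Empty) ⊕ X)).imp
      ((hrow.comp fun v => v.elim (.inl none) (.inr : X → Option (Option Empty) ⊕ X)).imp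
      (Definable.eq (Repeatable.var (.inl (some none)))
        (Repeatable.var (.inl none))))).forall_fun))).forall.forall
  have hteam := fun τ => Definable.comp (V := Empty ⊕ X)
    (FODef.mem_team (L := L) (b := b) X τ id) .inr
  have h3 := ((hteam 6).imp (hteam 7)).forall_fun
  refine (h1.and (h2.and h3)).congr fun x m e hm _ => ?_
  have lt : ∀ s : X → Fin x.n, ∀ v, (s v : ℕ) < size b x :=
    fun s v => (s v).2.trans (n_lt_size b x)
  have inj : ∀ {s s' : X → Fin x.n}, (∀ v, (s v : ℕ) = s' v) → s = s' :=
    fun h => coe_inj_fun (e := fun v => (_ : ℕ)) (fun _ => rfl) h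
  rw [Accept, hm.mem_two]
  simp only [Sum.elim_inr, Sum.elim_inl, Option.elim]
  refine and_congr ?_ (and_congr ?_ ?_)
  · constructor
    · intro h p hp
      obtain ⟨a, -, s, -, hs⟩ := h p (lt_size_of_mem_rows hp) hp
      exact ⟨s, hs⟩
    · intro h p _ hp
      obtain ⟨s, hs⟩ := h p hp
      exact ⟨fun v => s v, lt s, s, fun _ => rfl, hs⟩
  · constructor
    · intro h p hp q hq s hs hs'
      exact h p (lt_size_of_mem_rows hp) q (lt_size_of_mem_rows hq) hp hq (fun v => s v) (lt s)
        ⟨s, fun _ => rfl, hs⟩ ⟨s, fun _ => rfl, hs'⟩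
    · rintro h p - q - hp hq a - ⟨s, has, hs⟩ ⟨s', has', hs'⟩
      obtain rfl := coe_inj_fun has has'
      exact h p hp q hq s hs hs'
  · constructor
    · intro h s hs
      obtain ⟨s', hss', hs'⟩ := h (fun v => s v) (lt s) ⟨s, fun _ => rfl, hs⟩
      rwa [inj hss']
    · rintro h a - ⟨s, has, hs⟩
      exact ⟨s, has, h hs⟩

/-- The team described by the guess is computed in the tape `6`, its largest subteam that satisfies
`φ` in the tape `7`. -/
theorem Computes.evaluate (φ : InclusionFormula L) {X : Finset ℕ} (hφ : φ.freeVars ⊆ X)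
    (hb : X.card < b) :
    Computes (size b) HasInput (fun (x : WTInstance L) m m' => (∀ σ < 6, m' σ = m σ) ∧
      team b X x m' 6 = {s | ∃ p ∈ rows x, Row b X x m p s} ∧
      team b X x m' 7 = maxTeam φ X (team b X x m' 6)) := by
  have hdef : FODef b (fun (x : WTInstance L) m s => ∃ p ∈ rows x, Row b X x m p s) := by
    refine Definable.congr ((Definable.read (size := size b) (Inv := HasInput)
      (C := WTInstance L) 2 (Repeatable.var (none : Option X))).and
      (Definable.row hb)).exists fun x m e hm _ => ?_
    rw [hm.mem_two]
    constructor
    · rintro ⟨p, -, hp, s, hs, h⟩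
      exact ⟨s, hs, p, hp, h⟩
    · rintro ⟨s, hs, p, hp, h⟩
      exact ⟨p, lt_size_of_mem_rows hp, hp, s, hs, h⟩
  have h1 := Computes.assignTeam hdef 6
  have h2 := Computes.assignTeam (FODef.mem_team (L := L) (b := b) X 6 id) 7
  have h3 := computesTeam_maxTeam (b := b) φ hφ (τ := 7) (by norm_num)
  refine ((h1.seq h2 fun x m m' hm h => hm.of_eq (τ := 6) (by norm_num) fun σ hσ =>
    h.1 σ (by omega)).seq h3 fun x m m'' hm h => ?_).mono ?_
  · obtain ⟨m', a1, a2⟩ := h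
    exact hm.of_eq (τ := 6) (by norm_num) fun σ hσ =>
      (a2.1 σ (by omega)).trans (a1.1 σ (by omega))
  · rintro x m m₃ - ⟨m₂, ⟨m₁, a1, a2⟩, a3⟩
    have e6 : team b X x m₃ 6 = team b X x m₂ 6 := team_congr (a3.1 6 (by norm_num))
    have e6' : team b X x m₂ 6 = team b X x m₁ 6 := team_congr (a2.1 6 (by norm_num))
    refine ⟨fun σ hσ => ?_, ?_, ?_⟩
    · rw [a3.1 σ (by omega), a2.1 σ (by omega), a1.1 σ (by omega)]
    · rw [e6, e6', a1.2]
    · rw [a3.2, a2.2, e6, e6']; rfl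

/-- Guessed digits describe at most one assignment. -/
theorem Row.unique {X : Finset ℕ} {x : WTInstance L} {m : Mem} (hbits : Bits (size b x) m) {p : ℕ}
    {s s' : X → Fin x.n} (h : Row b X x m p s) (h' : Row b X x m p s') : s = s' := by
  funext v
  refine Fin.ext (Nat.eq_of_testBit_eq fun i => ?_)
  have lt : ∀ s : X → Fin x.n, (s v : ℕ) < size b x := fun s => (s v).2.trans (n_lt_size b x)
  rcases lt_or_ge i (size b x) with hi | hi
  · by_cases ha : ∃ a < size b x, a < x.n ∧ address (size b x) ![a, i] ∈ m 5
    · have := (h v i hi ha).symm.trans (h' v i hi ha)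
      rw [hbits _ (lt s) i hi, hbits _ (lt s') i hi] at this
      exact Bool.eq_iff_iff.mpr this
    -- A position that is used by no element of the structure is not guessed, but there all elements
    -- have the digit `0`.
    · have no : ∀ s : X → Fin x.n, (s v : ℕ).testBit i = false := by
        intro s
        by_contra hs
        exact ha ⟨s v, lt s, (s v).2, (hbits _ (lt s) i hi).mpr (by simpa using hs)⟩
      rw [no, no]
  · have no : ∀ s : X → Fin x.n, (s v : ℕ).testBit i = false := fun s =>
      Nat.testBit_lt_two_pow ((lt s).trans_le (hi.trans (Nat.lt_two_pow_self).le))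
    rw [no, no]

/-- Accepted guesses describe teams. -/
theorem Accept.exists_team {φ : InclusionFormula L} {X : Finset ℕ} {x : WTInstance L} {m : Mem}
    (hm : HasInput x m) (hbits : Bits (size b x) m)
    (h6 : team b X x m 6 = {s | ∃ p ∈ rows x, Row b X x m p s})
    (h7 : team b X x m 7 = maxTeam φ X (team b X x m 6)) (h : Accept b X x m) :
    ∃ T : Team X (Fin x.n), T.ncard = x.k ∧ φ.Sat (Fin x.n) X T := by
  obtain ⟨h1, h2, h3⟩ := h
  rw [hm.mem_two] at h1 h2
  refine ⟨team b X x m 6, ?_, sat_iff.mpr (h7 ▸ h3)⟩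
  -- The team is the image of the `k` names under the injective map `f`; injectivity is the second
  -- clause of `Accept`.
  choose! f hf using h1
  have himg : team b X x m 6 = f '' rows x := by
    rw [h6]
    ext s
    constructor
    · rintro ⟨p, hp, hs⟩
      exact ⟨p, hp, (hf p hp).unique hbits hs⟩
    · rintro ⟨p, hp, rfl⟩
      exact ⟨p, hp, hf p hp⟩
  have hinj : Set.InjOn f (rows x) := fun p hp q hq e =>
    h2 p hp q hq (f p) (hf p hp) (e ▸ hf q hq)
  rw [himg, Set.ncard_def, hinj.encard_image, encard_rows]
  rfl

/-- For every team that satisfies the formula there are digits that describe it. -/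
theorem accept_of_team {φ : InclusionFormula L} {X : Finset ℕ} {x : WTInstance L} (hb : X.card < b)
    {T : Team X (Fin x.n)} (hT : T.ncard = x.k) (hsat : φ.Sat (Fin x.n) X T) :
    ∃ H : Set ℕ, ∀ m₀ m, Prepared b X x m₀ → (∀ σ < 6, σ ≠ 3 → σ ≠ 4 → m σ = m₀ σ) →
      m 4 = {a | a ∈ m₀ 3 ∧ a ∈ H} → team b X x m 6 = {s | ∃ p ∈ rows x, Row b X x m p s} →
      team b X x m 7 = maxTeam φ X (team b X x m 6) → Accept b X x m := by
  have hcard : (rows x).encard = T.encard := by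
    rw [encard_rows, ← hT, (Set.toFinite T).cast_ncard_eq]
  -- The `k` names are matched with the members of the team, and the set to be guessed consists of
  -- the digits `1` of the values `f p v`.
  obtain ⟨f, hf⟩ := (Set.finite_of_encard_eq_coe (encard_rows x)).exists_bijOn_of_encard_eq hcard
  refine ⟨{a | ∃ p ∈ rows x, ∃ v : X, ∃ i < size b x, (f p v : ℕ).testBit i = true ∧
    a = address (size b x) ![Fintype.equivFin X v, p, i]}, fun m₀ m hm₀ hm h4 h6 h7 => ?_⟩
  have hin : HasInput x m := fun σ hσ =>
    (hm σ (by omega) (by omega) (by omega)).trans (hm₀.1 σ hσ)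
  have hbits : Bits (size b x) m := by
    intro a ha i hi
    rw [hm 5 (by norm_num) (by norm_num) (by norm_num)]
    exact hm₀.2.2.1 a ha i hi
  have lt : ∀ (s : X → Fin x.n) v, (s v : ℕ) < size b x :=
    fun s v => (s v).2.trans (n_lt_size b x)
  have idx : ∀ v : X, (Fintype.equivFin X v : ℕ) < X.card := fun v => by
    have := (Fintype.equivFin X v).2
    have := Fintype.card_coe X
    omega
  have triple : ∀ {u p i : ℕ}, u < size b x → p < size b x → i < size b x →
      ∀ v, (![u, p, i] : Fin 3 → ℕ) v < size b x := by
    intro u p i h1 h2 h3 v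
    fin_cases v <;> assumption
  have idx' : ∀ v : X, (Fintype.equivFin X v : ℕ) < size b x := fun v => by
    have := idx v
    simp only [size]; omega
  have hrow : ∀ p ∈ rows x, Row b X x m p (f p) := by
    rintro p hp v i hi ⟨a, ha, han, hai⟩
    rw [hbits _ (lt _ v) i hi, h4, hm₀.2.2.2]
    constructor
    · rintro ⟨-, q, hq, u, j, hj, hbit, e⟩
      have e' := address_injOn (triple (idx' v) (lt_size_of_mem_rows hp) hi)
        (triple (idx' u) (lt_size_of_mem_rows hq) hj) e
      have e0 := congrFun e' 0
      have e1 := congrFun e' 1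
      have e2 := congrFun e' 2
      simp only [Matrix.cons_val_zero, Matrix.cons_val_one, Matrix.cons_val] at e0 e1 e2
      have : v = u := (Fintype.equivFin X).injective (Fin.ext e0)
      rw [e1, e2, this]
      exact hbit
    · intro hbit
      refine ⟨⟨_, triple (idx' v) (lt_size_of_mem_rows hp) hi, ⟨idx v, hp, f p v, (f p v).2,
        hbit⟩, rfl⟩, p, hp, v, i, hi, hbit, rfl⟩
  have hteam : team b X x m 6 = T := by
    rw [h6, ← hf.image_eq]
    ext s
    constructor
    · rintro ⟨p, hp, hs⟩
      exact ⟨p, hp, (hrow p hp).unique hbits hs⟩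
    · rintro ⟨p, hp, rfl⟩
      exact ⟨p, hp, hrow p hp⟩
  refine ⟨fun p hp => ⟨f p, hrow p (hin.mem_two ▸ hp)⟩, fun p hp q hq s hs hs' => ?_, ?_⟩
  · rw [hin.mem_two] at hp hq
    exact hf.injOn hp hq (((hrow p hp).unique hbits hs).trans ((hrow q hq).unique hbits hs').symm)
  · rw [h7, hteam]
    exact sat_iff.mp hsat

end StackProgram


namespace StackProgram

open Function FirstOrder.Language InclusionFormula

variable {L : FirstOrder.Language.{0, 0}} [FinEnum (Σ r, L.Functions r)]
  [FinEnum (Σ r, L.Relations r)] {b : ℕ}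

/-! ### Recognizing encodings -/

variable (L) in
/-- The tapes hold a word that begins with the encoding of a structure with `n` elements, which has
length `l`. -/
def IsEncoding (N : ℕ) (m : Mem) (n l : ℕ) : Prop :=
  n ≠ 0 ∧ l = n + 1 + (L.symbols.map fun y => n ^ y.arity).sum ∧
  (∀ i < N, i < l ↔ i ∈ m 0 ∨ i ∈ m 1) ∧ (∀ i < N, i < n → i ∈ m 0) ∧ n ∈ m 1 ∧
  ∀ f : Σ r, L.Functions r, ∀ a : Fin f.1 → ℕ, (∀ i, a i < N) → (∀ i, a i < n) →
    ∃ c < N, c < n ∧ ∀ d < N, d < n →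
      (tableAddress n (.inr f : L.Symbol) (Fin.snoc (α := fun _ => ℕ) a d) ∈ m 0 ↔ d = c)

theorem Definable.isEncoding {C : Type} {size : C → ℕ} {Inv : C → Mem → Prop} {V : Type}
    (ν μ : V) : Definable size Inv fun x m e => IsEncoding L (size x) m (e ν) (e μ) := by
  have pow : ∀ r, Repeatable size (fun _ (e : V → ℕ) => e ν ^ r) := fun r => by
    simpa using Repeatable.var_pow_mul ν (Repeatable.one (size := size)) r
  have h1 : Definable size Inv fun _ _ e => e ν ≠ 0 :=
    (Definable.eq (Repeatable.var ν) Repeatable.zero).not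
  have h2 : Definable size Inv fun _ _ e =>
      e μ = e ν + 1 + (L.symbols.map fun y => e ν ^ y.arity).sum :=
    Definable.eq (Repeatable.var μ) (((Repeatable.var ν).add .one).add
      (Repeatable.listSum _ fun z : L.Symbol => pow z.arity))
  have h3 : Definable size Inv fun x m e => ∀ i < size x, (i < e μ ↔ i ∈ m 0 ∨ i ∈ m 1) :=
    ((Definable.lt none (some μ)).iff ((Definable.read 0 (Repeatable.var none)).or
      (Definable.read 1 (Repeatable.var none)))).forall
  have h4 : Definable size Inv fun x m e => ∀ i < size x, (i < e ν → i ∈ m 0) :=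
    ((Definable.lt none (some ν)).imp (Definable.read 0 (Repeatable.var none))).forall
  have h5 : Definable size Inv fun _ m e => e ν ∈ m 1 := Definable.read 1 (Repeatable.var ν)
  have h6 : ∀ f : Σ r, L.Functions r, Definable size Inv fun x m e => ∀ a : Fin f.1 → ℕ,
      (∀ i, a i < size x) → (∀ i, a i < e ν) → ∃ c < size x, c < e ν ∧ ∀ d < size x, d < e ν →
      (tableAddress (e ν) (.inr f : L.Symbol) (Fin.snoc (α := fun _ => ℕ) a d) ∈ m 0 ↔
        d = c) := by
    intro f
    have g1 : Definable size Inv fun _ _ (e : V ⊕ Fin f.1 → ℕ) =>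
        ∀ i : Fin f.1, e (.inr i) < e (.inl ν) :=
      Definable.finite_forall fun i => Definable.lt _ _
    have g2 : Definable size Inv fun _ m (e : Option (Option (V ⊕ Fin f.1)) → ℕ) =>
        tableAddress (e (some (some (.inl ν)))) (.inr f : L.Symbol) (Fin.snoc (α := fun _ => ℕ)
          (fun i => e (some (some (.inr i)))) (e none)) ∈ m 0 := by
      refine (Definable.read 0 (Repeatable.tableAddress (some (some (.inl ν)))
        (.inr f : L.Symbol) (Fin.snoc (α := fun _ => Option (Option (V ⊕ Fin f.1)))
          (fun i : Fin f.1 => some (some (.inr i))) none))).congr fun x m e _ _ => ?_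
      have : (fun i => e ((Fin.snoc (α := fun _ => Option (Option (V ⊕ Fin f.1)))
          (fun i : Fin f.1 => some (some (.inr i))) none : Fin (f.1 + 1) → _) i)) =
          (Fin.snoc (α := fun _ => ℕ) (fun i => e (some (some (.inr i)))) (e none) :
            Fin (f.1 + 1) → ℕ) := by
        funext i
        refine Fin.lastCases ?_ (fun i => ?_) i <;> simp
      exact iff_of_eq (congrArg (fun a => tableAddress (e (some (some (.inl ν))))
        (.inr f : L.Symbol) a ∈ m 0) this)
    exact (g1.imp ((Definable.lt none (some (.inl ν))).and ((Definable.lt none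
      (some (some (.inl ν)))).imp (g2.iff (Definable.eq (Repeatable.var none)
        (Repeatable.var (some none))))).forall).exists).forall_fun
  exact h1.and (h2.and (h3.and (h4.and (h5.and (Definable.finite_forall h6)))))

/-- Any bits form the table of a relation, whereas the table of a graph must have exactly one value
for every tuple of arguments. This is the last clause of `IsEncoding`, from which the functions are
chosen. -/
theorem IsEncoding.exists_instance {u : List Sym} {N n l : ℕ} (hN : u.length < N)
    (h : IsEncoding L N (inputMem u) n l) : ∃ x : WTInstance L, x.enc = u := by
  obtain ⟨hn, hl, hpos, hlt, hn1, hfun⟩ := h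
  have m0 : ∀ i, i ∈ inputMem u 0 ↔ u[i]? = some (some true) := fun i => Iff.rfl
  have m1 : ∀ i, i ∈ inputMem u 1 ↔ u[i]? = some (some false) := fun i => Iff.rfl
  have hnl : n < l := by omega
  -- The position just behind the word belongs to the domain but carries no symbol, so it cannot lie
  -- below `l`.
  have hlu : l ≤ u.length := by
    by_contra hlu
    have := (hpos u.length hN).mp (by omega)
    simp [m0, m1] at this
  have pos : ∀ i < l, ∃ c, u[i]? = some (some c) := by
    intro i hi
    rcases (hpos i (by omega)).mp hi with h | h
    · exact ⟨_, (m0 i).mp h⟩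
    · exact ⟨_, (m1 i).mp h⟩
  have neg : ∀ i < u.length, l ≤ i → u[i]? = some none := by
    intro i hi hi'
    have h := (hpos i (by omega)).not.mp (by omega)
    rw [m0, m1] at h
    cases hc : u[i]? with
    | none => rw [List.getElem?_eq_none_iff] at hc; omega
    | some c =>
      rw [hc] at h
      rcases c with _ | _ | _ <;> simp_all
  let w : List Bool := (u.take l).map fun c => c.getD false
  have hwlen : w.length = l := by simp [w, hlu]
  have hw : ∀ i < l, ∀ c, u[i]? = some (some c) ↔ w[i]? = some c := by
    intro i hi c
    obtain ⟨d, hd⟩ := pos i hi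
    simp [w, hi, hd]
  have hu : u = encodeInstance (w, u.length - l) := by
    refine List.ext_getElem? fun i => ?_
    rw [encodeInstance]
    rcases lt_or_ge i l with hi | hi
    · rw [List.getElem?_append_left (by simpa [hwlen] using hi)]
      obtain ⟨c, hc⟩ := pos i hi
      rw [List.getElem?_map, (hw i hi c).mp hc, hc]
      rfl
    · rw [List.getElem?_append_right (by simpa [hwlen] using hi), List.getElem?_replicate]
      by_cases hi' : i < u.length
      · rw [neg i hi' hi, if_pos]
        simp only [List.length_map, hwlen]
        omega
      · rw [List.getElem?_eq_none (by omega), if_neg]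
        simp only [List.length_map, hwlen]
        omega
  have func : ∀ (f : Σ r, L.Functions r) (a : Fin f.1 → Fin n), ∃ c : Fin n, ∀ d : Fin n,
      (tableAddress n (.inr f : L.Symbol) (fun i => (Fin.snoc (α := fun _ => Fin n) a d :
        Fin (f.1 + 1) → Fin n) i) ∈ inputMem u 0 ↔ c = d) := by
    intro f a
    obtain ⟨c, -, hc, h⟩ := hfun f (fun i => a i) (fun i => (a i).2.trans (by omega))
      fun i => (a i).2
    refine ⟨⟨c, hc⟩, fun d => ?_⟩
    have := h d (d.2.trans (by omega)) d.2
    rw [Fin.ext_iff, eq_comm (a := c), ← this]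
    have e : (fun i => ((Fin.snoc (α := fun _ => Fin n) a d : Fin (f.1 + 1) → Fin n) i : ℕ)) =
        (Fin.snoc (α := fun _ => ℕ) (fun i => (a i : ℕ)) (d : ℕ) : Fin (f.1 + 1) → ℕ) := by
      funext i
      refine Fin.lastCases ?_ (fun i => ?_) i <;> simp
    exact iff_of_eq (congrArg (fun a => tableAddress n (.inr f : L.Symbol) a ∈ inputMem u 0) e)
  choose F hF using func
  let str : L.Structure (Fin n) :=
    { funMap := fun {r} f a => F ⟨r, f⟩ a
      RelMap := fun {r} R a => tableAddress n (.inl ⟨r, R⟩ : L.Symbol) (fun i => a i) ∈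
        inputMem u 0 }
  have holds : ∀ (y : L.Symbol) (a : Fin y.arity → Fin n),
      y.Holds a ↔ tableAddress n y (fun i => a i) ∈ inputMem u 0 := by
    rintro (R | f) a
    · rfl
    · change F f (fun i => a i.castSucc) = a (Fin.last f.1) ↔ _
      rw [← hF]
      have : (Fin.snoc (α := fun _ => Fin n) (fun i : Fin f.1 => a i.castSucc) (a (Fin.last f.1)) :
          Fin (f.1 + 1) → Fin n) = a := by
        funext i
        refine Fin.lastCases ?_ (fun i => ?_) i <;> simp
      rw [this]
  have henc : w = encodeStructure L n := by
    refine eq_encodeStructure (hwlen.trans hl) (fun i hi => ?_) ?_ fun y a => ?_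
    · exact (hw i (by omega) true).mp ((m0 i).mp (hlt i (by omega) hi))
    · exact (hw n hnl false).mp ((m1 n).mp hn1)
    · have hlt : tableAddress n y (fun i => a i) < l := by
        have := (List.getElem?_eq_some_iff.mp (getElem?_encodeStructure y a)).1
        rwa [length_encodeStructure, ← hl] at this
      obtain ⟨c, hc⟩ := pos _ hlt
      rw [(hw _ hlt c).mp hc]
      congr 1
      rw [Bool.eq_iff_iff, truth_eq_true, holds, m0, hc]
      simp
  have : NeZero n := ⟨hn⟩
  rw [henc] at hu
  exact ⟨⟨n, inferInstance, str, u.length - l⟩, hu.symm⟩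

theorem isEncoding_enc (x : WTInstance L) {N : ℕ} (hN : x.enc.length < N) :
    IsEncoding L N (inputMem x.enc) x.n (encodeStructure L x.n).length := by
  have hin := hasInput_inputMem x
  have hlt : ∀ a : Fin x.n, (a : ℕ) < N := by
    intro a
    have := n_lt_size 0 x
    have := a.2
    simp only [size] at *
    omega
  refine ⟨NeZero.ne _, length_encodeStructure _, fun i _ => ?_, fun i _ hi => hin.mem_zero hi,
    hin.n_mem_one, fun f a _ ha => ?_⟩
  · constructor
    · intro hi
      obtain ⟨c, hc⟩ : ∃ c, (encodeStructure L x.n)[i]? = some c :=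
        ⟨_, List.getElem?_eq_getElem hi⟩
      have := getElem?_enc hc
      cases c
      · exact .inr this
      · exact .inl this
    · intro h
      by_contra hi
      have hnone : ∀ c, x.enc[i]? ≠ some (some c) := by
        intro c
        rw [WTInstance.enc, encodeInstance, List.getElem?_append_right (by simpa using hi),
          List.getElem?_replicate]
        split_ifs <;> simp
      rcases h with h | h
      · exact hnone true h
      · exact hnone false h
  · let a' : Fin f.1 → Fin x.n := fun i => ⟨a i, ha i⟩
    let c := FirstOrder.Language.Structure.funMap f.2 a'
    refine ⟨c, hlt c, c.2, fun d _ hd => ?_⟩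
    have := hin.table (.inr f : L.Symbol) (Fin.snoc (α := fun _ => Fin x.n) a' ⟨d, hd⟩ :
      Fin (f.1 + 1) → Fin x.n)
    have e : (fun i => ((Fin.snoc (α := fun _ => Fin x.n) a' ⟨d, hd⟩ :
        Fin (f.1 + 1) → Fin x.n) i : ℕ)) =
        (Fin.snoc (α := fun _ => ℕ) a d : Fin (f.1 + 1) → ℕ) := by
      funext i
      refine Fin.lastCases ?_ (fun i => ?_) i <;> simp [a']
    refine (iff_of_eq (congrArg (fun a => tableAddress x.n (.inr f : L.Symbol) a ∈
      inputMem x.enc 0) e)).symm.trans (this.trans ?_)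
    simp only [Symbol.Holds, Fin.snoc_castSucc, Fin.snoc_last]
    rw [Fin.ext_iff, eq_comm]

/-- The size `n` and the length `l` of the encoding are found by searching the domain; `l` may equal
the length of the word, hence `0 < b`. -/
theorem Definable.exists_instance (hb : 0 < b) :
    Definable (fun u : List Sym => u.length + b) (fun u m => m = inputMem u)
      (fun u _ (_ : Empty → ℕ) => ∃ x : WTInstance L, x.enc = u) := by
  refine (Definable.isEncoding (L := L) (V := Option (Option Empty)) (some none) none).exists.exists.congr
    fun u m e hm _ => ?_
  subst hm
  constructor
  · rintro ⟨n, -, l, -, h⟩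
    exact h.exists_instance (by omega)
  · rintro ⟨x, rfl⟩
    have h := isEncoding_enc x (N := x.enc.length + b) (by omega)
    refine ⟨x.n, n_lt_size b x, _, ?_, h⟩
    simp only [WTInstance.enc, encodeInstance, List.length_append, List.length_map]
    omega

end StackProgram

/-! ## Machines for the weighted team problem -/

theorem reduceOption_map_some {α : Type} (w : List α) : (w.map some).reduceOption = w := by
  simp [List.reduceOption, List.filterMap_map]

theorem encodeInstance_injective {α : Type} : Function.Injective (encodeInstance (α := α)) := by
  rintro ⟨w, k⟩ ⟨w', k'⟩ h
  have h1 := congrArg List.reduceOption h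
  have h2 := congrArg List.length h
  simp only [encodeInstance, List.reduceOption_append, reduceOption_map_some,
    List.reduceOption_replicate_none, List.append_nil, List.length_append, List.length_map,
    List.length_replicate] at h1 h2
  subst h1
  simpa using h2

theorem encodeStructure_size_injective {L : FirstOrder.Language.{0, 0}}
    [FinEnum (Σ r, L.Functions r)] [FinEnum (Σ r, L.Relations r)] {n n' : ℕ}
    [L.Structure (Fin n)] [L.Structure (Fin n')]
    (h : encodeStructure L n = encodeStructure L n') : n = n' := by
  rcases lt_trichotomy n n' with hlt | rfl | hlt
  · have h1 := FirstOrder.Language.getElem?_encodeStructure_self (L := L) n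
    rw [h, FirstOrder.Language.getElem?_encodeStructure_lt hlt] at h1
    cases h1
  · rfl
  · have h1 := FirstOrder.Language.getElem?_encodeStructure_self (L := L) n'
    rw [← h, FirstOrder.Language.getElem?_encodeStructure_lt hlt] at h1
    cases h1

open StackProgram FirstOrder.Language in
-- The common source of all claims. The bound on guesses quantifies over the instances encoded by
-- `u`, so on words that encode none it permits no guess at all.
theorem exists_pWT_machine {L : FirstOrder.Language.{0, 0}} [FinEnum (Σ r, L.Functions r)]
    [FinEnum (Σ r, L.Relations r)] (φ : InclusionFormula L) :
    ∃ (M : NTM (Option Bool)) (c : ℕ),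
      (∀ p, M.Accepts (encodeInstance p) ↔ p ∈ (pWT φ).lang) ∧
      (∀ u, M.HaltsWithin u (c * (u.length + 1) ^ c)) ∧
      ∀ u, ∀ B : ℕ, (∀ x : WTInstance L, x.enc = u → c * (x.k * Nat.clog 2 x.n) ≤ B) →
        M.NondetStepsWithin u B := by
  set X := φ.freeVars
  -- The indices of the variables and their number must be elements of the machine's domain.
  let b := X.card + 1
  have hb : X.card < b := Nat.lt_succ_self _
  have hin : ∀ (x : WTInstance L) m₀ G, Prepared b X x m₀ →
      HasInput x (Function.update (Function.update m₀ 3 ∅) 4 G) := by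
    intro x m₀ G h σ hσ
    have h3 : σ ≠ 3 := by omega
    have h4 : σ ≠ 4 := by omega
    simpa [h3, h4] using h.1 σ hσ
  obtain ⟨M, c, h1, h2, h3, h4⟩ := exists_guess_machine (WTInstance.enc (L := L)) b
    (R := fun x _ m' => Prepared b X x m') (R' := fun x m m' => (∀ σ < 6, m' σ = m σ) ∧
      team b X x m' 6 = {s | ∃ p ∈ rows x, Row b X x m p s} ∧
      team b X x m' 7 = φ.maxTeam X (team b X x m' 6)) (Acc := Accept b X)
    (Definable.exists_instance (Nat.succ_pos _)) (Computes.prepare hb)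
    (fun x m h => h.2.1)
    ((Computes.evaluate φ subset_rfl hb).restrict (by
      rintro x m ⟨m₀, G, h, -, rfl⟩; exact hin x m₀ G h))
    ((Definable.accept hb).mono (by
      rintro x m ⟨m₀, G, h, -, h', -⟩
      exact (hin x m₀ G h).of_eq (τ := 6) (by norm_num) h'))
  have row_congr : ∀ {x : WTInstance L} {m m' : Mem}, (∀ σ < 6, m' σ = m σ) →
      {s | ∃ p ∈ rows x, Row b X x m p s} = {s | ∃ p ∈ rows x, Row b X x m' p s} := by
    intro x m m' h
    unfold Row
    rw [h 4 (by norm_num), h 5 (by norm_num)]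
  refine ⟨M, c + X.card, ?_, fun u ω => ?_, fun u B hB => h2 u B fun x hx m hm => ?_⟩
  · rintro ⟨w, k⟩
    constructor
    · intro h
      obtain ⟨x, hx, m₀, G, m, hm₀, hG, ⟨a1, a2, a3⟩, hacc⟩ := h3 _ h
      have e := encodeInstance_injective hx
      have hm : HasInput x m := (hin x m₀ G hm₀).of_eq (τ := 6) (by norm_num) a1
      have hbits : Bits (size b x) m := by
        intro a ha i hi
        rw [a1 5 (by norm_num)]
        simpa using hm₀.2.2.1 a ha i hi
      obtain ⟨T, hT, hsat⟩ := Accept.exists_team hm hbits (a2.trans (row_congr a1)) a3 hacc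
      rw [Prod.mk.injEq] at e
      exact ⟨x.n, x.neZero, x.str, e.1.symm, T, hT.trans e.2, hsat⟩
    · rintro ⟨n, hn, str, hw, T, hT, hsat⟩
      obtain rfl : w = encodeStructure L n := hw
      let x : WTInstance L := ⟨n, hn, str, k⟩
      obtain ⟨H, hH⟩ := accept_of_team (x := x) hb hT hsat
      refine h4 x ⟨H, fun m₀ m hm₀ hm => ?_⟩
      obtain ⟨a1, a2, a3⟩ := hm
      refine hH m₀ m hm₀ (fun σ hσ h3 h4 => ?_) ?_ (a2.trans (row_congr a1)) a3
      · rw [a1 σ hσ]; simp [h3, h4]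
      · rw [a1 4 (by norm_num)]; simp
  · exact NTM.Halted.of_le (h1 u ω) (polyBound_mono (Nat.le_add_right c X.card) u.length)
  · subst hx
    refine hm.encard_le.trans (Nat.cast_le.mpr ((Nat.mul_le_mul_right _ ?_).trans (hB x rfl)))
    omega


/-! ## Composition of machines -/

namespace Turing.TM2

open Function

/-- A component of the internal state. -/
structure StateLens (σ σ' : Type) where
  get : σ' → σ
  set : σ → σ' → σ'
  get_set : ∀ a v, get (set a v) = a
  set_set : ∀ a a' v, set a (set a' v) = set a v

variable {K K' : Type} [DecidableEq K] [DecidableEq K'] {Γ : K' → Type} {Λ Λ' σ σ' : Type}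
  (e : K → K') (ℓ : StateLens σ σ') (emb : Λ → Λ') (ex : Option Λ')

/-- A statement of a machine as a statement of a larger machine, which continues at `ex` instead of
halting. -/
def Stmt.embed : Stmt (fun k => Γ (e k)) Λ σ → Stmt Γ Λ' σ'
  | push k f q => push (e k) (fun v => f (ℓ.get v)) q.embed
  | peek k f q => peek (e k) (fun v a => ℓ.set (f (ℓ.get v) a) v) q.embed
  | pop k f q => pop (e k) (fun v a => ℓ.set (f (ℓ.get v) a) v) q.embed
  | load a q => load (fun v => ℓ.set (a (ℓ.get v)) v) q.embed
  | branch p q₁ q₂ => branch (fun v => p (ℓ.get v)) q₁.embed q₂.embed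
  | goto l => goto fun v => emb (l (ℓ.get v))
  | halt => ex.elim halt fun l => goto fun _ => l

/-- The configuration `c'` of the larger machine extends `c`; the other components of the state and
the other stacks are given by `v₀` and `S₀`. -/
structure Extends (v₀ : σ') (S₀ : ∀ k, List (Γ k)) (c : Cfg (fun k => Γ (e k)) Λ σ)
    (c' : Cfg Γ Λ' σ') : Prop where
  l : c'.l = c.l.elim ex fun l => some (emb l)
  var : c'.var = ℓ.set c.var v₀
  stk : ∀ k, c'.stk (e k) = c.stk k
  frame : ∀ k, k ∉ Set.range e → c'.stk k = S₀ k

variable {e ℓ emb ex} {v₀ : σ'} {S₀ : ∀ k, List (Γ k)}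

omit [DecidableEq K] [DecidableEq K'] in
-- With the frame fixed, the large configuration is determined by the small one. Equal successors of
-- the small machine therefore stay equal in the large one.
theorem Extends.unique {c : Cfg (fun k => Γ (e k)) Λ σ} {c₁ c₂ : Cfg Γ Λ' σ'}
    (h₁ : Extends e ℓ emb ex v₀ S₀ c c₁) (h₂ : Extends e ℓ emb ex v₀ S₀ c c₂) : c₁ = c₂ := by
  rcases c₁ with ⟨l₁, v₁, S₁⟩
  rcases c₂ with ⟨l₂, v₂, S₂⟩
  obtain rfl : l₁ = l₂ := h₁.l.trans h₂.l.symm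
  obtain rfl : v₁ = v₂ := h₁.var.trans h₂.var.symm
  obtain rfl : S₁ = S₂ := by
    funext k
    by_cases hk : k ∈ Set.range e
    · obtain ⟨k, rfl⟩ := hk
      exact (h₁.stk k).trans (h₂.stk k).symm
    · exact (h₁.frame k hk).trans (h₂.frame k hk).symm
  rfl

theorem Extends.stepAux (he : Injective e) (q : Stmt (fun k => Γ (e k)) Λ σ) {v : σ} {v' : σ'}
    {S : ∀ k, List (Γ (e k))} {S' : ∀ k, List (Γ k)} (hv : v' = ℓ.set v v₀)
    (hS : ∀ k, S' (e k) = S k) (hS₀ : ∀ k, k ∉ Set.range e → S' k = S₀ k) :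
    Extends e ℓ emb ex v₀ S₀ (TM2.stepAux q v S) (TM2.stepAux (q.embed e ℓ emb ex) v' S') := by
  have upd : ∀ {S : ∀ k, List (Γ (e k))} {S' : ∀ k, List (Γ k)}, (∀ k, S' (e k) = S k) →
      (∀ k, k ∉ Set.range e → S' k = S₀ k) → ∀ k (x : List (Γ (e k))),
      (∀ j, update S' (e k) x (e j) = update S k x j) ∧
      ∀ j, j ∉ Set.range e → update S' (e k) x j = S₀ j := by
    intro S S' hS hS₀ k x
    refine ⟨fun j => ?_, fun j hj => ?_⟩
    · by_cases h : j = k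
      · subst h; simp
      · rw [update_of_ne h, update_of_ne (he.ne h), hS]
    · rw [update_of_ne (by rintro rfl; exact hj ⟨k, rfl⟩), hS₀ j hj]
  subst hv
  induction q generalizing v S S' with
  | push k f q ih =>
    simp only [Stmt.embed, TM2.stepAux, ℓ.get_set, hS]
    exact ih (upd hS hS₀ _ _).1 (upd hS hS₀ _ _).2
  | peek k f q ih =>
    simp only [Stmt.embed, TM2.stepAux, ℓ.get_set, ℓ.set_set, hS]
    exact ih hS hS₀
  | pop k f q ih =>
    simp only [Stmt.embed, TM2.stepAux, ℓ.get_set, ℓ.set_set, hS]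
    exact ih (upd hS hS₀ _ _).1 (upd hS hS₀ _ _).2
  | load a q ih =>
    simp only [Stmt.embed, TM2.stepAux, ℓ.get_set, ℓ.set_set]
    exact ih hS hS₀
  | branch p q₁ q₂ ih₁ ih₂ =>
    simp only [Stmt.embed, TM2.stepAux, ℓ.get_set]
    cases p v
    · exact ih₂ hS hS₀
    · exact ih₁ hS hS₀
  | goto l =>
    simp only [Stmt.embed, TM2.stepAux, ℓ.get_set]
    exact ⟨rfl, rfl, hS, hS₀⟩
  | halt =>
    cases ex
    · exact ⟨rfl, rfl, hS, hS₀⟩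
    · exact ⟨rfl, rfl, hS, hS₀⟩

theorem Extends.step (he : Injective e) {m : Λ → Stmt (fun k => Γ (e k)) Λ σ}
    {m' : Λ' → Stmt Γ Λ' σ'} (hm : ∀ l, m' (emb l) = (m l).embed e ℓ emb ex)
    {c d : Cfg (fun k => Γ (e k)) Λ σ} {c' : Cfg Γ Λ' σ'} (h : Extends e ℓ emb ex v₀ S₀ c c')
    (hd : TM2.step m c = some d) :
    ∃ d', TM2.step m' c' = some d' ∧ Extends e ℓ emb ex v₀ S₀ d d' := by
  rcases c with ⟨_ | l, v, S⟩
  · cases hd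
  · rcases c' with ⟨l', v', S'⟩
    obtain rfl : l' = some (emb l) := h.l
    refine ⟨_, rfl, ?_⟩
    rw [TM2.step, Option.some.injEq] at hd
    rw [← hd, hm]
    exact Extends.stepAux he _ h.var h.stk h.frame

/-! ### The length of stacks -/

/-- The number of pushes in a statement. -/
def Stmt.pushes {Γ : K → Type} : Stmt Γ Λ σ → ℕ
  | push _ _ q => q.pushes + 1
  | peek _ _ q => q.pushes
  | pop _ _ q => q.pushes
  | load _ q => q.pushes
  | branch _ q₁ q₂ => q₁.pushes + q₂.pushes
  | goto _ => 0
  | halt => 0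

theorem length_stepAux_le {Γ : K → Type} (q : Stmt Γ Λ σ) (v : σ) (S : ∀ k, List (Γ k)) (k : K) :
    ((TM2.stepAux q v S).stk k).length ≤ (S k).length + q.pushes := by
  induction q generalizing v S with
  | push j f q ih =>
    refine (ih _ _).trans ?_
    by_cases h : k = j
    · subst h
      simp only [update_self, List.length_cons, Stmt.pushes]
      omega
    · simp only [update_of_ne h, Stmt.pushes]
      omega
  | peek j f q ih => exact ih _ _
  | pop j f q ih =>
    refine (ih _ _).trans ?_
    by_cases h : k = j
    · subst h; simp [Stmt.pushes]
    · simp [Stmt.pushes, h]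
  | load a q ih => exact ih _ _
  | branch p q₁ q₂ ih₁ ih₂ =>
    simp only [TM2.stepAux, Stmt.pushes]
    cases p v
    · exact (ih₂ _ _).trans (by omega)
    · exact (ih₁ _ _).trans (by omega)
  | goto l => simp [Stmt.pushes]
  | halt => simp [Stmt.pushes]

theorem length_step_le {Γ : K → Type} {m : Λ → Stmt Γ Λ σ} {C : ℕ} (hC : ∀ l, (m l).pushes ≤ C)
    {c d : Cfg Γ Λ σ} (h : TM2.step m c = some d) (k : K) :
    (d.stk k).length ≤ (c.stk k).length + C := by
  rcases c with ⟨_ | l, v, S⟩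
  · cases h
  · rw [TM2.step, Option.some.injEq] at h
    rw [← h]
    exact (length_stepAux_le _ _ _ _).trans (Nat.add_le_add_left (hC l) _)

end Turing.TM2

/-- The first configurations of a terminating computation. -/
theorem StateTransition.exists_iterate {τ : Type} {f : τ → Option τ} {a z : τ} {n : ℕ}
    (h : (flip bind f)^[n] (some a) = some z) : ∃ c : ℕ → τ, c 0 = a ∧ c n = z ∧
      ∀ i < n, f (c i) = some (c (i + 1)) := by
  induction n generalizing a with
  | zero =>
    have : a = z := by simpa using h
    exact ⟨fun _ => a, rfl, this, fun i hi => absurd hi (Nat.not_lt_zero i)⟩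
  | succ n ih =>
    rw [Function.iterate_succ_apply] at h
    have hs : flip bind f (some a) = f a := rfl
    rw [hs] at h
    cases hfa : f a with
    | none =>
      have hnone : ∀ j, (flip bind f)^[j] none = none := by
        intro j
        induction j with
        | zero => rfl
        | succ j ih => rw [Function.iterate_succ_apply]; exact ih
      rw [hfa, hnone] at h
      cases h
    | some b =>
      rw [hfa] at h
      obtain ⟨c, h0, hn, hc⟩ := ih h
      refine ⟨fun i => Nat.casesOn i a c, rfl, hn, fun i hi => ?_⟩
      rcases i with _ | i
      · change f a = some (c 0)
        rw [h0, hfa]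
      · exact hc i (by omega)


/-! ### The composite machine and the transfer between its parts -/

namespace NTM

open Turing Function

variable {α β : Type} (tm : FinTM2) (hΓ : ∀ k, Finite (tm.Γ k)) (inp : tm.Γ tm.k₀ ≃ α)
  (out : tm.Γ tm.k₁ ≃ Option β) (M : NTM (Option β))

/-- The stacks of the composition: those of the two machines and an auxiliary one. -/
abbrev CompΓ : tm.K ⊕ (M.K ⊕ Unit) → Type :=
  Sum.elim tm.Γ (Sum.elim M.Γ fun _ => Option β)

/-- The labels of the composition: those of the two machines and two for the transfer. -/
abbrev CompLabel : Type := tm.Λ ⊕ (Bool ⊕ M.Λ)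

/-- The state of the composition: the states of the two machines and a register. -/
abbrev CompState : Type := tm.σ × (M.σ × Option (Option β))

/-- The state of the first machine. -/
def compFst : TM2.StateLens tm.σ (CompState (β := β) tm M) where
  get v := v.1
  set a v := (a, v.2)
  get_set _ _ := rfl
  set_set _ _ _ := rfl

/-- The state of the second machine. -/
def compSnd : TM2.StateLens M.σ (CompState (β := β) tm M) where
  get v := v.2.1
  set a v := (v.1, a, v.2.2)
  get_set _ _ := rfl
  set_set _ _ _ := rfl

/-- The program of the composition, for a program `m` of the second machine. -/
def compCode (m : M.Λ → TM2.Stmt M.Γ M.Λ M.σ) :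
    CompLabel tm M → TM2.Stmt (CompΓ tm M) (CompLabel tm M) (CompState tm M)
  | .inl l => TM2.Stmt.embed (K := tm.K) (Γ := CompΓ tm M) Sum.inl (compFst tm M) Sum.inl
      (some (.inr (.inl false))) (tm.m l)
  | .inr (.inl false) =>
    .pop (.inl tm.k₁) (fun v a => (v.1, v.2.1, a.map out))
      (.branch (fun v => v.2.2.isSome)
        (.push (.inr (.inr ())) (fun v => v.2.2.getD none) (.goto fun _ => .inr (.inl false)))
        (.goto fun _ => .inr (.inl true)))
  | .inr (.inl true) =>
    .pop (.inr (.inr ())) (fun v a => (v.1, v.2.1, a))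
      (.branch (fun v => v.2.2.isSome)
        (.push (.inr (.inl M.k₀)) (fun v => M.inputAlphabet.symm (v.2.2.getD none))
          (.goto fun _ => .inr (.inl true)))
        (.goto fun _ => .inr (.inr M.main)))
  | .inr (.inr l) => TM2.Stmt.embed (K := M.K) (Γ := CompΓ tm M) (fun k => Sum.inr (Sum.inl k))
      (compSnd tm M) (fun l => Sum.inr (Sum.inr l)) none (m l)

/-- The machine that applies `M` to the output of the deterministic machine `tm`. -/
noncomputable def comp : NTM α where
  K := tm.K ⊕ (M.K ⊕ Unit)
  kDecidableEq := @instDecidableEqSum _ _ tm.kDecidableEq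
    (@instDecidableEqSum _ _ M.kDecidableEq inferInstance)
  kFin := @instFintypeSum _ _ tm.kFin (@instFintypeSum _ _ M.kFin inferInstance)
  k₀ := .inl tm.k₀
  k₁ := .inl tm.k₀
  Γ := CompΓ tm M
  Λ := CompLabel tm M
  main := .inl tm.main
  ΛFin := @instFintypeSum _ _ tm.ΛFin (@instFintypeSum _ _ inferInstance M.ΛFin)
  σ := CompState tm M
  initialState := (tm.initialState, M.initialState, none)
  σFin :=
    -- The register holds symbols over `β`, whose finiteness comes from the output stack of the
    -- first machine.
    have := tm.σFin
    have := M.σFin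
    have := hΓ tm.k₁
    have : Finite (Option β) := Finite.of_equiv _ out
    Fintype.ofFinite _
  Γk₀Fin := tm.Γk₀Fin
  m := compCode tm out M M.m
  m' := compCode tm out M M.m'
  finite_stack_alphabet := by
    have := hΓ tm.k₁
    have : Finite (Option β) := Finite.of_equiv _ out
    rintro (k | k | k)
    · exact hΓ k
    · exact M.finite_stack_alphabet k
    · exact this
  inputAlphabet := inp
  accept := fun v => M.accept v.2.1

/-- Configurations of the composition. -/
abbrev CompCfg : Type := TM2.Cfg (CompΓ tm M) (CompLabel tm M) (CompState tm M)

variable {tm M}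

/-- The stacks of the composition. -/
def compStacks (f : ∀ k, List (tm.Γ k)) (g : ∀ k, List (M.Γ k)) (a : List (Option β)) :
    ∀ k, List (CompΓ tm M k)
  | .inl k => f k
  | .inr (.inl k) => g k
  | .inr (.inr ()) => a

section

variable (f : ∀ k, List (tm.Γ k)) (g : ∀ k, List (M.Γ k)) (a : List (Option β))

theorem update_compStacks_inl (k : tm.K) (x : List (CompΓ tm M (.inl k))) :
    update (β := fun k => List (CompΓ tm M k)) (compStacks f g a) (.inl k) x =
      compStacks (update (β := fun k => List (tm.Γ k)) f k x) g a := by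
  funext j
  rcases j with j | j | j
  · by_cases h : j = k
    · subst h
      exact (update_self (β := fun k => List (CompΓ tm M k)) _ _ _).trans
        (update_self (β := fun k => List (tm.Γ k)) _ _ _).symm
    · exact (update_of_ne (β := fun k => List (CompΓ tm M k)) (fun e => h (Sum.inl.inj e)) _ _).trans
        (update_of_ne (β := fun k => List (tm.Γ k)) h _ _).symm
  · exact update_of_ne (β := fun k => List (CompΓ tm M k)) Sum.inr_ne_inl _ _
  · exact update_of_ne (β := fun k => List (CompΓ tm M k)) Sum.inr_ne_inl _ _

theorem update_compStacks_inr (k : M.K) (x : List (CompΓ tm M (.inr (.inl k)))) :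
    update (β := fun k => List (CompΓ tm M k)) (compStacks f g a) (.inr (.inl k)) x =
      compStacks f (update (β := fun k => List (M.Γ k)) g k x) a := by
  funext j
  rcases j with j | j | j
  · exact update_of_ne (β := fun k => List (CompΓ tm M k)) Sum.inl_ne_inr _ _
  · by_cases h : j = k
    · subst h
      exact (update_self (β := fun k => List (CompΓ tm M k)) _ _ _).trans
        (update_self (β := fun k => List (M.Γ k)) _ _ _).symm
    · exact (update_of_ne (β := fun k => List (CompΓ tm M k))
        (fun e => h (Sum.inl.inj (Sum.inr.inj e))) _ _).trans
        (update_of_ne (β := fun k => List (M.Γ k)) h _ _).symm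
  · exact update_of_ne (β := fun k => List (CompΓ tm M k))
      (fun e => Sum.inr_ne_inl (Sum.inr.inj e)) _ _

theorem update_compStacks_aux (x : List (CompΓ tm M (.inr (.inr ())))) :
    update (β := fun k => List (CompΓ tm M k)) (compStacks f g a) (.inr (.inr ())) x =
      compStacks f g x := by
  funext j
  rcases j with j | j | j
  · exact update_of_ne (β := fun k => List (CompΓ tm M k)) Sum.inl_ne_inr _ _
  · exact update_of_ne (β := fun k => List (CompΓ tm M k))
      (fun e => Sum.inl_ne_inr (Sum.inr.inj e)) _ _
  · exact update_self (β := fun k => List (CompΓ tm M k)) _ _ _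

end

theorem comp_step_eq (b : Bool) (c : CompCfg tm M) :
    @Eq (Option (CompCfg tm M)) ((comp tm hΓ inp out M).step b c)
      (TM2.step (Γ := CompΓ tm M) (compCode tm out M (if b then M.m' else M.m)) c) := by
  cases b <;> rfl

/-- Only the second machine makes nondeterministic steps. -/
theorem not_branching_comp {c : CompCfg tm M} (h : ∀ l, c.l ≠ some (.inr (.inr l))) :
    ¬ (comp tm hΓ inp out M).Branching c := by
  rcases c with ⟨_ | l | b | l, v, S⟩
  · exact not_not.mpr rfl
  · exact not_not.mpr rfl
  · cases b <;> exact not_not.mpr rfl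
  · exact absurd rfl (h l)

section Transfer

variable {w : List α} {ω : ℕ → Bool}

theorem run_succ {M : NTM α} {t : ℕ} {d : M.toFinTM2.Cfg}
    (h : M.step (ω t) (M.run w ω t) = some d) : M.run w ω (t + 1) = d := by
  rw [run, h]; rfl

variable (v₁ : tm.σ) (v₂ : M.σ) (r : Option (Option β))

/-- The output of the first machine is moved to the auxiliary stack. -/
theorem comp_transfer_out (l : List (tm.Γ tm.k₁)) (f : ∀ k, List (tm.Γ k))
    (g : ∀ k, List (M.Γ k)) (a : List (Option β)) (hf : f tm.k₁ = l) {t : ℕ}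
    (hc : (comp tm hΓ inp out M).run w ω t =
      (⟨some (.inr (.inl false)), (v₁, v₂, r), compStacks f g a⟩ : CompCfg tm M)) :
    (comp tm hΓ inp out M).run w ω (t + (l.length + 1)) = (⟨some (.inr (.inl true)),
        (v₁, v₂, none), compStacks (update f tm.k₁ []) g ((l.map out).reverse ++ a)⟩ :
          CompCfg tm M) ∧
      ∀ u, t ≤ u → u < t + (l.length + 1) →
        ¬ (comp tm hΓ inp out M).Branching ((comp tm hΓ inp out M).run w ω u) := by
  have no : ¬ (comp tm hΓ inp out M).Branching ((comp tm hΓ inp out M).run w ω t) := by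
    rw [hc]
    exact not_branching_comp hΓ inp out fun l h => nomatch h
  induction l generalizing t f a r with
  | nil =>
    refine ⟨run_succ ?_, fun u h1 h2 => ?_⟩
    · rw [hc, comp_step_eq]
      have hf : compStacks f g a (.inl tm.k₁) = [] := hf
      simp only [TM2.step, compCode, TM2.stepAux, hf, update_compStacks_inl]
      rfl
    · obtain rfl : u = t := by simp only [List.length_nil] at h2; omega
      exact no
  | cons x l ih =>
    have h1 : (comp tm hΓ inp out M).run w ω (t + 1) = (⟨some (.inr (.inl false)),
        (v₁, v₂, some (out x)), compStacks (update f tm.k₁ l) g (out x :: a)⟩ :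
          CompCfg tm M) := by
      refine run_succ ?_
      rw [hc, comp_step_eq]
      have hf : compStacks f g a (.inl tm.k₁) = x :: l := hf
      simp only [TM2.step, compCode, TM2.stepAux, hf, update_compStacks_inl]
      exact congrArg (fun S => some (⟨_, _, S⟩ : CompCfg tm M)) (update_compStacks_aux _ _ _ _)
    obtain ⟨h2, h3⟩ := ih _ _ _ (update_self _ _ _) h1 (by
      rw [h1]
      exact not_branching_comp hΓ inp out fun l h => nomatch h)
    rw [update_idem] at h2
    refine ⟨?_, fun u h4 h5 => ?_⟩
    · rw [List.length_cons, show t + (l.length + 1 + 1) = t + 1 + (l.length + 1) by ring, h2]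
      simp only [List.map_cons, List.reverse_cons, List.append_assoc, List.singleton_append]
      rfl
    · rcases h4.eq_or_lt with rfl | h4
      · exact no
      · exact h3 u h4 (by simp only [List.length_cons] at h5; omega)

/-- The auxiliary stack is moved to the input stack of the second machine. -/
theorem comp_transfer_in (f : ∀ k, List (tm.Γ k)) (g : ∀ k, List (M.Γ k)) (a : List (Option β))
    {t : ℕ} (hc : (comp tm hΓ inp out M).run w ω t =
      (⟨some (.inr (.inl true)), (v₁, v₂, r), compStacks f g a⟩ : CompCfg tm M)) :
    (comp tm hΓ inp out M).run w ω (t + (a.length + 1)) = (⟨some (.inr (.inr M.main)),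
        (v₁, v₂, none), compStacks f
          (update g M.k₀ ((a.map M.inputAlphabet.symm).reverse ++ g M.k₀)) []⟩ :
          CompCfg tm M) ∧
      ∀ u, t ≤ u → u < t + (a.length + 1) →
        ¬ (comp tm hΓ inp out M).Branching ((comp tm hΓ inp out M).run w ω u) := by
  have no : ¬ (comp tm hΓ inp out M).Branching ((comp tm hΓ inp out M).run w ω t) := by
    rw [hc]
    exact not_branching_comp hΓ inp out fun l h => nomatch h
  induction a generalizing t g r with
  | nil =>
    refine ⟨run_succ ?_, fun u h1 h2 => ?_⟩
    · rw [hc, comp_step_eq]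
      simp only [List.map_nil, List.reverse_nil, List.nil_append, update_eq_self]
      exact congrArg (fun S => some (⟨_, _, S⟩ : CompCfg tm M)) (update_compStacks_aux _ _ _ _)
    · obtain rfl : u = t := by simp only [List.length_nil] at h2; omega
      exact no
  | cons x a ih =>
    have h1 : (comp tm hΓ inp out M).run w ω (t + 1) = (⟨some (.inr (.inl true)),
        (v₁, v₂, some x), compStacks f
          (update g M.k₀ (M.inputAlphabet.symm x :: g M.k₀)) a⟩ : CompCfg tm M) := by
      refine run_succ ?_
      rw [hc, comp_step_eq]
      refine congrArg (fun S => some (⟨_, _, S⟩ : CompCfg tm M)) ?_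
      exact (congrArg (fun S => update S _ _) (update_compStacks_aux _ _ _ a)).trans
        (update_compStacks_inr _ _ _ _ _)
    obtain ⟨h2, h3⟩ := ih _ _ h1 (by
      rw [h1]
      exact not_branching_comp hΓ inp out fun l h => nomatch h)
    rw [update_idem, update_self] at h2
    refine ⟨?_, fun u h4 h5 => ?_⟩
    · rw [List.length_cons, show t + (a.length + 1 + 1) = t + 1 + (a.length + 1) by ring, h2]
      simp only [List.map_cons, List.reverse_cons, List.append_assoc, List.singleton_append]
      rfl
    · rcases h4.eq_or_lt with rfl | h4
      · exact no
      · exact h3 u h4 (by simp only [List.length_cons] at h5; omega)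

end Transfer

end NTM


/-! ### Initial and final configurations, and the length of the output -/

namespace Turing

theorem initList_stk_self (tm : FinTM2) (s : List (tm.Γ tm.k₀)) :
    TM2.Cfg.stk (initList tm s) tm.k₀ = s := by
  simp [initList]

theorem initList_stk_of_ne (tm : FinTM2) (s : List (tm.Γ tm.k₀)) {k : tm.K} (h : k ≠ tm.k₀) :
    TM2.Cfg.stk (initList tm s) k = [] := by
  simp [initList, h]

theorem length_initList_stk_le (tm : FinTM2) (s : List (tm.Γ tm.k₀)) (k : tm.K) :
    (TM2.Cfg.stk (initList tm s) k).length ≤ s.length := by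
  by_cases h : k = tm.k₀
  · subst h
    rw [initList_stk_self]
  · rw [initList_stk_of_ne _ _ h]
    exact Nat.zero_le _

theorem haltList_stk_self (tm : FinTM2) (s : List (tm.Γ tm.k₁)) :
    TM2.Cfg.stk (haltList tm s) tm.k₁ = s := by
  simp [haltList]

/-- The output of a machine is longer than its input by at most a constant in each step. -/
theorem exists_length_output_le (tm : FinTM2) : ∃ C : ℕ, ∀ (s : List (tm.Γ tm.k₀))
    (l : List (tm.Γ tm.k₁)) (T : ℕ), Nonempty (TM2OutputsInTime tm s (some l) T) →
      l.length ≤ s.length + C * T := by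
  classical
  have := tm.ΛFin
  obtain ⟨C, hC⟩ : ∃ C, ∀ l, (tm.m l).pushes ≤ C :=
    ⟨Finset.univ.sup fun l => (tm.m l).pushes,
      fun l => Finset.le_sup (f := fun l => (tm.m l).pushes) (Finset.mem_univ l)⟩
  refine ⟨C, fun s l T ⟨h⟩ => ?_⟩
  obtain ⟨c, h0, hn, hc⟩ := StateTransition.exists_iterate h.evals_in_steps
  have key : ∀ i ≤ h.steps, (TM2.Cfg.stk (c i) tm.k₁).length ≤ s.length + C * i := by
    intro i
    induction i with
    | zero =>
      intro _
      rw [h0]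
      exact length_initList_stk_le tm s _
    | succ i ih =>
      intro hi
      refine (TM2.length_step_le hC (hc i hi) tm.k₁).trans ?_
      have := ih (Nat.le_of_succ_le hi)
      rw [Nat.mul_succ]
      omega
  have := key _ le_rfl
  rw [hn, haltList_stk_self] at this
  exact this.trans (Nat.add_le_add_left (Nat.mul_le_mul_left _ h.steps_le_m) _)

end Turing

/-! ### Runs of the composite machine -/

namespace NTM

open Turing Function

variable {α β : Type} {tm : FinTM2} (hΓ : ∀ k, Finite (tm.Γ k)) (inp : tm.Γ tm.k₀ ≃ α)
  (out : tm.Γ tm.k₁ ≃ Option β) {M : NTM (Option β)}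

theorem comp_extends_fst {w : List α} {ω : ℕ → Bool} {c : ℕ → tm.Cfg} {n : ℕ}
    (h0 : c 0 = initList tm (w.map inp.symm)) (hc : ∀ i < n, tm.step (c i) = some (c (i + 1)))
    {i : ℕ} (hi : i ≤ n) :
    TM2.Extends (Γ := CompΓ tm M) Sum.inl (compFst tm M) Sum.inl (some (.inr (.inl false)))
      (tm.initialState, M.initialState, none) (fun _ => []) (c i)
      ((comp tm hΓ inp out M).run w ω i) := by
  induction i with
  | zero =>
    rw [h0]
    refine ⟨rfl, rfl, fun k => ?_, fun k hk => ?_⟩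
    · by_cases h : k = tm.k₀
      · subst h
        rw [initList_stk_self]
        exact initList_stk_self (comp tm hΓ inp out M).toFinTM2 _
      · rw [initList_stk_of_ne _ _ h]
        exact initList_stk_of_ne (comp tm hΓ inp out M).toFinTM2 _ fun e => h (Sum.inl.inj e)
    · exact initList_stk_of_ne (comp tm hΓ inp out M).toFinTM2 _ fun e => hk ⟨_, e.symm⟩
  | succ i ih =>
    obtain ⟨d, hd, h⟩ := TM2.Extends.step (m' := compCode tm out M (if ω i then M.m' else M.m))
      Sum.inl_injective (fun _ => rfl) (ih (Nat.le_of_succ_le hi)) (hc i hi)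
    rwa [run_succ ((comp_step_eq hΓ inp out (ω i) _).trans hd)]

/-- Halting is treated along with ordinary steps, so that the simulation persists for all times. -/
theorem comp_step_extends_snd {v₀ : CompState tm M} {S₀ : ∀ k, List (CompΓ tm M k)}
    {c : M.toFinTM2.Cfg} {c' : CompCfg tm M}
    (h : TM2.Extends (Γ := CompΓ tm M) (fun k => .inr (.inl k)) (compSnd tm M)
      (fun l => .inr (.inr l)) none v₀ S₀ c c') (b : Bool) :
    (M.step b c = none ∧ (comp tm hΓ inp out M).step b c' = none) ∨
    ∃ d d', M.step b c = some d ∧ (comp tm hΓ inp out M).step b c' = some d' ∧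
      TM2.Extends (Γ := CompΓ tm M) (fun k => .inr (.inl k)) (compSnd tm M)
        (fun l => .inr (.inr l)) none v₀ S₀ d d' := by
  cases hd : M.step b c with
  | some d =>
    obtain ⟨d', hd', h'⟩ := TM2.Extends.step (m' := compCode tm out M (if b then M.m' else M.m))
      (fun _ _ e => Sum.inl.inj (Sum.inr.inj e)) (fun _ => rfl) h hd
    exact .inr ⟨d, d', rfl, (comp_step_eq hΓ inp out b _).trans hd', h'⟩
  | none =>
    refine .inl ⟨rfl, ?_⟩
    rcases c with ⟨_ | l, v, S⟩
    · rcases c' with ⟨l', v', S'⟩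
      obtain rfl : l' = none := h.l
      rfl
    · cases hd

theorem comp_extends_snd {w : List α} {u : List (Option β)} {ω : ℕ → Bool} {T : ℕ}
    {v₀ : CompState tm M} {S₀ : ∀ k, List (CompΓ tm M k)}
    (h : TM2.Extends (Γ := CompΓ tm M) (fun k => .inr (.inl k)) (compSnd tm M)
      (fun l => .inr (.inr l)) none v₀ S₀ (M.run u (fun s => ω (T + s)) 0)
      ((comp tm hΓ inp out M).run w ω T)) (t : ℕ) :
    TM2.Extends (Γ := CompΓ tm M) (fun k => .inr (.inl k)) (compSnd tm M)
      (fun l => .inr (.inr l)) none v₀ S₀ (M.run u (fun s => ω (T + s)) t)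
      ((comp tm hΓ inp out M).run w ω (T + t)) := by
  induction t with
  | zero => exact h
  | succ t ih =>
    rw [← Nat.add_assoc, run, run]
    rcases comp_step_extends_snd hΓ inp out ih (ω (T + t)) with ⟨h1, h2⟩ | ⟨d, d', h1, h2, h3⟩
    · rw [h1, h2]
      exact ih
    · rw [h1, h2]
      exact h3

/-- If both choices gave the same result in `M`, the two successors in the composition would extend
the same configuration and coincide by `Extends.unique`. -/
theorem Branching.of_comp {v₀ : CompState tm M} {S₀ : ∀ k, List (CompΓ tm M k)}
    {c : M.toFinTM2.Cfg} {c' : CompCfg tm M}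
    (h : TM2.Extends (Γ := CompΓ tm M) (fun k => .inr (.inl k)) (compSnd tm M)
      (fun l => .inr (.inr l)) none v₀ S₀ c c')
    (hb : (comp tm hΓ inp out M).Branching c') : M.Branching c := by
  intro he
  refine hb ?_
  rcases comp_step_extends_snd hΓ inp out h false with ⟨h1, h2⟩ | ⟨d, d', h1, h2, h3⟩ <;>
    rcases comp_step_extends_snd hΓ inp out h true with ⟨h4, h5⟩ | ⟨e, e', h4, h5, h6⟩
  · rw [h2, h5]
  · rw [h1, h4] at he; cases he
  · rw [h1, h4] at he; cases he
  · rw [h1, h4] at he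
    cases he
    rw [h2, h5]
    exact congrArg some (h3.unique h6)

/-- The run of the composition: after a deterministic phase of length `T₀` it simulates the second
machine on the output of the first one. -/
theorem exists_comp_run {w : List α} {u : List (Option β)} {T : ℕ}
    (h : Nonempty (TM2OutputsInTime tm (w.map inp.symm) (some (u.map out.symm)) T)) :
    ∃ T₀ ≤ T + 2 * (u.length + 1), ∀ ω : ℕ → Bool,
      (∀ t < T₀, ¬ (comp tm hΓ inp out M).Branching ((comp tm hΓ inp out M).run w ω t)) ∧
      ∃ v₀ S₀, ∀ t, TM2.Extends (Γ := CompΓ tm M) (fun k => .inr (.inl k)) (compSnd tm M)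
        (fun l => .inr (.inr l)) none v₀ S₀ (M.run u (fun s => ω (T₀ + s)) t)
        ((comp tm hΓ inp out M).run w ω (T₀ + t)) := by
  obtain ⟨h⟩ := h
  obtain ⟨c, h0, hn, hc⟩ := StateTransition.exists_iterate h.evals_in_steps
  -- Each of the two transfers takes one step per symbol and one to notice the empty stack. Two
  -- transfers are made because each of them reverses the word.
  refine ⟨h.steps + (u.length + 1) + (u.length + 1), by have := h.steps_le_m; omega,
    fun ω => ?_⟩
  have h1 := fun i hi => comp_extends_fst hΓ inp out (M := M) (w := w) (ω := ω) h0 hc (i := i) hi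
  have e1 : (comp tm hΓ inp out M).run w ω h.steps = (⟨some (.inr (.inl false)),
      (tm.initialState, M.initialState, none),
      compStacks (TM2.Cfg.stk (haltList tm (u.map out.symm))) (fun _ => []) []⟩ :
        CompCfg tm M) := by
    have := h1 _ le_rfl
    rw [hn] at this
    refine this.unique ⟨rfl, rfl, fun k => rfl, fun k hk => ?_⟩
    rcases k with k | k | k
    · exact absurd ⟨k, rfl⟩ hk
    · rfl
    · rfl
  obtain ⟨e2, b2⟩ := comp_transfer_out hΓ inp out _ _ _ _ _ _ _ (haltList_stk_self _ _) e1
  rw [List.length_map] at e2 b2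
  obtain ⟨e3, b3⟩ := comp_transfer_in hΓ inp out _ _ _ _ _ _ e2
  simp only [List.append_nil, List.map_map, List.length_reverse,
    Equiv.self_comp_symm, List.map_id, List.map_reverse, List.reverse_reverse] at e3 b3
  refine ⟨fun t ht => ?_, (tm.initialState, M.initialState, none),
    compStacks (update (TM2.Cfg.stk (haltList tm (u.map out.symm))) tm.k₁ []) (fun _ => []) [],
    comp_extends_snd hΓ inp out ?_⟩
  · by_cases t1 : t < h.steps
    · have := h1 t t1.le
      refine not_branching_comp hΓ inp out fun l hl => ?_
      rw [this.l] at hl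
      cases hcl : (c t).l <;> rw [hcl] at hl <;> cases hl
    · by_cases t2 : t < h.steps + (u.length + 1)
      · exact b2 t (not_lt.mp t1) t2
      · exact b3 t (not_lt.mp t2) ht
  · rw [e3]
    refine ⟨rfl, rfl, fun k => ?_, fun k hk => ?_⟩
    · change update (β := fun k => List (M.Γ k)) (fun _ => []) M.k₀
        (u.map M.inputAlphabet.symm) k =
          TM2.Cfg.stk (initList M.toFinTM2 (u.map M.inputAlphabet.symm)) k
      by_cases h : k = M.k₀
      · subst h
        rw [initList_stk_self, update_self]
      · rw [initList_stk_of_ne _ _ h, update_of_ne h]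
    · rcases k with k | k | k
      · rfl
      · exact absurd ⟨k, rfl⟩ hk
      · rfl

/-- The composition of a deterministic machine with a nondeterministic one. -/
theorem exists_comp {tm : FinTM2} (hΓ : ∀ k, Finite (tm.Γ k)) (inp : tm.Γ tm.k₀ ≃ α)
    (out : tm.Γ tm.k₁ ≃ Option β) (M : NTM (Option β)) : ∃ N : NTM α,
    ∀ (w : List α) (u : List (Option β)) (T : ℕ),
      Nonempty (TM2OutputsInTime tm (w.map inp.symm) (some (u.map out.symm)) T) →
      (N.Accepts w ↔ M.Accepts u) ∧
      (∀ T', M.HaltsWithin u T' → N.HaltsWithin w (T + 2 * (u.length + 1) + T')) ∧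
      ∀ B, M.NondetStepsWithin u B → N.NondetStepsWithin w B := by
  refine ⟨comp tm hΓ inp out M, fun w u T h => ?_⟩
  obtain ⟨T₀, hT₀, hrun⟩ := exists_comp_run hΓ inp out (M := M) h
  have halted : ∀ ω t, (comp tm hΓ inp out M).Halted ((comp tm hΓ inp out M).run w ω (T₀ + t)) ↔
      M.Halted (M.run u (fun s => ω (T₀ + s)) t) := by
    intro ω t
    obtain ⟨v₀, S₀, hx⟩ := (hrun ω).2
    unfold NTM.Halted
    have := (hx t).l
    rw [show TM2.Cfg.l ((comp tm hΓ inp out M).run w ω (T₀ + t)) = _ from this]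
    cases TM2.Cfg.l (M.run u (fun s => ω (T₀ + s)) t) <;> simp
  have accept : ∀ ω t, (comp tm hΓ inp out M).accept
      (TM2.Cfg.var ((comp tm hΓ inp out M).run w ω (T₀ + t))) =
      M.accept (TM2.Cfg.var (M.run u (fun s => ω (T₀ + s)) t)) := by
    intro ω t
    obtain ⟨v₀, S₀, hx⟩ := (hrun ω).2
    exact congrArg (comp tm hΓ inp out M).accept (hx t).var
  refine ⟨⟨?_, ?_⟩, ?_, ?_⟩
  · rintro ⟨ω, t, ht, ha⟩
    have e := NTM.Halted.run_eq ht (Nat.le_add_left t T₀)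
    rw [← e] at ht ha
    exact ⟨_, t, (halted ω t).1 ht, (accept ω t).symm.trans ha⟩
  · rintro ⟨ω, t, ht, ha⟩
    -- The choices before time `T₀` are irrelevant, so those for `M` are delayed by `T₀`.
    have e : (fun s => (fun r => ω (r - T₀)) (T₀ + s)) = ω := by
      funext s
      simp
    refine ⟨fun r => ω (r - T₀), T₀ + t, (halted _ _).2 ?_, (accept _ _).trans ?_⟩
    · rw [e]; exact ht
    · rw [e]; exact ha
  · intro T' hT' ω
    exact NTM.Halted.of_le ((halted ω T').2 (hT' _)) (by omega)
  · intro B hB ω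
    obtain ⟨hd, v₀, S₀, hx⟩ := hrun ω
    refine le_trans ?_ (hB fun s => ω (T₀ + s))
    refine le_trans (Set.encard_le_encard ?_) (Set.encard_image_le (fun s => T₀ + s) _)
    intro t ht
    have h1 : T₀ ≤ t := not_lt.mp fun h1 => hd t h1 ht
    obtain ⟨s, rfl⟩ := Nat.exists_eq_add_of_le h1
    exact ⟨s, Branching.of_comp hΓ inp out (hx s) ht, rfl⟩

end NTM


/-! ## Resource bounds -/

namespace Computable

variable {f g : ℕ → ℕ}

theorem natAdd (hf : Computable f) (hg : Computable g) : Computable fun k => f k + g k :=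
  Primrec.nat_add.to_comp.comp hf hg

theorem natMul (hf : Computable f) (hg : Computable g) : Computable fun k => f k * g k :=
  Primrec.nat_mul.to_comp.comp hf hg

theorem natPow (hf : Computable f) (c : ℕ) : Computable fun k => f k ^ c := by
  induction c with
  | zero => exact Computable.const 1
  | succ c ih => exact ih.natMul hf

end Computable

/-- With `l = log 2 (m + 2)`, the estimates `G ≤ 2 ^ G` and `m + 1 ≤ 2 ^ (l + 1)` give the exponent
`G + (l + 1) * d`. The shift by `2` ensures `1 ≤ l`, which absorbs the additive terms. -/
theorem clog_le_of_le_mul_pow {n G m d : ℕ} (h : n ≤ G * (m + 1) ^ d) :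
    Nat.clog 2 n ≤ (G + 2 * d) * Nat.log 2 (m + 2) := by
  have h1 : 1 ≤ Nat.log 2 (m + 2) := Nat.log_pos (by norm_num) (by omega)
  have h2 : m + 1 ≤ 2 ^ (Nat.log 2 (m + 2) + 1) :=
    (Nat.le_succ _).trans (Nat.lt_pow_succ_log_self (by norm_num) (m + 2)).le
  have h3 : n ≤ 2 ^ (G + (Nat.log 2 (m + 2) + 1) * d) := by
    rw [pow_add, pow_mul]
    exact h.trans (Nat.mul_le_mul Nat.lt_two_pow_self.le (Nat.pow_le_pow_left h2 d))
  refine (Nat.clog_le_of_le_pow h3).trans ?_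
  generalize Nat.log 2 (m + 2) = l at *
  nlinarith [Nat.mul_le_mul_left G h1, Nat.mul_le_mul_left d h1]

theorem length_encodeInstance {α : Type} (x : List α) (k : ℕ) :
    (encodeInstance (x, k)).length = x.length + k := by
  simp [encodeInstance]

/-! ### Membership in W[P] and closure under fpt-reductions -/

section

variable {L : FirstOrder.Language.{0, 0}} [FinEnum (Σ r, L.Functions r)]
  [FinEnum (Σ r, L.Relations r)]

theorem size_le_length_encodeStructure (n : ℕ) [L.Structure (Fin n)] :
    n ≤ (encodeStructure L n).length := by
  simp only [encodeStructure, List.length_append, List.length_replicate]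
  omega

theorem clog_size_le {w : List Bool} {k G m d : ℕ} (h : w.length ≤ G * (m + 1) ^ d)
    (x : WTInstance L) (hx : x.enc = encodeInstance (w, k)) :
    x.k * Nat.clog 2 x.n ≤ k * ((G + 2 * d) * Nat.log 2 (m + 2)) := by
  obtain ⟨h1, h2⟩ := Prod.mk.inj (encodeInstance_injective hx)
  rw [h2]
  refine Nat.mul_le_mul_left _ (clog_le_of_le_mul_pow (le_trans ?_ h))
  rw [← h1]
  exact size_le_length_encodeStructure x.n

theorem pWT_mem_WP (φ : InclusionFormula L) : pWT φ ∈ WP := by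
  obtain ⟨M, c, h1, h2, h3⟩ := exists_pWT_machine φ
  -- The time bound uses `|w| + k + 1 ≤ (k + 1) * (|w| + 1)`; the factor `3` is `G + 2 * d` for `G =
  -- d = 1`.
  refine ⟨M, fun k => c * (k + 1) ^ c, fun k => c * (k * 3), c,
    (Computable.const c).natMul ((Computable.succ).natPow c),
    (Computable.const c).natMul (Computable.id.natMul (Computable.const 3)),
    fun (w : List Bool) k => ⟨h1 (w, k), fun ω => ?_, h3 _ _ fun x hx => ?_⟩⟩
  · refine NTM.Halted.of_le (h2 _ ω) ?_
    change c * ((encodeInstance (α := Bool) (w, k)).length + 1) ^ c ≤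
      c * (k + 1) ^ c * (w.length + 1) ^ c
    rw [length_encodeInstance, mul_assoc, ← mul_pow]
    exact Nat.mul_le_mul_left _ (Nat.pow_le_pow_left (by nlinarith) _)
  · have := clog_size_le (G := 1) (m := List.length w) (d := 1) (by simp) x hx
    rw [mul_assoc, mul_assoc]
    exact Nat.mul_le_mul_left _ this

theorem exists_pWT_machine_poly (φ : InclusionFormula L) :
    ∃ (M : NTM (Option Bool)) (c : ℕ),
      (∀ (w : List Bool) (k : ℕ),
        (M.Accepts (encodeInstance (w, k)) ↔ (w, k) ∈ (pWT φ).lang) ∧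
        M.HaltsWithin (encodeInstance (w, k)) (c * (w.length + k + 1) ^ c)) ∧
      ∀ (n : ℕ) [NeZero n] [L.Structure (Fin n)] (k : ℕ),
        M.NondetStepsWithin (encodeInstance (encodeStructure L n, k)) (c * (k * Nat.clog 2 n)) := by
  obtain ⟨M, c, h1, h2, h3⟩ := exists_pWT_machine φ
  refine ⟨M, c, fun w k => ⟨h1 (w, k), ?_⟩, fun n _ _ k => h3 _ _ fun x hx => ?_⟩
  · have := h2 (encodeInstance (w, k))
    rwa [length_encodeInstance] at this
  · obtain ⟨h4, h5⟩ := Prod.mk.inj (encodeInstance_injective hx)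
    rw [h5, encodeStructure_size_injective h4]

/-- The composite machine guesses only in its second phase, in number at most a constant times `k' *
clog |A'|`. Here `k' ≤ g k`, and `|A'|` is at most the length of the reduction's output, which the
running time of the reduction bounds. -/
theorem mem_WP_of_fptReducible_pWT (φ : InclusionFormula L) {P : ParamProblem}
    (h : FPTReducible P (pWT φ)) : P ∈ WP := by
  obtain ⟨M, c, h1, h2, h3⟩ := exists_pWT_machine φ
  obtain ⟨F, ⟨R, f, a, hΓ, hf, hR⟩, hF, g, hg, hFg⟩ := h
  obtain ⟨C, hC⟩ := Turing.exists_length_output_le R.tm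
  obtain ⟨N, hN⟩ := NTM.exists_comp hΓ R.inputAlphabet R.outputAlphabet M
  -- The output is no longer than the input word, of length `|x| + k`, plus `C` symbols for each of
  -- the at most `f k * (|x| + 1) ^ a` steps.
  let G : ℕ → ℕ := fun k => 1 + k + C * f k
  have hG : Computable G :=
    ((Computable.const 1).natAdd Computable.id).natAdd ((Computable.const C).natMul hf)
  have len : ∀ (x : List P.alphabet) (k : ℕ),
      (encodeInstance (F (x, k))).length + 1 ≤ G k * (x.length + 1) ^ (a + 1) := by
    intro x k
    have h4 := hC _ _ _ (hR x k)
    rw [List.length_map, List.length_map, length_encodeInstance x k] at h4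
    have h5 : 1 ≤ (x.length + 1) ^ a := Nat.one_le_pow _ _ (Nat.succ_pos _)
    have h6 : (x.length + 1) ^ a * (x.length + 1) = (x.length + 1) ^ (a + 1) := rfl
    have h7 : x.length + 1 ≤ (x.length + 1) ^ (a + 1) := by nlinarith
    have h8 : (x.length + 1) ^ a ≤ (x.length + 1) ^ (a + 1) := by nlinarith
    have h9 := Nat.mul_le_mul_left (C * f k) h8
    have h10 := Nat.mul_le_mul_left k (h5.trans h8)
    change _ ≤ (1 + k + C * f k) * _
    rw [add_mul, add_mul]
    rw [← mul_assoc] at h4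
    omega
  -- The three summands stand for the reduction, the transfers and the second machine; the exponent
  -- `(a + 1) * (c + 1)` dominates `a`, `a + 1` and `(a + 1) * c`.
  refine ⟨N, fun k => f k + 2 * G k + c * G k ^ c, fun k => c * (g k * (G k + 2 * (a + 1))),
    (a + 1) * (c + 1), ((hf.natAdd ((Computable.const 2).natMul hG)).natAdd
      ((Computable.const c).natMul (hG.natPow c))), (Computable.const c).natMul
      (hg.natMul (hG.natAdd (Computable.const _))), fun x k => ?_⟩
  obtain ⟨acc, halt, nondet⟩ := hN _ _ _ (hR x k)
  refine ⟨acc.trans ((h1 _).trans (hF _).symm), fun ω => ?_, nondet _ (h3 _ _ fun y hy => ?_)⟩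
  · refine NTM.Halted.of_le (halt _ (h2 _) ω) ?_
    have hlen := len x k
    have h4 : ∀ b ≤ (a + 1) * (c + 1), (x.length + 1) ^ b ≤ (x.length + 1) ^ ((a + 1) * (c + 1)) :=
      fun b hb => Nat.pow_le_pow_right (Nat.succ_pos _) hb
    rw [add_mul, add_mul]
    refine Nat.add_le_add (Nat.add_le_add ?_ ?_) ?_
    · exact Nat.mul_le_mul_left _ (h4 _ (by nlinarith))
    · rw [mul_assoc]
      exact Nat.mul_le_mul_left _ (hlen.trans (Nat.mul_le_mul_left _ (h4 _ (by nlinarith))))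
    · rw [mul_assoc]
      refine Nat.mul_le_mul_left _ ((Nat.pow_le_pow_left hlen c).trans ?_)
      rw [mul_pow, ← pow_mul]
      exact Nat.mul_le_mul_left _ (h4 _ (Nat.mul_le_mul_left _ (Nat.le_succ c)))
  · have h4 : (F (x, k)).1.length ≤ G k * (x.length + 1) ^ (a + 1) := by
      refine le_trans ?_ (len x k)
      rw [length_encodeInstance]
      omega
    have h5 := clog_size_le (w := (F (x, k)).1) (k := (F (x, k)).2) h4 y hy
    rw [mul_assoc, mul_assoc]
    exact Nat.mul_le_mul_left _ (h5.trans (Nat.mul_le_mul_right _ (hFg (x, k))))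

end

theorem mainTheorem5 :
    (∀ (L : FirstOrder.Language.{0, 0}) [FinEnum (Σ r, L.Functions r)]
        [FinEnum (Σ r, L.Relations r)] (φ : InclusionFormula L),
      pWT φ ∈ WP ∧
      ∃ (M : NTM (Option Bool)) (c : ℕ),
        (∀ (w : List Bool) (k : ℕ),
          (M.Accepts (encodeInstance (w, k)) ↔ (w, k) ∈ (pWT φ).lang) ∧
          M.HaltsWithin (encodeInstance (w, k)) (c * (w.length + k + 1) ^ c)) ∧
        ∀ (n : ℕ) [NeZero n] [L.Structure (Fin n)] (k : ℕ),
          M.NondetStepsWithin (encodeInstance (encodeStructure L n, k))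
            (c * (k * Nat.clog 2 n))) ∧
    fptClosure pWTInclusion ⊆ WP := by
  refine ⟨fun L _ _ φ => ⟨pWT_mem_WP φ, exists_pWT_machine_poly φ⟩, ?_⟩
  rintro P ⟨Q, ⟨L, _, _, φ, rfl⟩, h⟩
  exact mem_WP_of_fptReducible_pWT φ h
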